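/- \textbf{Setting.} A fully dynamic algorithm on a vertex set of size $n\ge 1$ first preprocesses an arbitrary initial simple unweighted graph $G$ and then processes an arbitrary sequence of edge insertions and edge deletions (inserting a present edge or a self-loop, or deleting an absent edge, leaves the graph unchanged). The sequence of updates is fixed independently of the random choices of the algorithm (oblivious adversary). Let $\mathrm{ncc}(G)$ be the number of connected components of the current graph. We say that the algorithm \emph{maintains $\mathrm{ncc}$ up to additive error $\Delta$ with probability at least $1-p$} if it always holds a number $\overline{cc}$ such that, for every initial graph and every sequence of updates, at each point of time (after preprocessing and after each update) $\Pr\big[\,|\overline{cc}-\mathrm{ncc}(G)|\le \Delta\,\big]\ge 1-p$. The worst-case time per update is the maximum number of steps that one update takes, over all initial graphs, all update sequences and all random choices. Time is measured on a randomized word RAM with unit-cost operations, including the choice of a uniformly random element of $\{0,\dots,r-1\}$. Words have $w$ bits, where $w\ge K\log_2\!\big(2+n+\tfrac1\varepsilon+\log\tfrac1p\big)$ in part 1 and $w\ge K\log_2\!\big(2+n+\tfrac1\varepsilon\big)$ in part 2, for a constant $K$; the bounds hold for every such $w$. The program does not depend on $n$ and $w$, nor on $\varepsilon$ (and, in part 1,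 $p$), except that it receives, besides $n$, a constant number of words that depend only on $\varepsilon$ (and, in part 1, $p$). Preprocessing always terminates. $\log$ is the natural logarithm. \textbf{Theorem.} \begin{enumerate} \item There is such an algorithm that, for all $n\ge1$, $0<\varepsilon<1$ and $0<p<1$, maintains $\mathrm{ncc}$ up to additive error $\varepsilon n$ with probability at least $1-p$, in worst-case time per update $$O\!\left(\max\left\{1,\frac{\log(1/\varepsilon)\,\log(1/p)}{\varepsilon^{3}n}\right\}\right),$$ where the constant in $O(\cdot)$ is absolute. \item For every constant $c\ge1$ there is such an algorithm that, for all $n\ge 1$ and $\varepsilon>0$, maintains $\mathrm{ncc}$ up to additive error $\varepsilon n^{2/3}\log^{2/3}n$ with probability at least $1-n^{-c}$, in worst-case time per update $O(\max\{1,\varepsilon^{-3}\})$, where the constant in $O(\cdot)$ depends only on $c$. \end{enumerate} -/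

import Mathlib

/-! ### Randomized word RAM

Registers and memory cells hold `w`-bit words (natural numbers below `2 ^ w`).  A program is a
structured program over the usual unit-cost word instructions.  Every elementary transition,
control flow included, costs one step. -/

/-- Arithmetic and comparison instructions of the word RAM. -/
inductive WordOp where
  | add | sub | mul | div | mod | lt | eq

/-- The result of an arithmetic instruction on `w`-bit words: arithmetic is modulo `2 ^ w`
(subtraction is truncated at `0`, division by `0` gives `0`), comparisons give `0` or `1`. -/
def WordOp.eval (w : ℕ) : WordOp → ℕ → ℕ → ℕ
  | .add, x, y => (x + y) % 2 ^ w
  | .sub, x, y => (x - y) % 2 ^ w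
  | .mul, x, y => (x * y) % 2 ^ w
  | .div, x, y => (x / y) % 2 ^ w
  | .mod, x, y => (x % y) % 2 ^ w
  | .lt, x, y => (if x < y then 1 else 0) % 2 ^ w
  | .eq, x, y => (if x = y then 1 else 0) % 2 ^ w

/-- Programs of the randomized word RAM.  Arguments of instructions are register names, except
for the second argument of `const`, which is a literal. -/
inductive RamProg where
  /-- do nothing -/
  | skip
  /-- `reg d := c` -/
  | const (d c : ℕ)
  /-- `reg d := reg a (op) reg b` -/
  | op (o : WordOp) (d a b : ℕ)
  /-- `reg d := mem[reg a]` -/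
  | load (d a : ℕ)
  /-- `mem[reg a] := reg b` -/
  | store (a b : ℕ)
  /-- `reg d :=` a fresh uniformly random element of `{0, …, reg a - 1}` (`0` if `reg a = 0`) -/
  | rand (d a : ℕ)
  /-- first `P`, then `Q` -/
  | seq (P Q : RamProg)
  /-- if `reg a ≠ 0` then `P` else `Q` -/
  | ite (a : ℕ) (P Q : RamProg)
  /-- while `reg a ≠ 0` do `P` -/
  | loop (a : ℕ) (P : RamProg)

/-- Contents of the registers and of the memory. -/
structure RamState where
  reg : ℕ → ℕ
  mem : ℕ → ℕ

/-- Overwrite register `d`. -/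
def RamState.setReg (s : RamState) (d x : ℕ) : RamState :=
  { s with reg := Function.update s.reg d x }

/-- Overwrite memory cell `a`. -/
def RamState.setMem (s : RamState) (a x : ℕ) : RamState :=
  { s with mem := Function.update s.mem a x }

/-- A configuration: the (sub)programs still to be executed, in order, and the state.  For a fixed
program, only finitely many lists occur during its execution: the list is the program counter.
The machine has halted when the list is empty. -/
abbrev RamConfig := List RamProg × RamState

/-- One step of the machine with word length `w`; it is the identity on halted configurations. -/
noncomputable def RamConfig.step (w : ℕ) : RamConfig → PMF RamConfig
  | ([], s) => PMF.pure ([], s)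
  | (.skip :: k, s) => PMF.pure (k, s)
  | (.const d c :: k, s) => PMF.pure (k, s.setReg d (c % 2 ^ w))
  | (.op o d a b :: k, s) => PMF.pure (k, s.setReg d (o.eval w (s.reg a) (s.reg b)))
  | (.load d a :: k, s) => PMF.pure (k, s.setReg d (s.mem (s.reg a)))
  | (.store a b :: k, s) => PMF.pure (k, s.setMem (s.reg a) (s.reg b))
  | (.rand d a :: k, s) =>
      match s.reg a with
      | 0 => PMF.pure (k, s.setReg d 0)
      | m + 1 => (PMF.uniformOfFintype (Fin (m + 1))).map fun x => (k, s.setReg d x)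
  | (.seq P Q :: k, s) => PMF.pure (P :: Q :: k, s)
  | (.ite a P Q :: k, s) => PMF.pure (if s.reg a ≠ 0 then (P :: k, s) else (Q :: k, s))
  | (.loop a P :: k, s) => PMF.pure (if s.reg a ≠ 0 then (P :: .loop a P :: k, s) else (k, s))

/-- The law of the configuration after `T` steps, from configuration `c`. -/
noncomputable def RamConfig.run (w : ℕ) (c : RamConfig) : ℕ → PMF RamConfig
  | 0 => PMF.pure c
  | T + 1 => (RamConfig.run w c T).bind (RamConfig.step w)

/-- Started in state `s`, program `P` halts within `T` steps, for every outcome of the random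
choices. -/
def RamProg.HaltsWithin (w : ℕ) (P : RamProg) (T : ℕ) (s : RamState) : Prop :=
  ∀ c ∈ (RamConfig.run w ([P], s) T).support, c.1 = []

/-- The law of the state after running `P` for `T` steps from `s`.  If `P.HaltsWithin w T s`, this
is the law of the final state of `P`. -/
noncomputable def RamProg.after (w : ℕ) (P : RamProg) (T : ℕ) (s : RamState) : PMF RamState :=
  (RamConfig.run w ([P], s) T).map Prod.snd

/-! ### Dynamic graphs -/

/-- Edge updates of an unweighted graph on the vertices `0, …, n - 1`. -/
inductive EdgeUpdate (n : ℕ) where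
  | insert (u v : Fin n)
  | delete (u v : Fin n)

/-- The effect of an update on a simple graph.  Inserting a present edge or a self-loop and
deleting an absent edge leave the graph unchanged. -/
def EdgeUpdate.apply {n : ℕ} (G : SimpleGraph (Fin n)) : EdgeUpdate n → SimpleGraph (Fin n)
  | .insert u v => G ⊔ SimpleGraph.edge u v
  | .delete u v => G.deleteEdges {s(u, v)}

/-- The graph that results from `G` by a sequence of updates. -/
def updatedGraph {n : ℕ} (G : SimpleGraph (Fin n)) (ops : List (EdgeUpdate n)) :
    SimpleGraph (Fin n) :=
  ops.foldl EdgeUpdate.apply G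

/-- The number of connected components. -/
noncomputable def numCC {n : ℕ} (G : SimpleGraph (Fin n)) : ℕ :=
  Nat.card G.ConnectedComponent

/-! ### Fully dynamic algorithms -/

/-- A fully dynamic algorithm: a preprocessing program, run once on the initial graph, and an
update program, run once for each update.  Registers and memory persist between the runs. -/
structure DynamicAlgorithm where
  pre : RamProg
  upd : RamProg

open Classical in
/-- The input of the preprocessing program: register `1` holds `n`, registers `2, …, k + 1` hold
the `k` parameters, memory cell `u * n + v` holds the adjacency matrix entry at `(u, v)`; all other
registers and cells hold `0`. -/
noncomputable def initialState {k : ℕ} (par : Fin k → ℕ) {n : ℕ} (G : SimpleGraph (Fin n)) :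
    RamState where
  reg r := if r = 1 then n else if h : 2 ≤ r ∧ r - 2 < k then par ⟨r - 2, h.2⟩ else 0
  mem a := if ∃ u v : Fin n, a = u * n + v ∧ G.Adj u v then 1 else 0

/-- The update program is told the update by registers `1` (`0` for an insertion, `1` for a
deletion), `2` and `3` (the endpoints). -/
def RamState.receive {n : ℕ} (s : RamState) : EdgeUpdate n → RamState
  | .insert u v => ((s.setReg 1 0).setReg 2 u).setReg 3 v
  | .delete u v => ((s.setReg 1 1).setReg 2 u).setReg 3 v

/-- The law of the state of the algorithm after preprocessing the graph `G` (in `T₀` steps) and then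
processing the updates `ops` (each in `T` steps).  The sequence `ops` is fixed in advance: the
adversary is oblivious. -/
noncomputable def DynamicAlgorithm.law (A : DynamicAlgorithm) (w T₀ T : ℕ) {k : ℕ}
    (par : Fin k → ℕ) {n : ℕ} (G : SimpleGraph (Fin n)) (ops : List (EdgeUpdate n)) :
    PMF RamState :=
  ops.foldl (fun μ e => μ.bind fun s => A.upd.after w T (s.receive e))
    (A.pre.after w T₀ (initialState par G))

/-- On word length `w` and with parameters `par`, the algorithm maintains the number of connected
components of a fully dynamic graph on `n` vertices, with probability at least `1 - p` and up to an
additive error `err`, in worst-case time `T` per update: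
for every initial graph the preprocessing terminates, and after every sequence of updates
* each further update is processed within `T` steps, whatever the random choices were and will be;
* with probability at least `1 - p`, the value in register `0`, which is the estimator, differs from
  the number of connected components of the current graph by at most `err`. -/
def DynamicAlgorithm.MaintainsNumCC (A : DynamicAlgorithm) (w : ℕ) {k : ℕ} (par : Fin k → ℕ)
    (n : ℕ) (err p : ℝ) (T : ℕ) : Prop :=
  ∃ T₀ : ℕ, ∀ G : SimpleGraph (Fin n),
    A.pre.HaltsWithin w T₀ (initialState par G) ∧
    ∀ ops : List (EdgeUpdate n),
      (∀ s ∈ (A.law w T₀ T par G ops).support, ∀ e : EdgeUpdate n,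
        A.upd.HaltsWithin w T (s.receive e)) ∧
      ENNReal.ofReal (1 - p) ≤
        (A.law w T₀ T par G ops).toOuterMeasure
          {s | |(s.reg 0 : ℝ) - (numCC (updatedGraph G ops) : ℝ)| ≤ err}

/-! The number of components is the sum over all vertices `u` of `1 / c(u)`, where `c(u)` is the
size of the component of `u` (`SimpleGraph.sum_inv_compSize`), so it can be estimated by sampling
vertices. A sample draws a uniform vertex `u` and an independent uniform threshold `a` in `1, …,
Q²`; its value is `c(u)` if `c(u)² a ≤ Q²`, and `0` otherwise. Given `u`, the mean is `1 / c(u)` up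
to `1 / Q` (`le_sum_sampleValue`, `sum_sampleValue_le`), the value is at most `Q`, and the second
moment is at most `1` for every component size (`sum_sampleValue_sq_le`). The threshold also saves
time: a search stops once its number `k` of visited vertices satisfies `k² a > Q²`, and it takes
only about `k²` steps, because the arcs already scanned at a vertex lead to distinct visited
vertices (`Search.j_le`). So a search costs `O(Q² / a)`, which averages to `O(log Q)` by the
harmonic sum (`sum_exp_sampleCost_le`).

With `r = Q² l` samples, exponential moments bound three bad events by `exp (-l)` each: the sum is
too large, the sum is too small, the run needs more than `W = O(r log Q)` steps. The three
exponentials are added to a potential of the machine state that does not increase in expectation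
under a single machine-level step of the sampler (`sampleStep_spec`). It starts at no more than `3
exp (-l)` (`potential_init`) and is at least `1` if the run ends without a good estimate
(`one_le_or_near`), so Markov's inequality suffices.

An update changes the number of components by at most one (`numCC_apply_le`), so an estimate stays
useful for a number of updates proportional to `n / qb`. Time is cut into phases of `2H` updates,
`H` about `n / (16 qb)`. In the first half of a phase the stored graph catches up with the updates
of the previous phase, two at a time; in the second half it is frozen and the sampler runs `W / H +
1` steps per update; then the estimate is published. It is at most `4H` updates old when it is
replaced, so the cost per update is of order `qb³ l log Q / n`. If `n < 16 qb`, phases would be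
empty; then `Q = 8n` makes rounding exact, and everything is recomputed at each update.

For `p` near `1` the time has to shrink with `log (1/p)`, about `1 - p`. Then the estimate is
computed only with a coarser error `n / qb`, and one of `J` offsets is added at random, the windows
of radius `n / q` around the shifted values covering the coarse interval (`Params.exists_output`).
Success has probability at least `(1 - 3 exp (-l)) / J`, and `qb` is about `3q / J`. For `ε ≥ 1/2`
the constant answer `(n + 1) / 2` is good enough. In part 2, `l` and `log Q` are both `O(log n)`,
and `q³ log² n` is balanced against `n / ε³`; since `q` depends on `n`, the program computes it
itself (`IsRoot`).

On the formal side, `RamProg.Spec` is a Hoare triple that also bounds the expectation of a function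
of the final state, and `DynamicAlgorithm.maintainsNumCC_of_invariant` turns an invariant of laws
into the claim. -/

open scoped ENNReal

/-! ### Expectations with respect to discrete laws -/

/-- The expectation of a nonnegative function. -/
noncomputable def PMF.expect {α : Type*} (μ : PMF α) (f : α → ℝ≥0∞) : ℝ≥0∞ := ∑' a, μ a * f a

namespace PMF

variable {α β : Type*}

theorem expect_pure (a : α) (f : α → ℝ≥0∞) : (PMF.pure a).expect f = f a := by
  classical
  unfold expect
  rw [tsum_eq_single a]
  · simp [PMF.pure_apply]
  · intro b hb
    simp [PMF.pure_apply, hb]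

theorem expect_bind (μ : PMF α) (ν : α → PMF β) (f : β → ℝ≥0∞) :
    (μ.bind ν).expect f = μ.expect fun a => (ν a).expect f := by
  unfold expect
  simp only [PMF.bind_apply, ← ENNReal.tsum_mul_right, ← ENNReal.tsum_mul_left]
  rw [ENNReal.tsum_comm]
  simp only [mul_assoc]

theorem expect_map (μ : PMF α) (g : α → β) (f : β → ℝ≥0∞) :
    (μ.map g).expect f = μ.expect fun a => f (g a) := by
  simp only [PMF.map, expect_bind, Function.comp_def, expect_pure]

theorem expect_mono {μ : PMF α} {f g : α → ℝ≥0∞} (h : ∀ a ∈ μ.support, f a ≤ g a) :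
    μ.expect f ≤ μ.expect g := by
  refine ENNReal.tsum_le_tsum fun a => ?_
  by_cases ha : a ∈ μ.support
  · exact mul_le_mul_right (h a ha) _
  · have : μ a = 0 := by simpa [PMF.mem_support_iff] using ha
    simp [this]

theorem expect_const (μ : PMF α) (c : ℝ≥0∞) : (μ.expect fun _ => c) = c := by
  unfold expect
  rw [ENNReal.tsum_mul_right, μ.tsum_coe, one_mul]

theorem expect_add (μ : PMF α) (f g : α → ℝ≥0∞) :
    (μ.expect fun a => f a + g a) = μ.expect f + μ.expect g := by
  unfold expect
  simp only [mul_add, ENNReal.tsum_add]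

theorem expect_const_mul (μ : PMF α) (c : ℝ≥0∞) (f : α → ℝ≥0∞) :
    (μ.expect fun a => c * f a) = c * μ.expect f := by
  unfold expect
  rw [← ENNReal.tsum_mul_left]
  exact tsum_congr fun a => by ring

theorem expect_le_of_le {μ : PMF α} {f : α → ℝ≥0∞} {c : ℝ≥0∞} (h : ∀ a ∈ μ.support, f a ≤ c) :
    μ.expect f ≤ c :=
  (expect_mono h).trans_eq (expect_const μ c)

theorem expect_uniform_fin (m : ℕ) (f : Fin (m + 1) → ℝ≥0∞) :
    (PMF.uniformOfFintype (Fin (m + 1))).expect f = (∑ x, f x) / ((m + 1 : ℕ) : ℝ≥0∞) := by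
  unfold expect
  rw [tsum_fintype]
  simp only [PMF.uniformOfFintype_apply, Fintype.card_fin]
  rw [← Finset.mul_sum, mul_comm, ENNReal.div_eq_inv_mul, mul_comm]

/-- If the complement of `S` is unlikely, then `S` is likely. -/
theorem one_sub_le_toOuterMeasure (μ : PMF α) (S : Set α) {p : ℝ} (hp : 0 ≤ p)
    (f : α → ℝ≥0∞) (hf : ∀ a ∈ μ.support, a ∉ S → 1 ≤ f a)
    (h : μ.expect f ≤ ENNReal.ofReal p) :
    ENNReal.ofReal (1 - p) ≤ μ.toOuterMeasure S := by
  classical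
  have h1 : (1 : ℝ≥0∞) ≤ μ.toOuterMeasure S + ENNReal.ofReal p := by
    refine le_trans ?_ (add_le_add le_rfl h)
    rw [PMF.toOuterMeasure_apply, expect, ← ENNReal.tsum_add, ← μ.tsum_coe]
    refine ENNReal.tsum_le_tsum fun a => ?_
    by_cases ha : a ∈ S
    · simp [ha]
    · by_cases hs : a ∈ μ.support
      · simp only [Set.indicator, ha, if_false, zero_add]
        calc μ a = μ a * 1 := (mul_one _).symm
          _ ≤ _ := mul_le_mul_right (hf a hs ha) _
      · have : μ a = 0 := by simpa [PMF.mem_support_iff] using hs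
        simp [this]
  rw [ENNReal.ofReal_sub _ hp, ENNReal.ofReal_one]
  exact tsub_le_iff_right.mpr h1

theorem bind_congr_support {μ : PMF α} {ν ν' : α → PMF β} (h : ∀ a ∈ μ.support, ν a = ν' a) :
    μ.bind ν = μ.bind ν' := by
  ext b
  simp only [PMF.bind_apply]
  refine tsum_congr fun a => ?_
  by_cases ha : a ∈ μ.support
  · rw [h a ha]
  · have : μ a = 0 := by simpa [PMF.mem_support_iff] using ha
    simp [this]

end PMF

/-! ### Big-step semantics -/

namespace RamConfig

variable {w : ℕ}

theorem step_nil (s : RamState) : RamConfig.step w ([], s) = PMF.pure ([], s) := rfl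

/-- `run` appends a step at the end, whereas `Halts` peels off the first one. Associativity of
`bind` reconciles the two. -/
theorem run_succ (c : RamConfig) (T : ℕ) :
    c.run w (T + 1) = (c.step w).bind fun c' => c'.run w T := by
  induction T generalizing c with
  | zero => simp [run]
  | succ T ih =>
    rw [run, ih, PMF.bind_bind]
    rfl

/-- Configuration `c` halts within `T` steps and the law of its final state is `μ`. -/
inductive Halts (w : ℕ) : RamConfig → ℕ → PMF RamState → Prop
  | nil (s : RamState) (T : ℕ) : Halts w ([], s) T (PMF.pure s)
  | step (c : RamConfig) (T : ℕ) (ν : RamConfig → PMF RamState)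
      (h : ∀ c' ∈ (c.step w).support, Halts w c' T (ν c')) :
      Halts w c (T + 1) ((c.step w).bind ν)

/-- Halted configurations are fixed by `step`, so surplus time is harmless and branches of different
length can be merged. -/
theorem Halts.run_eq {c : RamConfig} {T : ℕ} {μ : PMF RamState} (h : Halts w c T μ) :
    c.run w T = μ.map fun s => ([], s) := by
  induction h with
  | nil s T =>
    rw [PMF.pure_map]
    induction T with
    | zero => rfl
    | succ T ih => rw [run, ih, PMF.pure_bind, step_nil]
  | step c T ν _ ih =>
    rw [run_succ, PMF.map_bind]
    exact PMF.bind_congr_support ih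

theorem Halts.mono {c : RamConfig} {T T' : ℕ} {μ : PMF RamState} (h : Halts w c T μ)
    (hT : T ≤ T') : Halts w c T' μ := by
  induction h generalizing T' with
  | nil s T => exact .nil s T'
  | step c T ν _ ih =>
    obtain ⟨T'', rfl⟩ : ∃ T'', T' = T'' + 1 := ⟨T' - 1, by omega⟩
    exact .step c T'' ν fun c' hc' => ih c' hc' (by omega)

theorem Halts.step_pure {c c' : RamConfig} {T : ℕ} {μ : PMF RamState}
    (hs : c.step w = PMF.pure c') (h : Halts w c' T μ) : Halts w c (T + 1) μ := by
  have := Halts.step (w := w) c T (fun _ => μ) (by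
    intro d hd
    rw [hs, PMF.support_pure, Set.mem_singleton_iff] at hd
    exact hd ▸ h)
  rwa [hs, PMF.pure_bind] at this

end RamConfig

namespace RamProg

variable {w : ℕ}

/-- From state `s`, program `P` takes at most `T` steps, and `μ` is the law of its final state. -/
def Big (w : ℕ) (P : RamProg) (s : RamState) (T : ℕ) (μ : PMF RamState) : Prop :=
  ∀ (k : List RamProg) (T' : ℕ) (ν : RamState → PMF RamState),
    (∀ s' ∈ μ.support, RamConfig.Halts w (k, s') T' (ν s')) →
      RamConfig.Halts w (P :: k, s) (T + T') (μ.bind ν)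

/-- `Big` quantifies over the continuation `k`, which makes composition immediate; the empty
continuation returns to complete runs. -/
theorem Big.halts {P : RamProg} {s : RamState} {T : ℕ} {μ : PMF RamState} (h : Big w P s T μ) :
    RamConfig.Halts w ([P], s) T μ := by
  have := h [] 0 PMF.pure fun s' _ => .nil s' 0
  rwa [PMF.bind_pure] at this

theorem Big.haltsWithin {P : RamProg} {s : RamState} {T : ℕ} {μ : PMF RamState}
    (h : Big w P s T μ) : P.HaltsWithin w T s := by
  intro c hc
  rw [h.halts.run_eq, PMF.support_map] at hc
  obtain ⟨s', -, rfl⟩ := hc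
  rfl

theorem Big.after_eq {P : RamProg} {s : RamState} {T : ℕ} {μ : PMF RamState}
    (h : Big w P s T μ) : P.after w T s = μ := by
  rw [after, h.halts.run_eq, PMF.map_comp]
  exact PMF.map_id μ

theorem Big.mono {P : RamProg} {s : RamState} {T T' : ℕ} {μ : PMF RamState}
    (h : Big w P s T μ) (hT : T ≤ T') : Big w P s T' μ := fun k T'' ν hk =>
  (h k T'' ν hk).mono (by omega)

theorem big_of_step {P : RamProg} {s s' : RamState}
    (h : ∀ k, RamConfig.step w (P :: k, s) = PMF.pure (k, s')) : Big w P s 1 (PMF.pure s') := by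
  intro k T' ν hk
  rw [PMF.pure_bind, add_comm]
  exact RamConfig.Halts.step_pure (h k) (hk s' (by simp))

theorem Big.seq {P Q : RamProg} {s : RamState} {T₁ T₂ : ℕ} {μ : PMF RamState}
    {ν : RamState → PMF RamState} (hP : Big w P s T₁ μ)
    (hQ : ∀ s' ∈ μ.support, Big w Q s' T₂ (ν s')) : Big w (.seq P Q) s (T₁ + T₂ + 1) (μ.bind ν) := by
  intro k T' ξ hk
  have h1 : RamConfig.Halts w (P :: Q :: k, s) (T₁ + (T₂ + T'))
      (μ.bind fun s' => (ν s').bind ξ) := by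
    refine hP _ _ _ fun s' hs' => hQ s' hs' k T' ξ fun s'' hs'' => hk s'' ?_
    rw [PMF.mem_support_bind_iff]
    exact ⟨s', hs', hs''⟩
  rw [PMF.bind_bind, show T₁ + T₂ + 1 + T' = T₁ + (T₂ + T') + 1 by omega]
  exact RamConfig.Halts.step_pure rfl h1

theorem Big.ite_pos {P Q : RamProg} {s : RamState} {a T : ℕ} {μ : PMF RamState}
    (ha : s.reg a ≠ 0) (hP : Big w P s T μ) : Big w (.ite a P Q) s (T + 1) μ := by
  intro k T' ν hk
  rw [show T + 1 + T' = T + T' + 1 by omega]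
  exact RamConfig.Halts.step_pure (by simp [RamConfig.step, ha]) (hP k T' ν hk)

theorem Big.ite_neg {P Q : RamProg} {s : RamState} {a T : ℕ} {μ : PMF RamState}
    (ha : s.reg a = 0) (hQ : Big w Q s T μ) : Big w (.ite a P Q) s (T + 1) μ := by
  intro k T' ν hk
  rw [show T + 1 + T' = T + T' + 1 by omega]
  exact RamConfig.Halts.step_pure (by simp [RamConfig.step, ha]) (hQ k T' ν hk)

theorem big_loop_zero {P : RamProg} {s : RamState} {a : ℕ} (ha : s.reg a = 0) :
    Big w (.loop a P) s 1 (PMF.pure s) :=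
  big_of_step fun k => by simp [RamConfig.step, ha]

theorem Big.loop_succ {P : RamProg} {s : RamState} {a T₁ T₂ : ℕ} {μ : PMF RamState}
    {ν : RamState → PMF RamState} (ha : s.reg a ≠ 0) (hP : Big w P s T₁ μ)
    (hQ : ∀ s' ∈ μ.support, Big w (.loop a P) s' T₂ (ν s')) :
    Big w (.loop a P) s (T₁ + T₂ + 1) (μ.bind ν) := by
  intro k T' ξ hk
  have h1 : RamConfig.Halts w (P :: .loop a P :: k, s) (T₁ + (T₂ + T'))
      (μ.bind fun s' => (ν s').bind ξ) := by
    refine hP _ _ _ fun s' hs' => hQ s' hs' k T' ξ fun s'' hs'' => hk s'' ?_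
    rw [PMF.mem_support_bind_iff]
    exact ⟨s', hs', hs''⟩
  rw [PMF.bind_bind, show T₁ + T₂ + 1 + T' = T₁ + (T₂ + T') + 1 by omega]
  exact RamConfig.Halts.step_pure (by simp [RamConfig.step, ha]) h1

theorem big_rand {s : RamState} {d a m : ℕ} (ha : s.reg a = m + 1) :
    Big w (.rand d a) s 1
      ((PMF.uniformOfFintype (Fin (m + 1))).map fun x : Fin (m + 1) => s.setReg d x) := by
  intro k T' ν hk
  have hs : RamConfig.step w (.rand d a :: k, s) =
      (PMF.uniformOfFintype (Fin (m + 1))).map fun x : Fin (m + 1) => ((k, s.setReg d x) : RamConfig) := by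
    simp only [RamConfig.step]
    split
    · omega
    · rename_i m' hm'
      obtain rfl : m = m' := by omega
      -- In `step` the uniform law on `Fin (m + 1)` was coerced to a law on `ℕ` before being mapped;
      -- writing the coercion as a `bind` allows the two maps to be fused.
      change PMF.map _ ((PMF.uniformOfFintype (Fin (m + 1))).bind fun x => PMF.pure (x : ℕ)) = _
      rw [PMF.map_bind]
      simp only [PMF.pure_map]
      rfl
  have := RamConfig.Halts.step (w := w) (.rand d a :: k, s) T' (fun c => ν c.2) (by
    intro c hc
    rw [hs, PMF.support_map] at hc
    obtain ⟨x, hx, rfl⟩ := hc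
    exact hk _ (by rw [PMF.support_map]; exact ⟨x, hx, rfl⟩))
  rw [hs, PMF.bind_map] at this
  rw [PMF.bind_map, add_comm]
  exact this

/-! ### Registers that a program does not write -/

/-- Program `P` never writes register `r`. -/
def Avoids (r : ℕ) : RamProg → Prop
  | .skip => True
  | .const d _ => r ≠ d
  | .op _ d _ _ => r ≠ d
  | .load d _ => r ≠ d
  | .store _ _ => True
  | .rand d _ => r ≠ d
  | .seq P Q => P.Avoids r ∧ Q.Avoids r
  | .ite _ P Q => P.Avoids r ∧ Q.Avoids r
  | .loop _ P => P.Avoids r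

end RamProg

/-- The basis of all frame arguments: which registers survive a program is read off its syntax, so
that specifications need to mention only what changes. -/
theorem RamConfig.step_avoids {w r : ℕ} {c : RamConfig} (hc : ∀ P ∈ c.1, P.Avoids r)
    {c' : RamConfig} (h : c' ∈ (c.step w).support) :
    (∀ P ∈ c'.1, P.Avoids r) ∧ c'.2.reg r = c.2.reg r := by
  obtain ⟨l, s⟩ := c
  cases l with
  | nil =>
    rw [step_nil, PMF.support_pure, Set.mem_singleton_iff] at h
    subst h
    exact ⟨hc, rfl⟩
  | cons P k =>
    have hk : ∀ R ∈ k, R.Avoids r := fun R hR => hc R (List.mem_cons_of_mem _ hR)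
    have hP : P.Avoids r := hc P List.mem_cons_self
    cases P with
    | rand d a =>
      have hd : r ≠ d := hP
      simp only [RamConfig.step] at h
      split at h
      · simp only [PMF.support_pure, Set.mem_singleton_iff] at h
        subst h
        exact ⟨hk, by simp [RamState.setReg, Function.update_of_ne hd]⟩
      · rw [PMF.support_map] at h
        obtain ⟨x, -, rfl⟩ := h
        exact ⟨hk, by simp [RamState.setReg, Function.update_of_ne hd]⟩
    | const d a =>
      simp only [RamConfig.step, PMF.support_pure, Set.mem_singleton_iff] at h
      subst h
      exact ⟨hk, by simp [RamState.setReg, Function.update_of_ne (show r ≠ d from hP)]⟩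
    | op o d a b =>
      simp only [RamConfig.step, PMF.support_pure, Set.mem_singleton_iff] at h
      subst h
      exact ⟨hk, by simp [RamState.setReg, Function.update_of_ne (show r ≠ d from hP)]⟩
    | load d a =>
      simp only [RamConfig.step, PMF.support_pure, Set.mem_singleton_iff] at h
      subst h
      exact ⟨hk, by simp [RamState.setReg, Function.update_of_ne (show r ≠ d from hP)]⟩
    | store a b =>
      simp only [RamConfig.step, PMF.support_pure, Set.mem_singleton_iff] at h
      subst h
      exact ⟨hk, rfl⟩
    | skip =>
      simp only [RamConfig.step, PMF.support_pure, Set.mem_singleton_iff] at h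
      subst h
      exact ⟨hk, rfl⟩
    | seq P Q =>
      simp only [RamConfig.step, PMF.support_pure, Set.mem_singleton_iff] at h
      subst h
      refine ⟨?_, rfl⟩
      simp only [List.mem_cons, forall_eq_or_imp]
      exact ⟨hP.1, hP.2, hk⟩
    | ite a P Q =>
      simp only [RamConfig.step, PMF.support_pure, Set.mem_singleton_iff] at h
      subst h
      split_ifs
      · refine ⟨?_, rfl⟩
        simp only [List.mem_cons, forall_eq_or_imp]
        exact ⟨hP.1, hk⟩
      · refine ⟨?_, rfl⟩
        simp only [List.mem_cons, forall_eq_or_imp]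
        exact ⟨hP.2, hk⟩
    | loop a P =>
      simp only [RamConfig.step, PMF.support_pure, Set.mem_singleton_iff] at h
      subst h
      split_ifs
      · refine ⟨?_, rfl⟩
        simp only [List.mem_cons, forall_eq_or_imp]
        exact ⟨hP, hP, hk⟩
      · exact ⟨hk, rfl⟩

theorem RamConfig.Halts.avoids {w r : ℕ} {c : RamConfig} {T : ℕ} {μ : PMF RamState}
    (h : RamConfig.Halts w c T μ) (hc : ∀ P ∈ c.1, P.Avoids r) :
    ∀ s' ∈ μ.support, s'.reg r = c.2.reg r := by
  induction h with
  | nil s T => simp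
  | step c T ν _ ih =>
    intro s' hs'
    rw [PMF.mem_support_bind_iff] at hs'
    obtain ⟨c', hc', hs'⟩ := hs'
    obtain ⟨h1, h2⟩ := RamConfig.step_avoids hc hc'
    rw [ih c' hc' h1 s' hs', h2]

namespace RamProg

variable {w : ℕ}

theorem Big.frame {P : RamProg} {s : RamState} {T : ℕ} {μ : PMF RamState}
    (h : Big w P s T μ) {r : ℕ} (hr : P.Avoids r) : ∀ s' ∈ μ.support, s'.reg r = s.reg r :=
  h.halts.avoids (by simpa using hr)

/-! ### Weakest preconditions of straight-line programs -/

end RamProg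

namespace RamState

variable (s : RamState) (d x r : ℕ)

theorem reg_setReg : (s.setReg d x).reg r = if r = d then x else s.reg r := by
  simp [setReg, Function.update_apply]

theorem mem_setReg : (s.setReg d x).mem = s.mem := rfl

theorem reg_setMem : (s.setMem d x).reg = s.reg := rfl

theorem mem_setMem : (s.setMem d x).mem = Function.update s.mem d x := rfl

end RamState

namespace RamProg

variable {w : ℕ}

/-- A precondition under which the program (without loops and random choices) does not overflow
and establishes `Q`. -/
def wp (w : ℕ) : RamProg → (RamState → Prop) → RamState → Prop
  | .skip, Q, s => Q s
  | .const d c, Q, s => c < 2 ^ w ∧ Q (s.setReg d c)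
  | .op .add d a b, Q, s => s.reg a + s.reg b < 2 ^ w ∧ Q (s.setReg d (s.reg a + s.reg b))
  | .op .sub d a b, Q, s => s.reg a - s.reg b < 2 ^ w ∧ Q (s.setReg d (s.reg a - s.reg b))
  | .op .mul d a b, Q, s => s.reg a * s.reg b < 2 ^ w ∧ Q (s.setReg d (s.reg a * s.reg b))
  | .op .div d a b, Q, s => s.reg a / s.reg b < 2 ^ w ∧ Q (s.setReg d (s.reg a / s.reg b))
  | .op .mod d a b, Q, s => s.reg a % s.reg b < 2 ^ w ∧ Q (s.setReg d (s.reg a % s.reg b))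
  | .op .lt d a b, Q, s => 1 < 2 ^ w ∧ (s.reg a < s.reg b → Q (s.setReg d 1)) ∧
      (s.reg b ≤ s.reg a → Q (s.setReg d 0))
  | .op .eq d a b, Q, s => 1 < 2 ^ w ∧ (s.reg a = s.reg b → Q (s.setReg d 1)) ∧
      (s.reg a ≠ s.reg b → Q (s.setReg d 0))
  | .load d a, Q, s => Q (s.setReg d (s.mem (s.reg a)))
  | .store a b, Q, s => Q (s.setMem (s.reg a) (s.reg b))
  | .rand _ _, _, _ => False
  | .seq P R, Q, s => P.wp w (R.wp w Q) s
  | .ite a P R, Q, s => (s.reg a ≠ 0 → P.wp w Q s) ∧ (s.reg a = 0 → R.wp w Q s)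
  | .loop _ _, _, _ => False

/-- A bound on the running time of a program without loops. -/
def cost : RamProg → ℕ
  | .seq P Q => P.cost + Q.cost + 1
  | .ite _ P Q => max P.cost Q.cost + 1
  | _ => 1

/-- Soundness of `wp`: its side conditions exclude overflow, so that arithmetic modulo `2 ^ w` is
exact, and execution is deterministic. -/
theorem exists_big_of_wp {P : RamProg} {Q : RamState → Prop} {s : RamState} (h : P.wp w Q s) :
    ∃ s', Big w P s P.cost (PMF.pure s') ∧ Q s' := by
  induction P generalizing Q s with
  | skip => exact ⟨s, big_of_step fun k => rfl, h⟩
  | const d c =>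
    refine ⟨_, big_of_step fun k => ?_, h.2⟩
    simp [RamConfig.step, Nat.mod_eq_of_lt h.1]
  | op o d a b =>
    cases o with
    | lt =>
      obtain ⟨h0, h1, h2⟩ := h
      by_cases hab : s.reg a < s.reg b
      · refine ⟨_, big_of_step fun k => ?_, h1 hab⟩
        simp [RamConfig.step, WordOp.eval, hab, Nat.mod_eq_of_lt h0]
      · refine ⟨_, big_of_step fun k => ?_, h2 (not_lt.mp hab)⟩
        simp [RamConfig.step, WordOp.eval, hab]
    | eq =>
      obtain ⟨h0, h1, h2⟩ := h
      by_cases hab : s.reg a = s.reg b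
      · refine ⟨_, big_of_step fun k => ?_, h1 hab⟩
        simp [RamConfig.step, WordOp.eval, hab, Nat.mod_eq_of_lt h0]
      · refine ⟨_, big_of_step fun k => ?_, h2 hab⟩
        simp [RamConfig.step, WordOp.eval, hab]
    | _ =>
      refine ⟨_, big_of_step fun k => ?_, h.2⟩
      simp [RamConfig.step, WordOp.eval, Nat.mod_eq_of_lt h.1]
  | load d a => exact ⟨_, big_of_step fun k => rfl, h⟩
  | store a b => exact ⟨_, big_of_step fun k => rfl, h⟩
  | rand d a => exact h.elim
  | seq P R ihP ihR =>
    obtain ⟨s₁, h1, h2⟩ := ihP h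
    obtain ⟨s₂, h3, h4⟩ := ihR h2
    refine ⟨s₂, ?_, h4⟩
    have := Big.seq (ν := fun _ => PMF.pure s₂) h1 (by
      intro s' hs'
      rw [PMF.support_pure, Set.mem_singleton_iff] at hs'
      exact hs' ▸ h3)
    rwa [PMF.pure_bind] at this
  | ite a P R ihP ihR =>
    by_cases ha : s.reg a = 0
    · obtain ⟨s', h1, h2⟩ := ihR (h.2 ha)
      exact ⟨s', Big.ite_neg ha (h1.mono (le_max_right _ _)), h2⟩
    · obtain ⟨s', h1, h2⟩ := ihP (h.1 ha)
      exact ⟨s', Big.ite_pos ha (h1.mono (le_max_left _ _)), h2⟩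
  | loop a P => exact h.elim

/-! ### Specifications -/

/-- Within `T` steps, program `P` started in `s` ends in a state that satisfies `Q`, and the
expectation of `f` over the final state is at most `c`. -/
def Spec (w : ℕ) (P : RamProg) (s : RamState) (T : ℕ) (Q : RamState → Prop)
    (f : RamState → ℝ≥0∞) (c : ℝ≥0∞) : Prop :=
  ∃ μ, Big w P s T μ ∧ (∀ s' ∈ μ.support, Q s') ∧ μ.expect f ≤ c

variable {P R : RamProg} {s : RamState} {T T₁ T₂ : ℕ} {Q Q' : RamState → Prop}
  {f f' : RamState → ℝ≥0∞} {c c' : ℝ≥0∞}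

theorem Spec.mono_time (h : Spec w P s T Q f c) (hT : T ≤ T₁) : Spec w P s T₁ Q f c := by
  obtain ⟨μ, h1, h2, h3⟩ := h
  exact ⟨μ, h1.mono hT, h2, h3⟩

theorem Spec.conseq (h : Spec w P s T Q f c) (hQ : ∀ s', Q s' → Q' s')
    (hf : ∀ s', Q s' → f' s' ≤ f s') (hc : c ≤ c') : Spec w P s T Q' f' c' := by
  obtain ⟨μ, h1, h2, h3⟩ := h
  exact ⟨μ, h1, fun s' hs' => hQ s' (h2 s' hs'),
    (PMF.expect_mono fun s' hs' => hf s' (h2 s' hs')).trans (h3.trans hc)⟩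

theorem Spec.frame (h : Spec w P s T Q f c) :
    Spec w P s T (fun s' => Q s' ∧ ∀ r, P.Avoids r → s'.reg r = s.reg r) f c := by
  obtain ⟨μ, h1, h2, h3⟩ := h
  exact ⟨μ, h1, fun s' hs' => ⟨h2 s' hs', fun r hr => h1.frame hr s' hs'⟩, h3⟩

/-- Expectations with affine rescaling. -/
theorem Spec.affine (h : Spec w P s T Q f c) (a b : ℝ≥0∞) :
    Spec w P s T Q (fun s' => a + b * f s') (a + b * c) := by
  obtain ⟨μ, h1, h2, h3⟩ := h
  refine ⟨μ, h1, h2, ?_⟩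
  rw [PMF.expect_add, PMF.expect_const, PMF.expect_const_mul]
  exact add_le_add_right (mul_le_mul_right h3 _) _

theorem Spec.of_wp (h : P.wp w (fun s' => Q s' ∧ f s' ≤ c) s) : Spec w P s P.cost Q f c := by
  obtain ⟨s', h1, h2, h3⟩ := exists_big_of_wp h
  refine ⟨_, h1, ?_, by rwa [PMF.expect_pure]⟩
  intro t ht
  rw [PMF.support_pure, Set.mem_singleton_iff] at ht
  exact ht ▸ h2

theorem Spec.skip (h : Q s) (hf : f s ≤ c) : Spec w .skip s 1 Q f c :=
  Spec.of_wp (P := .skip) ⟨h, hf⟩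

/-- Chooses a law of the final state for each intermediate state; states that violate `Q` get an
irrelevant value, since they lie outside the support. -/
theorem Spec.bind_aux {μ : PMF RamState} {g : RamState → ℝ≥0∞} 
    (hQ : ∀ s', Q s' → Spec w R s' T₂ Q' f (g s')) (h2 : ∀ s' ∈ μ.support, Q s')
    (h3 : μ.expect g ≤ c) :
    ∃ ν : RamState → PMF RamState, (∀ s' ∈ μ.support, Big w R s' T₂ (ν s')) ∧
      (∀ s' ∈ (μ.bind ν).support, Q' s') ∧ (μ.bind ν).expect f ≤ c := by
  classical
  have : ∀ s', ∃ ν, Q s' → Big w R s' T₂ ν ∧ (∀ t ∈ ν.support, Q' t) ∧ ν.expect f ≤ g s' := by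
    intro s'
    by_cases h : Q s'
    · obtain ⟨ν, hν⟩ := hQ s' h
      exact ⟨ν, fun _ => hν⟩
    · exact ⟨PMF.pure s', fun h' => absurd h' h⟩
  choose ν hν using this
  refine ⟨ν, fun s' hs' => (hν s' (h2 s' hs')).1, ?_, ?_⟩
  · intro t ht
    rw [PMF.mem_support_bind_iff] at ht
    obtain ⟨s', hs', ht⟩ := ht
    exact (hν s' (h2 s' hs')).2.1 t ht
  · rw [PMF.expect_bind]
    exact (PMF.expect_mono fun s' hs' => (hν s' (h2 s' hs')).2.2).trans h3

/-- The law of total expectation: the bound `g` for the second program, as a function of its initial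
state, is the function whose expectation the first program has to control. -/
theorem Spec.seq {g : RamState → ℝ≥0∞} (hP : Spec w P s T₁ Q g c)
    (hR : ∀ s', Q s' → Spec w R s' T₂ Q' f (g s')) :
    Spec w (.seq P R) s (T₁ + T₂ + 1) Q' f c := by
  obtain ⟨μ, h1, h2, h3⟩ := hP
  obtain ⟨ν, h4, h5, h6⟩ := Spec.bind_aux hR h2 h3
  exact ⟨_, h1.seq h4, h5, h6⟩

theorem Spec.ite {a : ℕ} (hP : s.reg a ≠ 0 → Spec w P s T Q f c)
    (hR : s.reg a = 0 → Spec w R s T Q f c) : Spec w (.ite a P R) s (T + 1) Q f c := by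
  by_cases ha : s.reg a = 0
  · obtain ⟨μ, h1, h2⟩ := hR ha
    exact ⟨μ, h1.ite_neg ha, h2⟩
  · obtain ⟨μ, h1, h2⟩ := hP ha
    exact ⟨μ, h1.ite_pos ha, h2⟩

theorem Spec.rand {d a : ℕ} (ha : s.reg a ≠ 0) (hQ : ∀ x < s.reg a, Q (s.setReg d x)) :
    Spec w (.rand d a) s 1 Q f
      ((∑ x ∈ Finset.range (s.reg a), f (s.setReg d x)) / (s.reg a : ℝ≥0∞)) := by
  obtain ⟨m, hm⟩ := Nat.exists_eq_succ_of_ne_zero ha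
  refine ⟨_, big_rand hm, ?_, ?_⟩
  · intro s' hs'
    rw [PMF.support_map] at hs'
    obtain ⟨x, -, rfl⟩ := hs'
    exact hQ x (by omega)
  · rw [PMF.expect_map, PMF.expect_uniform_fin, hm, Finset.sum_range]

/-- A loop whose body decreases a natural number: rule with a potential. -/
theorem Spec.loop {a : ℕ} (I : ℕ → RamState → Prop) (g : ℕ → RamState → ℝ≥0∞)
    (h0 : ∀ s, I 0 s → s.reg a = 0) (hpos : ∀ m s, I (m + 1) s → s.reg a ≠ 0)
    (hI : ∀ m s, I (m + 1) s → Spec w P s T (I m) (g m) (g (m + 1) s)) :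
    ∀ m s, I m s → Spec w (.loop a P) s (m * (T + 1) + 1) (I 0) (g 0) (g m s) := by
  intro m
  induction m with
  | zero =>
    intro s hs
    refine ⟨_, (big_loop_zero (h0 s hs)).mono (by omega), ?_, (PMF.expect_pure _ _).le⟩
    intro t ht
    rw [PMF.support_pure, Set.mem_singleton_iff] at ht
    exact ht ▸ hs
  | succ m ih =>
    intro s hs
    obtain ⟨μ, h1, h2, h3⟩ := hI m s hs
    obtain ⟨ν, h4, h5, h6⟩ := Spec.bind_aux ih h2 h3
    exact ⟨_, (h1.loop_succ (hpos m s hs) h4).mono (by ring_nf; omega), h5, h6⟩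

/-- Specifications without an expectation. -/
theorem Spec.of_wp' (h : P.wp w Q s) : Spec w P s P.cost Q (fun _ => 0) 0 := by
  refine Spec.of_wp ?_
  obtain ⟨s', h1, h2⟩ := exists_big_of_wp h
  simpa using h

end RamProg

/-! ### From invariants to dynamic algorithms -/

/-- A family of properties of laws, indexed by the updates so far, that is established by the
preprocessing and preserved by the updates. -/
theorem DynamicAlgorithm.maintainsNumCC_of_invariant {A : DynamicAlgorithm} {w T k n : ℕ}
    {par : Fin k → ℕ} {err p : ℝ} (hp : 0 ≤ p)
    (I : SimpleGraph (Fin n) → List (EdgeUpdate n) → PMF RamState → Prop)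
    (hpre : ∀ G, ∃ T₀ μ, A.pre.Big w (initialState par G) T₀ μ ∧ I G [] μ)
    (hupd : ∀ G ops e μ, I G ops μ → ∃ ν : RamState → PMF RamState,
      (∀ s ∈ μ.support, A.upd.Big w (s.receive e) T (ν s)) ∧ I G (ops ++ [e]) (μ.bind ν))
    (hgood : ∀ G ops μ, I G ops μ → ∃ f : RamState → ℝ≥0∞, μ.expect f ≤ ENNReal.ofReal p ∧
      ∀ s ∈ μ.support,
        ¬ |(s.reg 0 : ℝ) - (numCC (updatedGraph G ops) : ℝ)| ≤ err → 1 ≤ f s) :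
    A.MaintainsNumCC w par n err p T := by
  classical
  choose T₁ μ₁ h1 h2 using hpre
  have : Fintype (SimpleGraph (Fin n)) := Fintype.ofFinite _
  -- There are finitely many graphs on `Fin n`, so the sum of their preprocessing times is a common
  -- bound.
  set T₀ := ∑ G, T₁ G with hT₀
  have hT : ∀ G, T₁ G ≤ T₀ := fun G => Finset.single_le_sum (f := T₁) (fun _ _ => Nat.zero_le _)
    (Finset.mem_univ G)
  refine ⟨T₀, fun G => ?_⟩
  have hb := (h1 G).mono (hT G)
  have key : ∀ ops, I G ops (A.law w T₀ T par G ops) := by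
    intro ops
    induction ops using List.reverseRecOn with
    | nil =>
      rw [DynamicAlgorithm.law, List.foldl_nil, hb.after_eq]
      exact h2 G
    | append_singleton ops e ih =>
      obtain ⟨ν, h3, h4⟩ := hupd G ops e _ ih
      rw [DynamicAlgorithm.law, List.foldl_append, List.foldl_cons, List.foldl_nil]
      change I G (ops ++ [e]) ((A.law w T₀ T par G ops).bind _)
      rwa [PMF.bind_congr_support (ν' := ν) fun s hs => (h3 s hs).after_eq]
  refine ⟨hb.haltsWithin, fun ops => ⟨fun s hs e => ?_, ?_⟩⟩
  · obtain ⟨ν, h3, -⟩ := hupd G ops e _ (key ops)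
    exact (h3 s hs).haltsWithin
  · obtain ⟨f, h3, h4⟩ := hgood G ops _ (key ops)
    exact PMF.one_sub_le_toOuterMeasure _ _ hp f h4 h3

/-! ### The number of connected components -/

namespace SimpleGraph

variable {V : Type*} {G : SimpleGraph V}

/-- A connection can be chosen to use the new edge at most once, in one of its two directions. The
induction along the walk drops all earlier uses. -/
theorem Reachable.of_sup_edge {u v x y : V} (h : (G ⊔ edge u v).Reachable x y) :
    G.Reachable x y ∨ (G.Reachable x u ∧ G.Reachable v y) ∨
      (G.Reachable x v ∧ G.Reachable u y) := by
  obtain ⟨p⟩ := h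
  induction p with
  | nil => exact .inl (Reachable.refl _)
  | cons hadj _ ih =>
    rw [sup_adj, edge_adj] at hadj
    rcases hadj with hadj | ⟨⟨rfl, rfl⟩ | ⟨rfl, rfl⟩, -⟩
    · have := hadj.reachable
      rcases ih with h | ⟨h1, h2⟩ | ⟨h1, h2⟩
      · exact .inl (this.trans h)
      · exact .inr (.inl ⟨this.trans h1, h2⟩)
      · exact .inr (.inr ⟨this.trans h1, h2⟩)
    · rcases ih with h | ⟨h1, h2⟩ | ⟨h1, h2⟩
      · exact .inr (.inl ⟨Reachable.refl _, h⟩)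
      · exact .inr (.inl ⟨Reachable.refl _, h2⟩)
      · exact .inl h2
    · rcases ih with h | ⟨h1, h2⟩ | ⟨h1, h2⟩
      · exact .inr (.inr ⟨Reachable.refl _, h⟩)
      · exact .inl h2
      · exact .inr (.inr ⟨Reachable.refl _, h2⟩)

/-- The number of vertices of the connected component of `u`. -/
noncomputable def compSize (G : SimpleGraph V) (u : V) : ℕ := (G.connectedComponentMk u).supp.ncard

theorem compSize_pos [Finite V] (G : SimpleGraph V) (u : V) : 0 < G.compSize u :=
  (Set.ncard_pos (Set.toFinite _)).mpr ⟨u, rfl⟩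

/-- Every component contributes its size times the inverse of its size, that is, one. -/
theorem sum_inv_compSize [Fintype V] (G : SimpleGraph V) :
    ∑ u, (G.compSize u : ℝ)⁻¹ = Nat.card G.ConnectedComponent := by
  classical
  have : Fintype G.ConnectedComponent := Fintype.ofFinite _
  rw [← Finset.sum_fiberwise_of_maps_to (s := Finset.univ) (t := Finset.univ)
    (g := G.connectedComponentMk) (fun _ _ => Finset.mem_univ _)]
  rw [Nat.card_eq_fintype_card, Fintype.card, Finset.cast_card]
  refine Finset.sum_congr rfl fun c _ => ?_
  have hc : ∀ u ∈ Finset.univ.filter (fun u => G.connectedComponentMk u = c),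
      (G.compSize u : ℝ)⁻¹ = (c.supp.ncard : ℝ)⁻¹ := by
    intro u hu
    rw [compSize, (Finset.mem_filter.mp hu).2]
  rw [Finset.sum_congr rfl hc, Finset.sum_const, nsmul_eq_mul]
  have hs : c.supp = ((Finset.univ.filter fun u => G.connectedComponentMk u = c : Finset V) : Set V) := by
    ext u
    simp [ConnectedComponent.mem_supp_iff]
  rw [hs, Set.ncard_coe_finset]
  refine mul_inv_cancel₀ ?_
  obtain ⟨u, rfl⟩ := c.exists_rep
  rw [Nat.cast_ne_zero]
  exact Finset.card_ne_zero_of_mem (a := u) (by simp; rfl)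

end SimpleGraph

/-! ### An update changes the number of components by at most one -/

theorem numCC_sup_edge_le {n : ℕ} (G : SimpleGraph (Fin n)) (u v : Fin n) :
    numCC (G ⊔ SimpleGraph.edge u v) ≤ numCC G := by
  refine Nat.card_le_card_of_surjective
    (SimpleGraph.ConnectedComponent.map (SimpleGraph.Hom.ofLE le_sup_left)) ?_
  intro c
  induction c using SimpleGraph.ConnectedComponent.ind with
  | h x => exact ⟨G.connectedComponentMk x, rfl⟩

/-- The new edge can merge only the components of `u` and `v`. Sending the component of `v` to
`none` and every other one to its image is therefore injective. -/
theorem numCC_le_sup_edge {n : ℕ} (G : SimpleGraph (Fin n)) (u v : Fin n) :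
    numCC G ≤ numCC (G ⊔ SimpleGraph.edge u v) + 1 := by
  classical
  set G' := G ⊔ SimpleGraph.edge u v with hG'
  have : Nat.card (Option G'.ConnectedComponent) = numCC G' + 1 := by
    rw [Finite.card_option]; rfl
  rw [← this]
  refine Nat.card_le_card_of_injective (fun c : G.ConnectedComponent =>
    if c = G.connectedComponentMk v then none
    else some (c.map (SimpleGraph.Hom.ofLE (le_sup_left : G ≤ G')))) ?_
  intro c d
  induction c, d using SimpleGraph.ConnectedComponent.ind₂ with
  | h x y =>
    intro h
    simp only [SimpleGraph.ConnectedComponent.eq] at h ⊢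
    split_ifs at h with hx hy hy
    · exact hx.trans hy.symm
    · simp only [SimpleGraph.ConnectedComponent.map_mk, Option.some.injEq,
        SimpleGraph.ConnectedComponent.eq] at h
      rcases SimpleGraph.Reachable.of_sup_edge h with h | ⟨-, h⟩ | ⟨h, -⟩
      · exact h
      · exact absurd h.symm hy
      · exact absurd h hx

theorem numCC_apply_le {n : ℕ} (G : SimpleGraph (Fin n)) (e : EdgeUpdate n) :
    numCC (e.apply G) ≤ numCC G + 1 ∧ numCC G ≤ numCC (e.apply G) + 1 := by
  cases e with
  | insert u v =>
    exact ⟨(numCC_sup_edge_le G u v).trans (Nat.le_succ _), numCC_le_sup_edge G u v⟩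
  | delete u v =>
    -- A deletion without effect is trivial; otherwise the old graph arises from the new one by an
    -- insertion, and the bounds for insertions apply in reverse.
    have key : G.deleteEdges {s(u, v)} = G ∨
        G = G.deleteEdges {s(u, v)} ⊔ SimpleGraph.edge u v := by
      by_cases h : G.Adj u v
      · right
        ext x y
        simp only [SimpleGraph.sup_adj, SimpleGraph.deleteEdges_adj, SimpleGraph.edge_adj,
          Set.mem_singleton_iff, Sym2.eq_iff]
        constructor
        · intro hxy
          have := hxy.ne
          tauto
        · rintro (h' | ⟨⟨rfl, rfl⟩ | ⟨rfl, rfl⟩, -⟩)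
          · exact h'.1
          · exact h
          · exact h.symm
      · left
        ext x y
        simp only [SimpleGraph.deleteEdges_adj, Set.mem_singleton_iff, Sym2.eq_iff]
        constructor
        · exact fun h => h.1
        · intro hxy
          refine ⟨hxy, ?_⟩
          rintro (⟨rfl, rfl⟩ | ⟨rfl, rfl⟩)
          · exact h hxy
          · exact h hxy.symm
    change numCC (G.deleteEdges {s(u, v)}) ≤ _ ∧ _ ≤ numCC (G.deleteEdges {s(u, v)}) + 1
    rcases key with key | key
    · rw [key]; omega
    · have h1 := numCC_sup_edge_le (G.deleteEdges {s(u, v)}) u v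
      have h2 := numCC_le_sup_edge (G.deleteEdges {s(u, v)}) u v
      rw [← key] at h1 h2
      omega

theorem updatedGraph_append {n : ℕ} (G : SimpleGraph (Fin n)) (l l' : List (EdgeUpdate n)) :
    updatedGraph G (l ++ l') = updatedGraph (updatedGraph G l) l' := by
  simp [updatedGraph]

theorem numCC_updatedGraph_le {n : ℕ} (G : SimpleGraph (Fin n)) (l : List (EdgeUpdate n)) :
    numCC (updatedGraph G l) ≤ numCC G + l.length ∧
      numCC G ≤ numCC (updatedGraph G l) + l.length := by
  induction l using List.reverseRecOn with
  | nil => simp [updatedGraph]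
  | append_singleton l e ih =>
    rw [updatedGraph_append, List.length_append]
    have := numCC_apply_le (updatedGraph G l) e
    simp only [updatedGraph, List.foldl_cons, List.foldl_nil, List.length_singleton] at *
    omega

theorem numCC_le {n : ℕ} (G : SimpleGraph (Fin n)) : numCC G ≤ n := by
  have := Nat.card_le_card_of_surjective (Quot.mk G.Reachable) Quot.mk_surjective
  rwa [Nat.card_fin] at this

theorem numCC_pos {n : ℕ} (hn : 1 ≤ n) (G : SimpleGraph (Fin n)) : 1 ≤ numCC G := by
  have : Nonempty G.ConnectedComponent := ⟨G.connectedComponentMk ⟨0, hn⟩⟩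
  exact Nat.card_pos

/-! ### Moments of a sample -/

/-- The value of a sample from a component with `c` vertices if the random threshold is `a`. -/
def sampleValue (M c a : ℕ) : ℕ := if c * c * a ≤ M then c else 0

/-- A bound on the number of steps of a search with threshold `a`. -/
def sampleCost (M a : ℕ) : ℕ := Nat.sqrt (M / a) * (Nat.sqrt (M / a) + 1) + 2

section Moments

variable {Q c : ℕ}

theorem card_filter_mul_le (M c : ℕ) (hc : 0 < c) :
    ((Finset.range M).filter fun a => c * c * (a + 1) ≤ M).card = M / (c * c) := by
  have hcc : 0 < c * c := Nat.mul_pos hc hc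
  have : ((Finset.range M).filter fun a => c * c * (a + 1) ≤ M) = Finset.range (M / (c * c)) := by
    ext a
    simp only [Finset.mem_filter, Finset.mem_range]
    rw [mul_comm, ← Nat.le_div_iff_mul_le hcc]
    constructor
    · rintro ⟨-, h⟩; omega
    · intro h
      exact ⟨h.trans_le (Nat.div_le_self _ _), h⟩
  rw [this, Finset.card_range]

theorem sum_sampleValue (M c : ℕ) (hc : 0 < c) :
    ∑ a ∈ Finset.range M, (sampleValue M c (a + 1) : ℝ) = c * (M / (c * c) : ℕ) := by
  simp only [sampleValue, Nat.cast_ite, Nat.cast_zero]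
  rw [← Finset.sum_filter, Finset.sum_const, card_filter_mul_le M c hc, nsmul_eq_mul, mul_comm]

theorem sum_sampleValue_sq (M c : ℕ) (hc : 0 < c) :
    ∑ a ∈ Finset.range M, (sampleValue M c (a + 1) : ℝ) ^ 2 = c ^ 2 * (M / (c * c) : ℕ) := by
  have : ∀ a, (sampleValue M c (a + 1) : ℝ) ^ 2 = if c * c * (a + 1) ≤ M then (c : ℝ) ^ 2 else 0 := by
    intro a
    simp only [sampleValue]
    split_ifs <;> simp
  simp only [this]
  rw [← Finset.sum_filter, Finset.sum_const, card_filter_mul_le M c hc, nsmul_eq_mul, mul_comm]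

theorem sampleValue_le (c : ℕ) {a : ℕ} (ha : 1 ≤ a) : sampleValue (Q * Q) c a ≤ Q := by
  unfold sampleValue
  split_ifs with h
  · by_contra! hc
    have : Q * Q < c * c := Nat.mul_self_lt_mul_self hc
    nlinarith
  · exact Nat.zero_le _

theorem sum_sampleValue_le (hc : 0 < c) :
    ∑ a ∈ Finset.range (Q * Q), (sampleValue (Q * Q) c (a + 1) : ℝ) ≤ (Q : ℝ) ^ 2 * (c : ℝ)⁻¹ := by
  rw [sum_sampleValue _ _ hc]
  have hc' : (0 : ℝ) < c := by exact_mod_cast hc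
  have h : ((Q * Q / (c * c) : ℕ) : ℝ) ≤ ((Q * Q : ℕ) : ℝ) / ((c * c : ℕ) : ℝ) := Nat.cast_div_le
  calc (c : ℝ) * ((Q * Q / (c * c) : ℕ) : ℝ) ≤ c * (((Q * Q : ℕ) : ℝ) / ((c * c : ℕ) : ℝ)) := by
        gcongr
    _ = _ := by push_cast; field_simp

/-- Rounding `Q² / c²` down loses less than one threshold, of weight `c ≤ Q` among `Q²`. For `c > Q`
the left-hand side is not positive. -/
theorem le_sum_sampleValue (hQ : 0 < Q) (hc : 0 < c) :
    (Q : ℝ) ^ 2 * ((c : ℝ)⁻¹ - (Q : ℝ)⁻¹) ≤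
      ∑ a ∈ Finset.range (Q * Q), (sampleValue (Q * Q) c (a + 1) : ℝ) := by
  rw [sum_sampleValue _ _ hc]
  have hc' : (0 : ℝ) < c := by exact_mod_cast hc
  have hQ' : (0 : ℝ) < Q := by exact_mod_cast hQ
  rcases le_or_gt c Q with h | h
  · have h1 : Q * Q < c * c * (Q * Q / (c * c) + 1) := Nat.lt_mul_div_succ _ (Nat.mul_pos hc hc)
    have h2 : (Q : ℝ) * Q < c * c * ((Q * Q / (c * c) : ℕ) + 1) := by exact_mod_cast h1
    have h3 : (c : ℝ) ≤ Q := by exact_mod_cast h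
    have h4 : (Q : ℝ) ^ 2 * ((c : ℝ)⁻¹ - (Q : ℝ)⁻¹) = Q * Q / c - Q := by field_simp
    rw [h4]
    have h5 : (Q : ℝ) * Q / c ≤ c * ((Q * Q / (c * c) : ℕ) + 1) := by
      rw [div_le_iff₀ hc']
      nlinarith
    linarith
  · have h3 : (c : ℝ)⁻¹ ≤ (Q : ℝ)⁻¹ := by
      gcongr
    have : (Q : ℝ) ^ 2 * ((c : ℝ)⁻¹ - (Q : ℝ)⁻¹) ≤ 0 :=
      mul_nonpos_of_nonneg_of_nonpos (by positivity) (by linarith)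
    exact this.trans (by positivity)

/-- The value `c` is taken with probability at most `1 / c²`, so the second moment is at most one
whatever `c` is. This is why `Q² l` samples suffice although values reach `Q`. -/
theorem sum_sampleValue_sq_le (hc : 0 < c) :
    ∑ a ∈ Finset.range (Q * Q), (sampleValue (Q * Q) c (a + 1) : ℝ) ^ 2 ≤ (Q : ℝ) ^ 2 := by
  rw [sum_sampleValue_sq _ _ hc]
  have : c * c * (Q * Q / (c * c)) ≤ Q * Q := Nat.mul_div_le _ _
  have : (c : ℝ) * c * (Q * Q / (c * c) : ℕ) ≤ Q * Q := by exact_mod_cast this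
  nlinarith

theorem exp_le_one_add_add_sq {x : ℝ} (h : |x| ≤ 1) : Real.exp x ≤ 1 + x + x ^ 2 := by
  have := (abs_le.mp (Real.abs_exp_sub_one_sub_id_le h)).2
  linarith

/-- The scale `1 / Q` is the largest one for which the exponents stay in `[0, 1]`, so that `1 + x +
x²` applies; the second moment then costs only `1 / Q²`. -/
theorem sum_exp_sampleValue_le (hQ : 0 < Q) (hc : 0 < c) :
    ∑ a ∈ Finset.range (Q * Q), Real.exp ((Q : ℝ)⁻¹ * sampleValue (Q * Q) c (a + 1)) ≤
      (Q : ℝ) ^ 2 * (1 + (Q : ℝ)⁻¹ * (c : ℝ)⁻¹ + (Q : ℝ)⁻¹ ^ 2) := by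
  have hQ' : (0 : ℝ) < Q := by exact_mod_cast hQ
  have h1 : ∀ a ∈ Finset.range (Q * Q), Real.exp ((Q : ℝ)⁻¹ * sampleValue (Q * Q) c (a + 1)) ≤
      1 + (Q : ℝ)⁻¹ * sampleValue (Q * Q) c (a + 1) +
        (Q : ℝ)⁻¹ ^ 2 * (sampleValue (Q * Q) c (a + 1) : ℝ) ^ 2 := by
    intro a _
    rw [← mul_pow]
    refine exp_le_one_add_add_sq ?_
    rw [abs_of_nonneg (by positivity), inv_mul_le_iff₀ hQ', mul_one]
    exact_mod_cast sampleValue_le c (by omega)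
  refine (Finset.sum_le_sum h1).trans ?_
  rw [Finset.sum_add_distrib, Finset.sum_add_distrib, ← Finset.mul_sum, ← Finset.mul_sum,
    Finset.sum_const, Finset.card_range, nsmul_eq_mul, mul_one]
  have h2 := mul_le_mul_of_nonneg_left (sum_sampleValue_le (Q := Q) hc) (inv_nonneg.mpr hQ'.le)
  have h3 := mul_le_mul_of_nonneg_left (sum_sampleValue_sq_le (Q := Q) hc)
    (sq_nonneg ((Q : ℝ)⁻¹))
  push_cast
  nlinarith

theorem sum_exp_neg_sampleValue_le (hQ : 0 < Q) (hc : 0 < c) :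
    ∑ a ∈ Finset.range (Q * Q), Real.exp (-((Q : ℝ)⁻¹ * sampleValue (Q * Q) c (a + 1))) ≤
      (Q : ℝ) ^ 2 * (1 - (Q : ℝ)⁻¹ * ((c : ℝ)⁻¹ - (Q : ℝ)⁻¹) + (Q : ℝ)⁻¹ ^ 2) := by
  have hQ' : (0 : ℝ) < Q := by exact_mod_cast hQ
  have h1 : ∀ a ∈ Finset.range (Q * Q), Real.exp (-((Q : ℝ)⁻¹ * sampleValue (Q * Q) c (a + 1))) ≤
      1 + -(Q : ℝ)⁻¹ * sampleValue (Q * Q) c (a + 1) +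
        (Q : ℝ)⁻¹ ^ 2 * (sampleValue (Q * Q) c (a + 1) : ℝ) ^ 2 := by
    intro a _
    rw [← mul_pow, ← neg_sq, ← neg_mul]
    refine exp_le_one_add_add_sq ?_
    rw [neg_mul, abs_neg, abs_of_nonneg (by positivity), inv_mul_le_iff₀ hQ', mul_one]
    exact_mod_cast sampleValue_le c (by omega)
  refine (Finset.sum_le_sum h1).trans ?_
  rw [Finset.sum_add_distrib, Finset.sum_add_distrib, ← Finset.mul_sum, ← Finset.mul_sum,
    Finset.sum_const, Finset.card_range, nsmul_eq_mul, mul_one]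
  have h2 := mul_le_mul_of_nonneg_left (le_sum_sampleValue hQ hc) (inv_nonneg.mpr hQ'.le)
  have h3 := mul_le_mul_of_nonneg_left (sum_sampleValue_sq_le (Q := Q) hc)
    (sq_nonneg ((Q : ℝ)⁻¹))
  push_cast
  nlinarith

/-- Since `a ≤ M`, the square root `X` is at least one, so `X (X + 1) + 2 ≤ 4 X²`, and `X² a ≤ M`.
-/
theorem sampleCost_le {M a : ℕ} (ha : 1 ≤ a) (haM : a ≤ M) :
    (sampleCost M a : ℝ) ≤ 4 * M / a := by
  have ha' : (0 : ℝ) < a := by exact_mod_cast ha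
  rw [le_div_iff₀ ha']
  set X := Nat.sqrt (M / a) with hX
  have h1 : 1 ≤ X := Nat.sqrt_pos.mpr (Nat.div_pos haM ha)
  have h2 : X * X ≤ M / a := Nat.sqrt_le _
  have h3 : X * X * a ≤ M := (Nat.le_div_iff_mul_le ha).mp h2
  have h4 : sampleCost M a ≤ 4 * (X * X) := by
    rw [sampleCost, ← hX]
    nlinarith
  have h5 : sampleCost M a * a ≤ 4 * M := by nlinarith
  exact_mod_cast h5

/-- With scale `1 / (4 Q²)` the exponent is at most `1 / a ≤ 1`, so its exponential is at most `1 +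
2 / a`. The sum over all thresholds is harmonic, and `log (Q²) ≤ 2 g`. -/
theorem sum_exp_sampleCost_le {g : ℕ} (hQ : 0 < Q) (hg : Q ≤ 2 ^ g) :
    ∑ a ∈ Finset.range (Q * Q), Real.exp ((4 * (Q : ℝ) ^ 2)⁻¹ * sampleCost (Q * Q) (a + 1)) ≤
      (Q : ℝ) ^ 2 * (1 + (2 + 4 * g) * (Q : ℝ)⁻¹ ^ 2) := by
  have hQ' : (0 : ℝ) < Q := by exact_mod_cast hQ
  have h1 : ∀ a ∈ Finset.range (Q * Q),
      Real.exp ((4 * (Q : ℝ) ^ 2)⁻¹ * sampleCost (Q * Q) (a + 1)) ≤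
        1 + 2 * ((a + 1 : ℕ) : ℝ)⁻¹ := by
    intro a ha
    have ha' : a + 1 ≤ Q * Q := Finset.mem_range.mp ha
    have h2 := sampleCost_le (Nat.le_add_left 1 a) ha'
    have hp : (0 : ℝ) < ((a + 1 : ℕ) : ℝ) := by positivity
    have h3 : (4 * (Q : ℝ) ^ 2)⁻¹ * sampleCost (Q * Q) (a + 1) ≤ ((a + 1 : ℕ) : ℝ)⁻¹ := by
      calc (4 * (Q : ℝ) ^ 2)⁻¹ * (sampleCost (Q * Q) (a + 1) : ℝ)
          ≤ (4 * (Q : ℝ) ^ 2)⁻¹ * (4 * ((Q * Q : ℕ) : ℝ) / ((a + 1 : ℕ) : ℝ)) := by gcongr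
        _ = _ := by push_cast; field_simp
    have h4 : ((a + 1 : ℕ) : ℝ)⁻¹ ≤ 1 := inv_le_one_of_one_le₀ (by push_cast; linarith [a.cast_nonneg (α := ℝ)])
    have h5 : 0 < ((a + 1 : ℕ) : ℝ)⁻¹ := by positivity
    refine (Real.exp_le_exp.mpr h3).trans ((exp_le_one_add_add_sq ?_).trans ?_)
    · rwa [abs_of_pos h5]
    · nlinarith
  refine (Finset.sum_le_sum h1).trans ?_
  rw [Finset.sum_add_distrib, ← Finset.mul_sum, Finset.sum_const, Finset.card_range, nsmul_eq_mul,
    mul_one]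
  have h6 : ∑ a ∈ Finset.range (Q * Q), ((a + 1 : ℕ) : ℝ)⁻¹ ≤ 1 + 2 * g := by
    have h7 := harmonic_le_one_add_log (Q * Q)
    have h8 : ((harmonic (Q * Q) : ℚ) : ℝ) = ∑ a ∈ Finset.range (Q * Q), ((a + 1 : ℕ) : ℝ)⁻¹ := by
      simp [harmonic]
    rw [← h8]
    refine h7.trans ?_
    push_cast
    rw [Real.log_mul hQ'.ne' hQ'.ne']
    have h9 : Real.log Q ≤ g := by
      calc Real.log Q ≤ Real.log ((2 : ℝ) ^ g) := by
            apply Real.log_le_log hQ'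
            exact_mod_cast hg
        _ = g * Real.log 2 := Real.log_pow _ _
        _ ≤ g * 1 := by
            gcongr
            linarith [Real.log_two_lt_d9]
        _ = g := mul_one _
    linarith
  have h10 : (Q : ℝ) ^ 2 * (Q : ℝ)⁻¹ ^ 2 = 1 := by field_simp
  push_cast at h6 ⊢
  nlinarith

end Moments

/-! ### The potential -/

/-- A bound on the probability that the final sum of the samples is far from its mean, if `i` samples
are missing and the sum of the samples so far is `S`.  Here `ν` is the relative number of
components. -/
noncomputable def deviation (Q r : ℕ) (ν : ℝ) (S i : ℕ) : ℝ :=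
  Real.exp ((Q : ℝ)⁻¹ * (S - r * (ν + 2 * (Q : ℝ)⁻¹)) + i * ((Q : ℝ)⁻¹ * ν + (Q : ℝ)⁻¹ ^ 2)) +
  Real.exp ((Q : ℝ)⁻¹ * (r * (ν - 3 * (Q : ℝ)⁻¹) - S) +
    i * (-((Q : ℝ)⁻¹ * (ν - (Q : ℝ)⁻¹)) + (Q : ℝ)⁻¹ ^ 2))

/-- A bound on the probability that the estimator fails, if moreover `m` steps remain. -/
noncomputable def potential (Q g r : ℕ) (ν : ℝ) (S i : ℕ) (m : ℝ) : ℝ :=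
  deviation Q r ν S i +
    Real.exp (-((4 * (Q : ℝ) ^ 2)⁻¹ * m) + i * ((2 + 4 * g) * (Q : ℝ)⁻¹ ^ 2))

section Potential

variable {Q g r n : ℕ} {ν : ℝ}

theorem potential_nonneg (S i : ℕ) (m : ℝ) : 0 ≤ potential Q g r ν S i m := by
  unfold potential deviation; positivity

theorem deviation_nonneg (S i : ℕ) : 0 ≤ deviation Q r ν S i := by
  unfold deviation; positivity

theorem deviation_le_potential (S i : ℕ) (m : ℝ) :
    deviation Q r ν S i ≤ potential Q g r ν S i m :=
  le_add_of_nonneg_right (Real.exp_nonneg _)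

theorem potential_anti (S i : ℕ) {m m' : ℝ} (h : m ≤ m') :
    potential Q g r ν S i m' ≤ potential Q g r ν S i m := by
  unfold potential
  gcongr

/-- The constants are tuned so that each exponent is at most `-l`. Per sample, the margin `2 / Q`
above the mean pays for the second moment and leaves `1 / Q²`; below the mean the bias `1 / Q` has
to be paid too, hence the margin `3 / Q`. In the time term, `4 g + 3` exceeds the drift `4 g + 2` by
one. -/
theorem potential_init (hQ : 0 < Q) {l W : ℕ} (hr : r = Q * Q * l) (hW : 4 * r * (4 * g + 3) ≤ W) :
    potential Q g r ν 0 r W ≤ 3 * Real.exp (-l) := by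
  have hQ' : (0 : ℝ) < Q := by exact_mod_cast hQ
  have hr' : (r : ℝ) = Q ^ 2 * l := by rw [hr]; push_cast; ring
  have hW' : (4 : ℝ) * r * (4 * g + 3) ≤ W := by exact_mod_cast hW
  unfold potential deviation
  have e1 : (Q : ℝ)⁻¹ * (((0 : ℕ) : ℝ) - r * (ν + 2 * (Q : ℝ)⁻¹)) +
      r * ((Q : ℝ)⁻¹ * ν + (Q : ℝ)⁻¹ ^ 2) = -l := by
    rw [hr']; push_cast; field_simp; ring
  have e2 : (Q : ℝ)⁻¹ * (r * (ν - 3 * (Q : ℝ)⁻¹) - ((0 : ℕ) : ℝ)) +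
      r * (-((Q : ℝ)⁻¹ * (ν - (Q : ℝ)⁻¹)) + (Q : ℝ)⁻¹ ^ 2) = -l := by
    rw [hr']; push_cast; field_simp; ring
  have e3 : -((4 * (Q : ℝ) ^ 2)⁻¹ * W) + r * ((2 + 4 * g) * (Q : ℝ)⁻¹ ^ 2) ≤ -l := by
    have : (4 * (Q : ℝ) ^ 2)⁻¹ * (4 * (r : ℝ) * (4 * g + 3)) ≤ (4 * (Q : ℝ) ^ 2)⁻¹ * (W : ℝ) := by
      gcongr
    have e4 : (4 * (Q : ℝ) ^ 2)⁻¹ * (4 * (r : ℝ) * (4 * g + 3)) = l * (4 * g + 3) := by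
      rw [hr']; field_simp
    have e5 : (r : ℝ) * ((2 + 4 * g) * (Q : ℝ)⁻¹ ^ 2) = l * (2 + 4 * g) := by
      rw [hr']; field_simp
    rw [e5]
    linarith
  rw [e1, e2]
  have := Real.exp_le_exp.mpr e3
  linarith

/-- The time term alone reaches one when the step budget is exhausted while samples may still be
missing. -/
theorem one_le_potential_of_missing (S : ℕ) {i : ℕ} {m : ℝ} (hm : m ≤ 0) :
    1 ≤ potential Q g r ν S i m := by
  unfold potential
  have : (1 : ℝ) ≤ Real.exp (-((4 * (Q : ℝ) ^ 2)⁻¹ * m) + i * ((2 + 4 * g) * (Q : ℝ)⁻¹ ^ 2)) := by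
    apply Real.one_le_exp
    have : (4 * (Q : ℝ) ^ 2)⁻¹ * m ≤ 0 := mul_nonpos_of_nonneg_of_nonpos (by positivity) hm
    have : (0 : ℝ) ≤ i * ((2 + 4 * g) * (Q : ℝ)⁻¹ ^ 2) := by positivity
    linarith
  have := deviation_nonneg (Q := Q) (r := r) (ν := ν) S i
  linarith

theorem one_le_deviation (S : ℕ)
    (h : r * (ν + 2 * (Q : ℝ)⁻¹) ≤ S ∨ S ≤ r * (ν - 3 * (Q : ℝ)⁻¹)) :
    1 ≤ deviation Q r ν S 0 := by
  unfold deviation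
  have h1 := Real.exp_nonneg ((Q : ℝ)⁻¹ * (S - r * (ν + 2 * (Q : ℝ)⁻¹)) +
    (0 : ℕ) * ((Q : ℝ)⁻¹ * ν + (Q : ℝ)⁻¹ ^ 2))
  have h2 := Real.exp_nonneg ((Q : ℝ)⁻¹ * (r * (ν - 3 * (Q : ℝ)⁻¹) - S) +
    (0 : ℕ) * (-((Q : ℝ)⁻¹ * (ν - (Q : ℝ)⁻¹)) + (Q : ℝ)⁻¹ ^ 2))
  have hQ : (0 : ℝ) ≤ (Q : ℝ)⁻¹ := by positivity
  rcases h with h | h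
  · have : 1 ≤ Real.exp ((Q : ℝ)⁻¹ * (S - r * (ν + 2 * (Q : ℝ)⁻¹)) +
        (0 : ℕ) * ((Q : ℝ)⁻¹ * ν + (Q : ℝ)⁻¹ ^ 2)) := by
      apply Real.one_le_exp
      have := mul_nonneg hQ (sub_nonneg.mpr h)
      push_cast; linarith
    linarith
  · have : 1 ≤ Real.exp ((Q : ℝ)⁻¹ * (r * (ν - 3 * (Q : ℝ)⁻¹) - S) +
        (0 : ℕ) * (-((Q : ℝ)⁻¹ * (ν - (Q : ℝ)⁻¹)) + (Q : ℝ)⁻¹ ^ 2)) := by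
      apply Real.one_le_exp
      have := mul_nonneg hQ (sub_nonneg.mpr h)
      push_cast; linarith
    linarith

/-- On average, the potential does not increase when a sample is drawn. -/
theorem sum_potential_le (hn : 0 < n) (hQ : 0 < Q) (hg : Q ≤ 2 ^ g) (c : ℕ → ℕ)
    (hc : ∀ u < n, 0 < c u) (hν : ∑ u ∈ Finset.range n, (c u : ℝ)⁻¹ = n * ν) (S i : ℕ) (m : ℝ) :
    (∑ u ∈ Finset.range n, (∑ a ∈ Finset.range (Q * Q),
      potential Q g r ν (S + sampleValue (Q * Q) (c u) (a + 1)) i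
        (m - sampleCost (Q * Q) (a + 1))) / (Q * Q : ℕ)) / n ≤ potential Q g r ν S (i + 1) m := by
  have hQ' : (0 : ℝ) < Q := by exact_mod_cast hQ
  have hn' : (0 : ℝ) < n := by exact_mod_cast hn
  set x₁ : ℝ := Real.exp ((Q : ℝ)⁻¹ * (S - r * (ν + 2 * (Q : ℝ)⁻¹)) +
    i * ((Q : ℝ)⁻¹ * ν + (Q : ℝ)⁻¹ ^ 2)) with hx₁
  set x₂ : ℝ := Real.exp ((Q : ℝ)⁻¹ * (r * (ν - 3 * (Q : ℝ)⁻¹) - S) +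
    i * (-((Q : ℝ)⁻¹ * (ν - (Q : ℝ)⁻¹)) + (Q : ℝ)⁻¹ ^ 2)) with hx₂
  set x₃ : ℝ := Real.exp (-((4 * (Q : ℝ) ^ 2)⁻¹ * m) + i * ((2 + 4 * g) * (Q : ℝ)⁻¹ ^ 2)) with hx₃
  -- Each of the three exponentials factors into the state before the sample and the contribution of
  -- the sample.
  have hterm : ∀ u a, potential Q g r ν (S + sampleValue (Q * Q) (c u) (a + 1)) i
        (m - sampleCost (Q * Q) (a + 1)) =
      x₁ * Real.exp ((Q : ℝ)⁻¹ * sampleValue (Q * Q) (c u) (a + 1)) +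
      x₂ * Real.exp (-((Q : ℝ)⁻¹ * sampleValue (Q * Q) (c u) (a + 1))) +
      x₃ * Real.exp ((4 * (Q : ℝ) ^ 2)⁻¹ * sampleCost (Q * Q) (a + 1)) := by
    intro u a
    rw [hx₁, hx₂, hx₃, ← Real.exp_add, ← Real.exp_add, ← Real.exp_add, potential, deviation]
    push_cast
    ring_nf
  have hu : ∀ u ∈ Finset.range n, (∑ a ∈ Finset.range (Q * Q),
      potential Q g r ν (S + sampleValue (Q * Q) (c u) (a + 1)) i
        (m - sampleCost (Q * Q) (a + 1))) / (Q * Q : ℕ) ≤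
      x₁ * (1 + (Q : ℝ)⁻¹ * (c u : ℝ)⁻¹ + (Q : ℝ)⁻¹ ^ 2) +
      x₂ * (1 - (Q : ℝ)⁻¹ * ((c u : ℝ)⁻¹ - (Q : ℝ)⁻¹) + (Q : ℝ)⁻¹ ^ 2) +
      x₃ * (1 + (2 + 4 * g) * (Q : ℝ)⁻¹ ^ 2) := by
    intro u hu
    have hcu := hc u (Finset.mem_range.mp hu)
    rw [div_le_iff₀ (by push_cast; positivity)]
    simp only [hterm, Finset.sum_add_distrib, ← Finset.mul_sum]
    have h1 := mul_le_mul_of_nonneg_left (sum_exp_sampleValue_le hQ hcu)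
      (Real.exp_nonneg _ : 0 ≤ x₁)
    have h2 := mul_le_mul_of_nonneg_left (sum_exp_neg_sampleValue_le hQ hcu)
      (Real.exp_nonneg _ : 0 ≤ x₂)
    have h3 := mul_le_mul_of_nonneg_left (sum_exp_sampleCost_le hQ hg)
      (Real.exp_nonneg _ : 0 ≤ x₃)
    push_cast
    linarith
  rw [div_le_iff₀ hn']
  refine (Finset.sum_le_sum hu).trans ?_
  have hsum : ∑ u ∈ Finset.range n, (x₁ * (1 + (Q : ℝ)⁻¹ * (c u : ℝ)⁻¹ + (Q : ℝ)⁻¹ ^ 2) +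
      x₂ * (1 - (Q : ℝ)⁻¹ * ((c u : ℝ)⁻¹ - (Q : ℝ)⁻¹) + (Q : ℝ)⁻¹ ^ 2) +
      x₃ * (1 + (2 + 4 * g) * (Q : ℝ)⁻¹ ^ 2)) =
      n * (x₁ * (1 + ((Q : ℝ)⁻¹ * ν + (Q : ℝ)⁻¹ ^ 2)) +
        x₂ * (1 + (-((Q : ℝ)⁻¹ * (ν - (Q : ℝ)⁻¹)) + (Q : ℝ)⁻¹ ^ 2)) +
        x₃ * (1 + (2 + 4 * g) * (Q : ℝ)⁻¹ ^ 2)) := by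
    have : ∀ u, (x₁ * (1 + (Q : ℝ)⁻¹ * (c u : ℝ)⁻¹ + (Q : ℝ)⁻¹ ^ 2) +
      x₂ * (1 - (Q : ℝ)⁻¹ * ((c u : ℝ)⁻¹ - (Q : ℝ)⁻¹) + (Q : ℝ)⁻¹ ^ 2) +
      x₃ * (1 + (2 + 4 * g) * (Q : ℝ)⁻¹ ^ 2)) =
      (x₁ * (1 + (Q : ℝ)⁻¹ ^ 2) + x₂ * (1 + (Q : ℝ)⁻¹ * (Q : ℝ)⁻¹ + (Q : ℝ)⁻¹ ^ 2) +
      x₃ * (1 + (2 + 4 * g) * (Q : ℝ)⁻¹ ^ 2)) +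
      (x₁ * (Q : ℝ)⁻¹ - x₂ * (Q : ℝ)⁻¹) * (c u : ℝ)⁻¹ := fun u => by ring
    simp only [this, Finset.sum_add_distrib, ← Finset.mul_sum, hν, Finset.sum_const,
      Finset.card_range, nsmul_eq_mul]
    ring
  rw [hsum, mul_comm]
  refine mul_le_mul_of_nonneg_right ?_ hn'.le
  have hpot : potential Q g r ν S (i + 1) m =
      x₁ * Real.exp ((Q : ℝ)⁻¹ * ν + (Q : ℝ)⁻¹ ^ 2) +
      x₂ * Real.exp (-((Q : ℝ)⁻¹ * (ν - (Q : ℝ)⁻¹)) + (Q : ℝ)⁻¹ ^ 2) +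
      x₃ * Real.exp ((2 + 4 * g) * (Q : ℝ)⁻¹ ^ 2) := by
    rw [hx₁, hx₂, hx₃, ← Real.exp_add, ← Real.exp_add, ← Real.exp_add, potential, deviation]
    push_cast
    ring_nf
  rw [hpot]
  -- The averaged moments have the form `1 + x`, where `x` is exactly the amount by which an
  -- exponent grows per missing sample.
  have hexp : ∀ x : ℝ, 1 + x ≤ Real.exp x := fun x => by linarith [Real.add_one_le_exp x]
  have h₁ : 0 ≤ x₁ := Real.exp_nonneg _
  have h₂ : 0 ≤ x₂ := Real.exp_nonneg _
  have h₃ : 0 ≤ x₃ := Real.exp_nonneg _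
  gcongr <;> exact hexp _

end Potential

theorem ENNReal.sum_ofReal_div {m : ℕ} (hm : 0 < m) (f : ℕ → ℝ) (hf : ∀ x, 0 ≤ f x) :
    (∑ x ∈ Finset.range m, ENNReal.ofReal (f x)) / (m : ENNReal) =
      ENNReal.ofReal ((∑ x ∈ Finset.range m, f x) / m) := by
  rw [← ENNReal.ofReal_sum_of_nonneg fun x _ => hf x, ENNReal.ofReal_div_of_pos (by exact_mod_cast hm),
    ENNReal.ofReal_natCast]

/-! ### Sets as arrays

A set of numbers below `n` is stored as the array `a 0, …, a (d - 1)` of its elements, together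
with an array `p` of positions.  Entries of `p` outside the set are arbitrary. -/

/-- The arrays `a`, `p` and the number `d` represent the set `S`. -/
structure IsRow (n : ℕ) (S : ℕ → Prop) (a p : ℕ → ℕ) (d : ℕ) : Prop where
  elem : ∀ j < d, a j < n ∧ S (a j) ∧ p (a j) = j
  pos : ∀ v < n, S v → p v < d ∧ a (p v) = v

namespace IsRow

variable {n : ℕ} {S S' : ℕ → Prop} {a a' p p' : ℕ → ℕ} {d : ℕ}

/-- Cross-checking the two arrays decides membership even if `p` contains garbage. So a set is
emptied by setting `d` to zero, which lets each search start with an empty visited set in constant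
time. -/
theorem mem_iff (h : IsRow n S a p d) {v : ℕ} (hv : v < n) : S v ↔ p v < d ∧ a (p v) = v :=
  ⟨h.pos v hv, fun ⟨h1, h2⟩ => h2 ▸ (h.elem _ h1).2.1⟩

theorem injOn (h : IsRow n S a p d) : Set.InjOn a (Finset.range d : Set ℕ) := by
  intro i hi j hj hij
  rw [← (h.elem i (by simpa using hi)).2.2, hij, (h.elem j (by simpa using hj)).2.2]

theorem le (h : IsRow n S a p d) : d ≤ n := by
  have := Finset.card_le_card_of_injOn (s := Finset.range d) (t := Finset.range n) a
    (fun j hj => by simpa using (h.elem j (by simpa using hj)).1) h.injOn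
  simpa using this

theorem lt_of_not_mem (h : IsRow n S a p d) {v : ℕ} (hv : v < n) (hS : ¬ S v) : d < n := by
  have := Finset.card_le_card_of_injOn (s := Finset.range d) (t := (Finset.range n).erase v) a
    (fun j hj => by
      have h1 := h.elem j (by simpa using hj)
      have : a j ≠ v := fun h2 => hS (h2 ▸ h1.2.1)
      simpa using ⟨h1.1, this⟩) h.injOn
  rw [Finset.card_erase_of_mem (by simpa using hv), Finset.card_range, Finset.card_range] at this
  omega

theorem congr (h : IsRow n S a p d) (hS : ∀ v < n, S v ↔ S' v) (ha : ∀ j < n, a' j = a j)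
    (hp : ∀ v < n, p' v = p v) : IsRow n S' a' p' d := by
  have hd := h.le
  refine ⟨fun j hj => ?_, fun v hv hv' => ?_⟩
  · obtain ⟨h1, h2, h3⟩ := h.elem j hj
    rw [ha j (by omega), hp _ h1]
    exact ⟨h1, (hS _ h1).mp h2, h3⟩
  · obtain ⟨h1, h2⟩ := h.pos v hv ((hS v hv).mpr hv')
    rw [hp v hv, ha _ (by omega)]
    exact ⟨h1, h2⟩

theorem insert (h : IsRow n S a p d) {v : ℕ} (hv : v < n) (hS : ¬ S v) :
    IsRow n (fun x => S x ∨ x = v) (Function.update a d v) (Function.update p v d) (d + 1) := by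
  refine ⟨fun j hj => ?_, fun x hx hx' => ?_⟩
  · by_cases hjd : j = d
    · subst hjd
      simp [hv]
    · have h1 := h.elem j (by omega)
      have h2 : a j ≠ v := fun h2 => hS (h2 ▸ h1.2.1)
      simp [hjd, h2, h1]
  · by_cases hxv : x = v
    · subst hxv
      simp
    · have h1 := h.pos x hx (hx'.resolve_right hxv)
      have h2 : p x ≠ d := by omega
      simp only [Function.update_of_ne hxv, Function.update_of_ne h2]
      exact ⟨by omega, h1.2⟩

/-- The last element moves into the gap. If the erased element is itself the last, the two writes
are void, because the gap lies beyond the new length. -/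
theorem erase (h : IsRow n S a p d) {v : ℕ} (hv : v < n) (hS : S v) :
    IsRow n (fun x => S x ∧ x ≠ v) (Function.update a (p v) (a (d - 1)))
      (Function.update p (a (d - 1)) (p v)) (d - 1) := by
  obtain ⟨hpv, hapv⟩ := h.pos v hv hS
  have hl := h.elem (d - 1) (by omega)
  have hne : ∀ j < d - 1, a j ≠ a (d - 1) := by
    intro j hj h1
    have := (h.elem j (by omega)).2.2
    rw [h1, hl.2.2] at this
    omega
  refine ⟨fun j hj => ?_, fun x hx hx' => ?_⟩
  · by_cases hjp : j = p v
    · subst hjp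
      have h1 : a (d - 1) ≠ v := fun h1 => by
        have := hne (p v) hj
        rw [hapv, h1] at this
        exact this rfl
      simp [hl.1, hl.2.1, h1]
    · have h1 := h.elem j (by omega)
      have h2 : a j ≠ v := fun h2 => hjp (by rw [← h2, h1.2.2])
      simp only [Function.update_of_ne hjp, Function.update_of_ne (hne j hj)]
      exact ⟨h1.1, ⟨h1.2.1, h2⟩, h1.2.2⟩
  · have h1 := h.pos x hx hx'.1
    by_cases hxl : x = a (d - 1)
    · rw [hxl, Function.update_self, Function.update_self]
      refine ⟨?_, rfl⟩
      by_contra h2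
      have : p v = d - 1 := by omega
      rw [this] at hapv
      exact hx'.2 (hxl.trans hapv)
    · have h2 : p x ≠ d - 1 := fun h2 => hxl (by rw [← h2, h1.2])
      have h3 : p x ≠ p v := fun h3 => hx'.2 (by rw [← h1.2, h3, hapv])
      simp only [Function.update_of_ne hxl, Function.update_of_ne h3]
      exact ⟨by omega, h1.2⟩

end IsRow

theorem cell_lt {n u v : ℕ} (hu : u < n) (hv : v < n) : u * n + v < n * n := by
  have : (u + 1) * n ≤ n * n := Nat.mul_le_mul_right n hu
  rw [Nat.add_mul] at this
  omega

theorem cell_inj {n u v u' v' : ℕ} (hv : v < n) (hv' : v' < n) (h : u * n + v = u' * n + v') :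
    u = u' ∧ v = v' := by
  have hn : 0 < n := by omega
  have h1 : (u * n + v) / n = u := by
    rw [mul_comm, Nat.mul_add_div hn, Nat.div_eq_of_lt hv, add_zero]
  have h2 : (u' * n + v') / n = u' := by
    rw [mul_comm, Nat.mul_add_div hn, Nat.div_eq_of_lt hv', add_zero]
  rw [h, h2] at h1
  subst h1
  exact ⟨rfl, by omega⟩

/-- The memory holds the adjacency lists of the directed graph `E`. -/
def Stores (n : ℕ) (E : ℕ → ℕ → Prop) (m : ℕ → ℕ) : Prop :=
  ∀ u < n, IsRow n (E u) (fun j => m (n * n + u * n + j)) (fun v => m (2 * (n * n) + u * n + v))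
    (m (3 * (n * n) + u))

namespace Stores

variable {n : ℕ} {E E' : ℕ → ℕ → Prop} {m m' : ℕ → ℕ} {u v : ℕ}

theorem congr (h : Stores n E m) (hE : ∀ u < n, ∀ v < n, E u v ↔ E' u v)
    (hm : ∀ x, n * n ≤ x → x < 3 * (n * n) + n → m' x = m x) : Stores n E' m' := by
  intro u hu
  have hr : m' (3 * (n * n) + u) = m (3 * (n * n) + u) := hm _ (by omega) (by omega)
  rw [hr]
  refine (h u hu).congr (hE u hu) (fun j hj => ?_) fun v hv => ?_
  · have := cell_lt hu hj
    exact hm _ (by omega) (by omega)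
  · have := cell_lt hu hv
    exact hm _ (by omega) (by omega)

theorem insert (h : Stores n E m) (hu : u < n) (hv : v < n) (hE : ¬ E u v) :
    Stores n (fun x y => E x y ∨ (x = u ∧ y = v))
      (Function.update (Function.update (Function.update m
        (n * n + u * n + m (3 * (n * n) + u)) v)
        (2 * (n * n) + u * n + v) (m (3 * (n * n) + u)))
        (3 * (n * n) + u) (m (3 * (n * n) + u) + 1)) := by
  intro x hx
  have hd := (h u hu).lt_of_not_mem hv hE
  have h1 := cell_lt hu hd
  have h2 := cell_lt hu hv
  by_cases hxu : x = u
  · subst hxu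
    rw [Function.update_self]
    refine ((h x hx).insert hv hE).congr (fun y hy => by simp) (fun j hj => ?_) fun y hy => ?_
    · have h3 := cell_lt hu hj
      rw [Function.update_of_ne (by omega), Function.update_of_ne (by omega)]
      simp only [Function.update_apply, Nat.add_left_cancel_iff]
    · have h3 := cell_lt hu hy
      rw [Function.update_of_ne (by omega)]
      simp only [Function.update_apply, Nat.add_left_cancel_iff]
      rw [if_neg (show ¬ 2 * (n * n) + x * n + y = n * n + x * n + m (3 * (n * n) + x) by omega)]
  · rw [Function.update_of_ne (by omega), Function.update_of_ne (by omega),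
      Function.update_of_ne (by omega)]
    refine (h x hx).congr (fun y hy => by simp [hxu]) (fun j hj => ?_) fun y hy => ?_
    · have h3 := cell_lt hx hj
      rw [Function.update_of_ne (by omega), Function.update_of_ne (by omega),
        Function.update_of_ne]
      intro h4
      exact hxu (cell_inj hj hd (by omega)).1
    · have h3 := cell_lt hx hy
      rw [Function.update_of_ne (by omega), Function.update_of_ne, Function.update_of_ne (by omega)]
      intro h4
      exact hxu (cell_inj hy hv (by omega)).1

theorem erase (h : Stores n E m) (hu : u < n) (hv : v < n) (hE : E u v) :
    Stores n (fun x y => E x y ∧ ¬ (x = u ∧ y = v))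
      (Function.update (Function.update (Function.update m
        (n * n + u * n + m (2 * (n * n) + u * n + v))
          (m (n * n + u * n + (m (3 * (n * n) + u) - 1))))
        (2 * (n * n) + u * n + m (n * n + u * n + (m (3 * (n * n) + u) - 1)))
          (m (2 * (n * n) + u * n + v)))
        (3 * (n * n) + u) (m (3 * (n * n) + u) - 1)) := by
  intro x hx
  have hd := (h u hu).le
  have hp := (h u hu).pos v hv hE
  have hl := (h u hu).elem (m (3 * (n * n) + u) - 1) (by omega)
  have h1 := cell_lt hu (show m (2 * (n * n) + u * n + v) < n by omega)
  have h2 := cell_lt hu hl.1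
  by_cases hxu : x = u
  · subst hxu
    rw [Function.update_self]
    refine ((h x hx).erase hv hE).congr (fun y hy => by simp) (fun j hj => ?_) fun y hy => ?_
    · have h3 := cell_lt hu hj
      rw [Function.update_of_ne (by omega), Function.update_of_ne (by omega)]
      simp only [Function.update_apply, Nat.add_left_cancel_iff]
    · have h3 := cell_lt hu hy
      rw [Function.update_of_ne (by omega)]
      simp only [Function.update_apply, Nat.add_left_cancel_iff]
      rw [if_neg (show ¬ 2 * (n * n) + x * n + y =
        n * n + x * n + m (2 * (n * n) + x * n + v) by omega)]
  · rw [Function.update_of_ne (by omega), Function.update_of_ne (by omega),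
      Function.update_of_ne (by omega)]
    refine (h x hx).congr (fun y hy => by simp [hxu]) (fun j hj => ?_) fun y hy => ?_
    · have h3 := cell_lt hx hj
      rw [Function.update_of_ne (by omega), Function.update_of_ne (by omega),
        Function.update_of_ne]
      intro h4
      exact hxu (cell_inj hj (show m (2 * (n * n) + u * n + v) < n by omega) (by omega)).1
    · have h3 := cell_lt hx hy
      rw [Function.update_of_ne (by omega), Function.update_of_ne, Function.update_of_ne (by omega)]
      intro h4
      exact hxu (cell_inj hy hl.1 (by omega)).1

end Stores

/-! ### Parameters and register layout

Register `0` holds the estimate and registers `1`, `2`, `3` the update.  Registers `4`, …, `25` hold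
constants that are computed by the preprocessing program.  Registers `26` and `27` are the clock of
the current phase and the number of old updates that were already applied in this phase.
Registers `30`, …, `36` belong to the sampler, registers `37`, `38`, `39` hold the update that is being
applied, registers `40`, …, `49` are temporary, and register `50` counts iterations. -/

/-- The numbers that control the algorithm: the number `n` of vertices, the inverse `q` of the
permitted relative error, the inverse `qb` of the relative error of the estimator before a random
offset is added, the logarithm `l` of the inverse failure probability of this estimator, and the
number `J` of offsets. -/
structure Params where
  n : ℕ
  q : ℕ
  qb : ℕ
  l : ℕ
  J : ℕ

namespace Params

variable (P : Params)

/-- In a small graph, the estimator is recomputed after every update. -/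
def Small : Prop := P.n < 16 * P.qb

instance : Decidable P.Small := inferInstanceAs (Decidable (_ < _))

/-- The inverse precision of the sampler. -/
def Q : ℕ := if P.Small then 8 * P.n else 8 * P.qb

/-- The binary logarithm of the inverse precision. -/
def g : ℕ := Nat.clog 2 P.Q

/-- The number of samples. -/
def r : ℕ := P.Q * P.Q * P.l

/-- The number of steps of the sampler. -/
def W : ℕ := 4 * P.r * (4 * P.g + 3)

/-- Half the length of a phase. -/
def H : ℕ := P.n / (16 * P.qb)

/-- The number of steps of the sampler per update. -/
def b : ℕ := if P.Small then P.W else P.W / P.H + 1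

/-- The permitted error. -/
def R : ℕ := P.n / P.q

/-- The permitted error before a random offset is added. -/
def Rb : ℕ := P.n / P.qb

/-- Requirements on the parameters and the word length. -/
structure Ok (w : ℕ) : Prop where
  n_pos : 0 < P.n
  qb_pos : 0 < P.qb
  l_pos : 0 < P.l
  J_pos : 0 < P.J
  mem : 3 * (P.n * P.n) + 6 * P.n + 1 < 2 ^ w
  -- The search tests `(cnt + 1)² a`, which is at most `4 cnt² a ≤ 4 Q²`.
  thr : 4 * (P.Q * P.Q) < 2 ^ w
  est : 2 * (P.r * P.Q * P.n) + P.r < 2 ^ w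
  shift : P.Q * P.n + P.J * (2 * P.R + 1) + P.R < 2 ^ w
  small : 16 * P.qb < 2 ^ w
  steps : P.W + 1 < 2 ^ w
  two_r : 2 * P.r < 2 ^ w
  -- The `J` windows of `2 R + 1` integers cover the `2 Rb + 1` integers at distance at most `Rb`
  -- from the estimate.
  cover : 2 * P.Rb + 1 ≤ P.J * (2 * P.R + 1)

theorem Q_pos {w : ℕ} (h : P.Ok w) : 0 < P.Q := by
  have := h.n_pos
  have := h.qb_pos
  unfold Q
  split_ifs <;> omega

theorem r_pos {w : ℕ} (h : P.Ok w) : 0 < P.r :=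
  Nat.mul_pos (Nat.mul_pos (P.Q_pos h) (P.Q_pos h)) h.l_pos

theorem Q_le : P.Q ≤ 2 ^ P.g := Nat.le_pow_clog (by norm_num) _

end Params

/-- The constants are in their registers. -/
structure Cfg (P : Params) (s : RamState) : Prop where
  r4 : s.reg 4 = P.n
  r5 : s.reg 5 = P.n * P.n
  r6 : s.reg 6 = 2 * (P.n * P.n)
  r7 : s.reg 7 = 3 * (P.n * P.n)
  r8 : s.reg 8 = 1
  r9 : s.reg 9 = if P.Small then 1 else 0
  r10 : s.reg 10 = 3 * (P.n * P.n) + P.n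
  r11 : s.reg 11 = 3 * (P.n * P.n) + 2 * P.n
  r12 : s.reg 12 = 3 * (P.n * P.n) + 3 * P.n
  r13 : s.reg 13 = 3 * (P.n * P.n) + 4 * P.n
  r14 : s.reg 14 = 3 * (P.n * P.n) + 5 * P.n
  r15 : s.reg 15 = 1
  r16 : s.reg 16 = 0
  r17 : s.reg 17 = P.Q * P.Q
  r18 : s.reg 18 = P.r
  r19 : s.reg 19 = P.J
  r20 : s.reg 20 = 2 * P.R + 1
  r21 : s.reg 21 = P.R
  r22 : s.reg 22 = P.Rb
  r23 : s.reg 23 = P.b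
  r24 : s.reg 24 = P.H
  r25 : s.reg 25 = 2 * P.H

theorem Cfg.frame {P : Params} {s s' : RamState} (h : Cfg P s)
    (hs : ∀ r, 4 ≤ r → r < 26 → s'.reg r = s.reg r) : Cfg P s' := by
  constructor <;> (rw [hs _ (by norm_num) (by norm_num)])
  exacts [h.r4, h.r5, h.r6, h.r7, h.r8, h.r9, h.r10, h.r11, h.r12, h.r13, h.r14, h.r15, h.r16,
    h.r17, h.r18, h.r19, h.r20, h.r21, h.r22, h.r23, h.r24, h.r25]

/-! ### Applying an update -/

namespace RamProg

variable {w : ℕ}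

/-- A specification without an expectation. -/
def Sure (w : ℕ) (P : RamProg) (s : RamState) (T : ℕ) (Q : RamState → Prop) : Prop :=
  Spec w P s T Q (fun _ => 0) 0

section

variable {P R : RamProg} {s : RamState} {T T₁ T₂ : ℕ} {Q Q' : RamState → Prop}
  {f : RamState → ℝ≥0∞} {c : ℝ≥0∞}

theorem Sure.spec (h : Sure w P s T Q) (hf : ∀ s', Q s' → f s' ≤ c) : Spec w P s T Q f c := by
  obtain ⟨μ, h1, h2, -⟩ := h
  exact ⟨μ, h1, h2, PMF.expect_le_of_le fun s' hs' => hf s' (h2 s' hs')⟩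

theorem Sure.of_wp (h : P.wp w Q s) : Sure w P s P.cost Q := Spec.of_wp' h

theorem Sure.mono (h : Sure w P s T Q) (hQ : ∀ s', Q s' → Q' s') : Sure w P s T Q' :=
  Spec.conseq h hQ (fun _ _ => le_rfl) le_rfl

theorem Sure.seq (hP : Sure w P s T₁ Q) (hR : ∀ s', Q s' → Sure w R s' T₂ Q') :
    Sure w (.seq P R) s (T₁ + T₂ + 1) Q' := Spec.seq hP hR

theorem Sure.frame (h : Sure w P s T Q) :
    Sure w P s T (fun s' => Q s' ∧ ∀ r, P.Avoids r → s'.reg r = s.reg r) := Spec.frame h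

theorem Sure.seq_spec (hP : Sure w P s T₁ Q) (hR : ∀ s', Q s' → Spec w R s' T₂ Q' f c) :
    Spec w (.seq P R) s (T₁ + T₂ + 1) Q' f c :=
  Spec.seq (g := fun _ => c) (hP.spec fun _ _ => le_rfl) hR

end

/-- Sequences of programs. -/
def block : List RamProg → RamProg
  | [] => .skip
  | [P] => P
  | P :: Q :: l => .seq P (block (Q :: l))

/-- Look up the arc from register `37` to register `38`; the answer is put into register `46`. -/
def lookup : RamProg := block
  [.op .mul 40 37 4, .op .add 41 6 40, .op .add 41 41 38, .load 42 41, .op .add 43 7 37,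
   .load 44 43, .op .add 45 5 40, .op .lt 46 42 44,
   .ite 46 (block [.op .add 47 45 42, .load 47 47, .op .eq 46 47 38]) .skip]

/-- Insert the arc from register `37` to register `38`. -/
def insertArc : RamProg := .seq lookup (.ite 46 .skip (block
  [.op .add 47 45 44, .store 47 38, .store 41 44, .op .add 44 44 15, .store 43 44]))

/-- Delete the arc from register `37` to register `38`. -/
def deleteArc : RamProg := .seq lookup (.ite 46 (block
  [.op .sub 44 44 15, .op .add 47 45 44, .load 48 47, .op .add 47 45 42, .store 47 48,
   .op .add 47 6 40, .op .add 47 47 48, .store 47 42, .store 43 44]) .skip)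

/-- Exchange registers `37` and `38`. -/
def swapEnds : RamProg := block [.op .add 49 37 16, .op .add 37 38 16, .op .add 38 49 16]

/-- Apply the update in registers `37`, `38`, `39` to the adjacency lists. -/
def applyOp : RamProg := .seq (.op .eq 40 37 38) (.ite 40 .skip (.ite 39
  (.seq deleteArc (.seq swapEnds deleteArc)) (.seq insertArc (.seq swapEnds insertArc))))

end RamProg

/-- The memory `m'` holds the directed graph `E` and agrees with `m` outside the adjacency lists. -/
structure ArcChange (n : ℕ) (E : ℕ → ℕ → Prop) (m m' : ℕ → ℕ) : Prop where
  stores : Stores n E m'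
  out : ∀ x, x < n * n ∨ 3 * (n * n) + n ≤ x → m' x = m x

namespace ArcChange

variable {n u v : ℕ} {E E' : ℕ → ℕ → Prop} {m m' m'' : ℕ → ℕ}

theorem refl (h : Stores n E m) (hE : ∀ u < n, ∀ v < n, E u v ↔ E' u v) : ArcChange n E' m m :=
  ⟨h.congr hE fun _ _ _ => rfl, fun _ _ => rfl⟩

theorem trans (h : ArcChange n E m m') (h' : ArcChange n E' m' m'') : ArcChange n E' m m'' :=
  ⟨h'.stores, fun x hx => (h'.out x hx).trans (h.out x hx)⟩

theorem congr (h : ArcChange n E m m') (hE : ∀ u < n, ∀ v < n, E u v ↔ E' u v) :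
    ArcChange n E' m m' :=
  ⟨h.stores.congr hE fun _ _ _ => rfl, h.out⟩

theorem insert (h : Stores n E m) (hu : u < n) (hv : v < n) (hE : ¬ E u v) :
    ArcChange n (fun x y => E x y ∨ (x = u ∧ y = v)) m
      (Function.update (Function.update (Function.update m
        (n * n + u * n + m (3 * (n * n) + u)) v)
        (2 * (n * n) + u * n + v) (m (3 * (n * n) + u)))
        (3 * (n * n) + u) (m (3 * (n * n) + u) + 1)) := by
  refine ⟨h.insert hu hv hE, fun x hx => ?_⟩
  have h1 := cell_lt hu ((h u hu).lt_of_not_mem hv hE)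
  have h2 := cell_lt hu hv
  rw [Function.update_of_ne (by omega), Function.update_of_ne (by omega),
    Function.update_of_ne (by omega)]

theorem erase (h : Stores n E m) (hu : u < n) (hv : v < n) (hE : E u v) :
    ArcChange n (fun x y => E x y ∧ ¬ (x = u ∧ y = v)) m
      (Function.update (Function.update (Function.update m
        (n * n + u * n + m (2 * (n * n) + u * n + v))
          (m (n * n + u * n + (m (3 * (n * n) + u) - 1))))
        (2 * (n * n) + u * n + m (n * n + u * n + (m (3 * (n * n) + u) - 1)))
          (m (2 * (n * n) + u * n + v)))
        (3 * (n * n) + u) (m (3 * (n * n) + u) - 1)) := by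
  refine ⟨h.erase hu hv hE, fun x hx => ?_⟩
  have hd := (h u hu).le
  have hp := (h u hu).pos v hv hE
  have hl := (h u hu).elem (m (3 * (n * n) + u) - 1) (by omega)
  have h1 := cell_lt hu (show m (2 * (n * n) + u * n + v) < n by omega)
  have h2 := cell_lt hu hl.1
  rw [Function.update_of_ne (by omega), Function.update_of_ne (by omega),
    Function.update_of_ne (by omega)]

end ArcChange

/-- The arcs of a graph. -/
def arcs {n : ℕ} (G : SimpleGraph (Fin n)) (u v : ℕ) : Prop :=
  ∃ (hu : u < n) (hv : v < n), G.Adj ⟨u, hu⟩ ⟨v, hv⟩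

namespace EdgeUpdate

variable {n : ℕ}

/-- The code of the kind of an update. -/
def kind : EdgeUpdate n → ℕ
  | .insert _ _ => 0
  | .delete _ _ => 1

/-- The first vertex of an update. -/
def fst : EdgeUpdate n → Fin n
  | .insert u _ => u
  | .delete u _ => u

/-- The second vertex of an update. -/
def snd : EdgeUpdate n → Fin n
  | .insert _ v => v
  | .delete _ v => v

theorem receive_eq (s : RamState) (e : EdgeUpdate n) :
    s.receive e = ((s.setReg 1 e.kind).setReg 2 e.fst).setReg 3 e.snd := by
  cases e <;> rfl

theorem arcs_apply (G : SimpleGraph (Fin n)) (e : EdgeUpdate n) (x y : ℕ) :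
    arcs (e.apply G) x y ↔
      if (e.fst : ℕ) = e.snd then arcs G x y
      else if e.kind = 0 then
        (arcs G x y ∨ (x = e.fst ∧ y = e.snd)) ∨ (x = e.snd ∧ y = e.fst)
      else (arcs G x y ∧ ¬ (x = e.fst ∧ y = e.snd)) ∧ ¬ (x = e.snd ∧ y = e.fst) := by
  cases e with
  | insert u v =>
    simp only [apply, fst, snd, kind, if_true, arcs, SimpleGraph.sup_adj, SimpleGraph.edge_adj]
    split_ifs with h
    · obtain rfl : u = v := Fin.ext h
      constructor
      · rintro ⟨hx, hy, h1 | ⟨h3, h2⟩⟩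
        exacts [⟨hx, hy, h1⟩, absurd (by rcases h3 with ⟨h, h'⟩ | ⟨h, h'⟩ <;> exact h.trans h'.symm) h2]
      · rintro ⟨hx, hy, h1⟩
        exact ⟨hx, hy, .inl h1⟩
    · constructor
      · rintro ⟨hx, hy, h1 | ⟨⟨rfl, rfl⟩ | ⟨rfl, rfl⟩, h2⟩⟩
        exacts [.inl (.inl ⟨hx, hy, h1⟩), .inl (.inr ⟨rfl, rfl⟩), .inr ⟨rfl, rfl⟩]
      · rintro ((⟨hx, hy, h1⟩ | ⟨rfl, rfl⟩) | ⟨rfl, rfl⟩)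
        · exact ⟨hx, hy, .inl h1⟩
        · exact ⟨u.2, v.2, .inr ⟨.inl ⟨rfl, rfl⟩, fun h' => h (congrArg Fin.val h')⟩⟩
        · exact ⟨v.2, u.2, .inr ⟨.inr ⟨rfl, rfl⟩, fun h' => h (congrArg Fin.val h'.symm)⟩⟩
  | delete u v =>
    simp only [apply, fst, snd, kind, one_ne_zero, if_false, arcs, SimpleGraph.deleteEdges_adj,
      Set.mem_singleton_iff, Sym2.eq_iff, Fin.ext_iff]
    split_ifs with h
    · constructor
      · rintro ⟨hx, hy, h1, h2⟩
        exact ⟨hx, hy, h1⟩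
      · rintro ⟨hx, hy, h1⟩
        refine ⟨hx, hy, h1, ?_⟩
        have := h1.ne
        simp only [ne_eq, Fin.mk.injEq] at this
        omega
    · constructor
      · rintro ⟨hx, hy, h1, h2⟩
        exact ⟨⟨⟨hx, hy, h1⟩, by tauto⟩, by tauto⟩
      · rintro ⟨⟨⟨hx, hy, h1⟩, h2⟩, h3⟩
        exact ⟨hx, hy, h1, by tauto⟩

end EdgeUpdate

namespace RamProg

open RamState

variable {w : ℕ} {P : Params} {s : RamState} {E : ℕ → ℕ → Prop} {u v : ℕ}

/-- `lookup` performs the cross-check of `IsRow.mem_iff`. Its two ways to fail, position out of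
range or another vertex at that position, lead to the same insertion. -/
theorem insertArc_sure (hw : P.Ok w) (hc : Cfg P s) (hE : Stores P.n E s.mem) (hu : u < P.n)
    (hv : v < P.n) (h37 : s.reg 37 = u) (h38 : s.reg 38 = v) :
    Sure w insertArc s insertArc.cost fun s' =>
      ArcChange P.n (fun x y => E x y ∨ (x = u ∧ y = v)) s.mem s'.mem := by
  have hm := hw.mem
  have huv := cell_lt hu hv
  have hrow := hE u hu
  have hd := hrow.le
  have hiff := hrow.mem_iff hv
  have old : E u v → ArcChange P.n (fun x y => E x y ∨ (x = u ∧ y = v)) s.mem s.mem := by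
    intro h
    refine ArcChange.refl hE fun x hx y hy => ⟨.inl, ?_⟩
    rintro (h1 | ⟨rfl, rfl⟩)
    exacts [h1, h]
  have new : ¬ E u v → _ := fun h => ArcChange.insert hE hu hv h
  have new' : ¬ E u v → s.mem (3 * (P.n * P.n) + u) < P.n := fun h => hrow.lt_of_not_mem hv h
  refine Sure.of_wp ?_
  simp only [insertArc, lookup, block, wp, reg_setReg, mem_setReg, reg_setMem, mem_setMem,
    Nat.reduceEqDiff, reduceIte, h37, h38, hc.r4, hc.r5, hc.r6, hc.r7, hc.r15, ne_eq, one_ne_zero,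
    not_false_eq_true, not_true_eq_false, true_implies, false_implies, true_and, and_true]
  refine ⟨by omega, by omega, by omega, by omega, by omega, by omega, fun h1 => ⟨by omega, by omega,
    fun h2 => old (hiff.mpr ⟨h1, h2⟩), fun h2 => ?_⟩, fun h1 => ?_⟩
  all_goals
    have hn : ¬ E u v := fun h => by have := hiff.mp h; omega
    have := cell_lt hu (new' hn)
    exact ⟨by omega, by omega, new hn⟩

theorem deleteArc_sure (hw : P.Ok w) (hc : Cfg P s) (hE : Stores P.n E s.mem) (hu : u < P.n)
    (hv : v < P.n) (h37 : s.reg 37 = u) (h38 : s.reg 38 = v) :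
    Sure w deleteArc s deleteArc.cost fun s' =>
      ArcChange P.n (fun x y => E x y ∧ ¬ (x = u ∧ y = v)) s.mem s'.mem := by
  have hm := hw.mem
  have huv := cell_lt hu hv
  have hrow := hE u hu
  have hd := hrow.le
  have hiff := hrow.mem_iff hv
  have old : ¬ E u v → ArcChange P.n (fun x y => E x y ∧ ¬ (x = u ∧ y = v)) s.mem s.mem := by
    intro h
    refine ArcChange.refl hE fun x hx y hy => ⟨fun h1 => ⟨h1, ?_⟩, And.left⟩
    rintro ⟨rfl, rfl⟩
    exact h h1
  have new : E u v → _ := fun h => ArcChange.erase hE hu hv h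
  refine Sure.of_wp ?_
  simp only [deleteArc, lookup, block, wp, reg_setReg, mem_setReg, reg_setMem, mem_setMem,
    Nat.reduceEqDiff, reduceIte, h37, h38, hc.r4, hc.r5, hc.r6, hc.r7, hc.r15, ne_eq, one_ne_zero,
    not_false_eq_true, not_true_eq_false, true_implies, false_implies, true_and, and_true]
  refine ⟨by omega, by omega, by omega, by omega, by omega, by omega, fun h1 => ⟨by omega, by omega,
    fun h2 => ?_, fun h2 => old fun h => ?_⟩, fun h1 => old fun h => ?_⟩
  · have hE' := hiff.mpr ⟨h1, h2⟩
    have hl := (hrow.elem (s.mem (3 * (P.n * P.n) + u) - 1) (by omega)).1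
    have := cell_lt hu (show s.mem (3 * (P.n * P.n) + u) - 1 < P.n by omega)
    have h3 := new hE'
    have hp := cell_lt hu (show s.mem (2 * (P.n * P.n) + u * P.n + v) < P.n by omega)
    have h4 := cell_lt hu hl
    exact ⟨by omega, by omega, by omega, by omega, by omega, h3⟩
  · exact h2 (hiff.mp h).2
  · have := (hiff.mp h).1; omega

/-- An edge is stored as two opposite arcs. Self-loops are filtered out first, since inserting an
arc from a vertex to itself would change the stored graph. -/
theorem applyOp_sure (hw : P.Ok w) (hc : Cfg P s) {G : SimpleGraph (Fin P.n)}
    (hE : Stores P.n (arcs G) s.mem) (e : EdgeUpdate P.n)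
    (h37 : s.reg 37 = e.fst) (h38 : s.reg 38 = e.snd) (h39 : s.reg 39 = e.kind) :
    Sure w applyOp s applyOp.cost fun s' => ArcChange P.n (arcs (e.apply G)) s.mem s'.mem ∧
      ∀ r, r < 37 ∨ 50 ≤ r → s'.reg r = s.reg r := by
  have hm := hw.mem
  have harcs := e.arcs_apply G
  have av : ∀ r, r < 37 ∨ 50 ≤ r → applyOp.Avoids r := by
    intro r hr
    simp only [applyOp, deleteArc, insertArc, swapEnds, lookup, block, Avoids, true_and, and_true]
    omega
  have hu := e.fst.2
  have hv := e.snd.2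
  have swap : ∀ s₁ : RamState, Cfg P s₁ → s₁.reg 37 = e.fst → s₁.reg 38 = e.snd →
      Sure w swapEnds s₁ swapEnds.cost fun s' =>
        (s'.mem = s₁.mem ∧ s'.reg 37 = e.snd ∧ s'.reg 38 = e.fst) := by
    intro s₁ hc₁ h37 h38
    refine Sure.of_wp ?_
    simp only [swapEnds, block, wp, reg_setReg, mem_setReg, Nat.reduceEqDiff, reduceIte, h37, h38,
      hc₁.r16, add_zero, and_true]
    omega
  have hsw : ∀ r, (r < 37 ∨ r = 39) → swapEnds.Avoids r := by
    intro r hr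
    simp only [swapEnds, block, Avoids]
    omega
  have hin : ∀ r, r < 40 → insertArc.Avoids r := by
    intro r hr
    simp only [insertArc, lookup, block, Avoids, true_and, and_true]
    omega
  have hdel : ∀ r, r < 40 → deleteArc.Avoids r := by
    intro r hr
    simp only [deleteArc, lookup, block, Avoids, true_and, and_true]
    omega
  refine Sure.mono (Sure.frame (Q := fun s' => ArcChange P.n (arcs (e.apply G)) s.mem s'.mem) ?_)
    fun s' h => ⟨h.1, fun r hr => h.2 r (av r hr)⟩
  unfold applyOp
  refine (Sure.seq (T₁ := 1) (T₂ := max 1 (max (deleteArc.cost + (swapEnds.cost + deleteArc.cost + 1) + 1)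
    (insertArc.cost + (swapEnds.cost + insertArc.cost + 1) + 1) + 1) + 1)
    (Q := fun s' => (s'.reg 40 = if (e.fst : ℕ) = e.snd then 1 else 0) ∧ s'.mem = s.mem ∧
    ∀ r, r < 40 → s'.reg r = s.reg r) ?_ ?_)
  · refine Sure.of_wp (P := .op .eq 40 37 38) ?_
    simp only [wp, reg_setReg, mem_setReg, reduceIte, h37, h38]
    refine ⟨by omega, fun h => ⟨by simp [h], trivial, fun r hr => ?_⟩,
      fun h => ⟨by simp [h], trivial, fun r hr => ?_⟩⟩ <;> rw [if_neg (by omega)]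
  · rintro s₁ ⟨h40, hmem, hreg⟩
    have hc₁ : Cfg P s₁ := hc.frame fun r _ hr => hreg r (by omega)
    rw [← hmem] at hE
    refine Spec.ite (fun h => ?_) fun h => ?_
    · have heq : (e.fst : ℕ) = e.snd := by
        by_contra h'
        exact h (by rw [h40, if_neg h'])
      refine (Sure.of_wp (P := .skip) ?_).mono_time (le_max_left _ _)
      rw [← hmem]
      refine ArcChange.refl hE fun x _ y _ => ?_
      rw [harcs, if_pos heq]
    · have hne : ¬ (e.fst : ℕ) = e.snd := by
        intro h'
        rw [h40, if_pos h'] at h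
        omega
      refine Spec.mono_time (Spec.ite (T := max (deleteArc.cost + (swapEnds.cost + deleteArc.cost + 1) + 1)
        (insertArc.cost + (swapEnds.cost + insertArc.cost + 1) + 1)) (fun h => ?_) fun h => ?_) (le_max_right _ _)
      · rw [hreg 39 (by omega), h39] at h
        refine Spec.mono_time ?_ (le_max_left _ _)
        refine Sure.seq (deleteArc_sure hw hc₁ hE hu hv (by rw [hreg 37 (by omega), h37])
          (by rw [hreg 38 (by omega), h38])).frame ?_
        rintro s₂ ⟨h2, hr2⟩
        have hc₂ : Cfg P s₂ := hc₁.frame fun r _ hr => hr2 r (hdel r (by omega))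
        refine Sure.seq (swap s₂ hc₂ (by rw [hr2 37 (hdel _ (by omega)), hreg 37 (by omega), h37])
          (by rw [hr2 38 (hdel _ (by omega)), hreg 38 (by omega), h38])).frame ?_
        rintro s₃ ⟨⟨h3, h37', h38'⟩, hr3⟩
        have hc₃ : Cfg P s₃ := hc₂.frame fun r _ hr => hr3 r (hsw r (by omega))
        refine (deleteArc_sure hw hc₃ (by rw [h3]; exact h2.stores) hv hu h37' h38').mono ?_
        intro s₄ h4
        rw [h3] at h4
        rw [← hmem]
        refine (h2.trans h4).congr fun x _ y _ => ?_
        rw [harcs, if_neg hne, if_neg h]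
      · rw [hreg 39 (by omega), h39] at h
        refine Spec.mono_time ?_ (le_max_right _ _)
        refine Sure.seq (insertArc_sure hw hc₁ hE hu hv (by rw [hreg 37 (by omega), h37])
          (by rw [hreg 38 (by omega), h38])).frame ?_
        rintro s₂ ⟨h2, hr2⟩
        have hc₂ : Cfg P s₂ := hc₁.frame fun r _ hr => hr2 r (hin r (by omega))
        refine Sure.seq (swap s₂ hc₂ (by rw [hr2 37 (hin _ (by omega)), hreg 37 (by omega), h37])
          (by rw [hr2 38 (hin _ (by omega)), hreg 38 (by omega), h38])).frame ?_
        rintro s₃ ⟨⟨h3, h37', h38'⟩, hr3⟩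
        have hc₃ : Cfg P s₃ := hc₂.frame fun r _ hr => hr3 r (hsw r (by omega))
        refine (insertArc_sure hw hc₃ (by rw [h3]; exact h2.stores) hv hu h37' h38').mono ?_
        intro s₄ h4
        rw [h3] at h4
        rw [← hmem]
        refine (h2.trans h4).congr fun x _ y _ => ?_
        rw [harcs, if_neg hne, if_pos h]

end RamProg

/-! ### A search -/

/-- The number of vertices of the component of vertex `u`. -/
noncomputable def compSizeAt {n : ℕ} (G : SimpleGraph (Fin n)) (u : ℕ) : ℕ :=
  if h : u < n then G.compSize ⟨u, h⟩ else 1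

/-- Vertices `u` and `v` are in the same component. -/
def Linked {n : ℕ} (G : SimpleGraph (Fin n)) (u v : ℕ) : Prop :=
  ∃ (hu : u < n) (hv : v < n), G.Reachable ⟨u, hu⟩ ⟨v, hv⟩

/-- The default value `1` for numbers that are not vertices keeps the size positive everywhere. -/
theorem compSizeAt_pos {n : ℕ} (G : SimpleGraph (Fin n)) (u : ℕ) : 0 < compSizeAt G u := by
  unfold compSizeAt
  split_ifs
  · exact G.compSize_pos _
  · exact one_pos

theorem sum_inv_compSizeAt {n : ℕ} (G : SimpleGraph (Fin n)) :
    ∑ u ∈ Finset.range n, (compSizeAt G u : ℝ)⁻¹ = numCC G := by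
  rw [Finset.sum_range, numCC, ← G.sum_inv_compSize]
  exact Finset.sum_congr rfl fun u _ => by simp [compSizeAt]

theorem Linked.trans_arc {n : ℕ} {G : SimpleGraph (Fin n)} {u v x : ℕ} (h : Linked G u v)
    (ha : arcs G v x) : Linked G u x := by
  obtain ⟨hu, hv, h⟩ := h
  obtain ⟨hv', hx, ha⟩ := ha
  exact ⟨hu, hx, h.trans ha.reachable⟩

namespace IsRow

variable {n d u : ℕ} {V : ℕ → Prop} {a p : ℕ → ℕ} {G : SimpleGraph (Fin n)}

theorem ncard_eq (h : IsRow n V a p d) : {v : Fin n | V v}.ncard = d := by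
  have hinj : Function.Injective fun j : Fin d => (⟨a j, (h.elem j j.2).1⟩ : Fin n) := by
    intro i j hij
    refine Fin.ext (h.injOn (by simp) (by simp) ?_)
    simpa using hij
  have hrange : {v : Fin n | V v} =
      Set.range fun j : Fin d => (⟨a j, (h.elem j j.2).1⟩ : Fin n) := by
    ext v
    constructor
    · intro hv
      obtain ⟨h1, h2⟩ := h.pos v v.2 hv
      exact ⟨⟨p v, h1⟩, Fin.ext h2⟩
    · rintro ⟨j, rfl⟩
      exact (h.elem j j.2).2.1
  rw [hrange, ← Set.image_univ, Set.ncard_image_of_injective _ hinj, Set.ncard_univ,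
    Nat.card_eq_fintype_card, Fintype.card_fin]

theorem le_compSizeAt (h : IsRow n V a p d) (hu : u < n) (hV : ∀ v, V v → Linked G u v) :
    d ≤ compSizeAt G u := by
  rw [compSizeAt, dif_pos hu, ← h.ncard_eq]
  refine Set.ncard_le_ncard (fun v hv => ?_) (Set.toFinite _)
  obtain ⟨_, _, h1⟩ := hV v hv
  exact SimpleGraph.ConnectedComponent.sound h1.symm

/-- A set of vertices reachable from `u` that contains `u` and is closed under arcs is the whole
component. -/
theorem compSizeAt_eq (h : IsRow n V a p d) (hu : u < n) (hV : ∀ v, V v → Linked G u v)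
    (hVu : V u) (hcl : ∀ x y, V x → arcs G x y → V y) : compSizeAt G u = d := by
  refine le_antisymm ?_ (h.le_compSizeAt hu hV)
  rw [compSizeAt, dif_pos hu, ← h.ncard_eq]
  refine Set.ncard_le_ncard (fun v hv => ?_) (Set.toFinite _)
  obtain ⟨q⟩ := (SimpleGraph.ConnectedComponent.exact hv : G.Reachable v ⟨u, hu⟩).symm
  have : ∀ x y : Fin n, G.Walk x y → V x → V y := by
    intro x y q
    induction q with
    | nil => exact id
    | cons hadj _ ih => exact fun hx => ih (hcl _ _ hx ⟨_, _, hadj⟩)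
  exact this _ _ q hVu

end IsRow

/-- The state of a search in the graph `G` whose visited vertices form the set `V`: the memory is `m`,
the threshold `a`, the length of the queue `cnt`, its current position `h`, and the position in the
adjacency list of the current vertex is `j`. -/
structure Search {n : ℕ} (G : SimpleGraph (Fin n)) (M : ℕ) (V : ℕ → Prop) (m : ℕ → ℕ)
    (a cnt h j : ℕ) : Prop where
  row : IsRow n V (fun i => m (3 * (n * n) + n + i)) (fun v => m (3 * (n * n) + 2 * n + v)) cnt
  cnt_pos : 1 ≤ cnt
  linked : ∀ v, V v → Linked G (m (3 * (n * n) + n)) v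
  le_cnt : h ≤ cnt
  -- The queue before position `h` is completely processed; at `h = cnt` this makes the visited set
  -- closed under arcs.
  done : ∀ i < h, ∀ y, arcs G (m (3 * (n * n) + n + i)) y → V y
  cur : h < cnt → j ≤ m (3 * (n * n) + m (3 * (n * n) + n + h)) ∧
    ∀ i < j, V (m (n * n + m (3 * (n * n) + n + h) * n + i))
  fin : h = cnt → j = 0
  -- A search is abandoned as soon as this would fail, so it also bounds the number of visited
  -- vertices.
  thr : cnt * cnt * a ≤ M
  a_pos : 1 ≤ a

namespace Search

variable {n M a cnt h j : ℕ} {G : SimpleGraph (Fin n)} {V : ℕ → Prop} {m m' : ℕ → ℕ}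

theorem root (hs : Search G M V m a cnt h j) : m (3 * (n * n) + n) < n ∧ V (m (3 * (n * n) + n)) := by
  have := hs.row.elem 0 hs.cnt_pos
  simp only [add_zero] at this
  exact ⟨this.1, this.2.1⟩

theorem cnt_le_sqrt (hs : Search G M V m a cnt h j) : cnt ≤ Nat.sqrt (M / a) :=
  Nat.le_sqrt.mpr ((Nat.le_div_iff_mul_le hs.a_pos).mpr hs.thr)

/-- The first `j` neighbours in the current list are distinct and all visited. So the time of a
search is bounded by the number of visited vertices, irrespective of degrees. -/
theorem j_le (hs : Search G M V m a cnt h j) (hE : Stores n (arcs G) m) : j ≤ cnt := by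
  rcases hs.le_cnt.lt_or_eq with hlt | heq
  · obtain ⟨h1, h2⟩ := hs.cur hlt
    have hv := (hs.row.elem h hlt).1
    have hrow := hE _ hv
    have := Finset.card_le_card_of_injOn (s := Finset.range j) (t := Finset.range cnt)
      (fun i => m (3 * (n * n) + 2 * n + m (n * n + m (3 * (n * n) + n + h) * n + i)))
      (fun i hi => by
        have hi' : i < j := by simpa using hi
        have h3 := hrow.elem i (by omega)
        simpa using (hs.row.pos _ h3.1 (h2 i hi')).1)
      (fun i hi i' hi' hii => by
        have hi1 : i < j := by simpa using hi
        have hi2 : i' < j := by simpa using hi'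
        have h3 := hrow.elem i (by omega)
        have h4 := hrow.elem i' (by omega)
        have h5 := (hs.row.pos _ h3.1 (h2 i hi1)).2
        have h6 := (hs.row.pos _ h4.1 (h2 i' hi2)).2
        simp only at hii h5 h6 h3 h4
        rw [hii, h6] at h5
        rw [← h3.2.2, ← h4.2.2, h5])
    simpa using this
  · rw [hs.fin heq]
    exact Nat.zero_le _

/-- Only two cells are written: stale entries of an earlier search are invalidated by the queue
length `1`. -/
theorem init {u : ℕ} (hu : u < n) (ha : 1 ≤ a) (haM : a ≤ M) :
    Search G M (fun v => v = u) (Function.update (Function.update m (3 * (n * n) + n) u)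
      (3 * (n * n) + 2 * n + u) 0) a 1 0 0 := by
  have h0 : Function.update (Function.update m (3 * (n * n) + n) u)
      (3 * (n * n) + 2 * n + u) 0 (3 * (n * n) + n) = u := by
    rw [Function.update_of_ne (by omega), Function.update_self]
  refine ⟨⟨fun i hi => ?_, ?_⟩, le_rfl, ?_, Nat.zero_le _, fun i hi => absurd hi (by omega),
    fun _ => ⟨Nat.zero_le _, fun i hi => absurd hi (by omega)⟩, fun _ => rfl, by simpa using haM, ha⟩
  · obtain rfl : i = 0 := by omega
    simp only [add_zero, h0, Function.update_self, hu, and_self]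
  · rintro v hv rfl
    simp only [add_zero, h0, Function.update_self, zero_lt_one, and_self]
  · rintro v rfl
    rw [h0]
    exact ⟨hu, hu, SimpleGraph.Reachable.refl _⟩

theorem next (hs : Search G M V m a cnt h j) (hE : Stores n (arcs G) m) (hh : h < cnt)
    (hj : m (3 * (n * n) + m (3 * (n * n) + n + h)) ≤ j) : Search G M V m a cnt (h + 1) 0 := by
  have hv := (hs.row.elem h hh).1
  have hrow := hE _ hv
  refine ⟨hs.row, hs.cnt_pos, hs.linked, hh, fun i hi y hy => ?_,
    fun _ => ⟨Nat.zero_le _, fun i hi => absurd hi (by omega)⟩, fun _ => rfl, hs.thr, hs.a_pos⟩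
  rcases (Nat.lt_succ_iff.mp hi).lt_or_eq with hi | rfl
  · exact hs.done i hi y hy
  · have hy' : y < n := hy.2.1
    obtain ⟨h1, h2⟩ := hrow.pos y hy' hy
    have := (hs.cur hh).2 _ (h1.trans_le hj)
    rwa [h2] at this

theorem seen (hs : Search G M V m a cnt h j) (hh : h < cnt)
    (hj : j < m (3 * (n * n) + m (3 * (n * n) + n + h)))
    (hx : V (m (n * n + m (3 * (n * n) + n + h) * n + j))) : Search G M V m a cnt h (j + 1) := by
  refine ⟨hs.row, hs.cnt_pos, hs.linked, hs.le_cnt, hs.done, fun _ => ⟨hj, fun i hi => ?_⟩,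
    fun h' => absurd h' hh.ne, hs.thr, hs.a_pos⟩
  rcases (Nat.lt_succ_iff.mp hi).lt_or_eq with hi | rfl
  · exact (hs.cur hh).2 i hi
  · exact hx

/-- The memory after a new vertex was visited. -/
theorem visit_row (hs : Search G M V m a cnt h j) {x : ℕ} (hx : x < n) (hxV : ¬ V x) :
    IsRow n (fun y => V y ∨ y = x)
      (fun i => Function.update (Function.update m (3 * (n * n) + n + cnt) x)
        (3 * (n * n) + 2 * n + x) cnt (3 * (n * n) + n + i))
      (fun v => Function.update (Function.update m (3 * (n * n) + n + cnt) x)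
        (3 * (n * n) + 2 * n + x) cnt (3 * (n * n) + 2 * n + v)) (cnt + 1) := by
  have hlt := hs.row.lt_of_not_mem hx hxV
  refine (hs.row.insert hx hxV).congr (fun _ _ => Iff.rfl) (fun i hi => ?_) fun v hv => ?_
  · rw [Function.update_of_ne (by omega)]
    simp only [Function.update_apply, Nat.add_left_cancel_iff]
  · simp only [Function.update_apply, Nat.add_left_cancel_iff]
    rw [if_neg (show ¬ 3 * (n * n) + 2 * n + v = 3 * (n * n) + n + cnt by omega)]

theorem visit_linked (hs : Search G M V m a cnt h j) {x : ℕ} (hh : h < cnt)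
    (hx : arcs G (m (3 * (n * n) + n + h)) x) :
    ∀ v, V v ∨ v = x → Linked G (m (3 * (n * n) + n)) v := by
  rintro v (hv | rfl)
  · exact hs.linked v hv
  · exact (hs.linked _ (hs.row.elem h hh).2.1).trans_arc hx

/-- The two written cells lie beyond the occupied part of the queue and in the position table, so
the adjacency lists and the earlier queue entries survive. -/
theorem visit (hs : Search G M V m a cnt h j) (hE : Stores n (arcs G) m) (hh : h < cnt)
    (hj : j < m (3 * (n * n) + m (3 * (n * n) + n + h))) {x : ℕ}
    (hxj : m (n * n + m (3 * (n * n) + n + h) * n + j) = x) (hxV : ¬ V x)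
    (hthr : (cnt + 1) * (cnt + 1) * a ≤ M) :
    Search G M (fun y => V y ∨ y = x) (Function.update (Function.update m
      (3 * (n * n) + n + cnt) x) (3 * (n * n) + 2 * n + x) cnt) a (cnt + 1) h (j + 1) := by
  have hv := (hs.row.elem h hh).1
  have hxe := (hE _ hv).elem j hj
  simp only [hxj] at hxe
  have hlt := hs.row.lt_of_not_mem hxe.1 hxV
  have hq : ∀ i < cnt, Function.update (Function.update m
      (3 * (n * n) + n + cnt) x) (3 * (n * n) + 2 * n + x) cnt (3 * (n * n) + n + i) =
      m (3 * (n * n) + n + i) := by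
    intro i hi
    rw [Function.update_of_ne (by omega), Function.update_of_ne (by omega)]
  have hlow : ∀ y < 3 * (n * n) + n, Function.update (Function.update m
      (3 * (n * n) + n + cnt) x) (3 * (n * n) + 2 * n + x) cnt y = m y := by
    intro y hy
    rw [Function.update_of_ne (by omega), Function.update_of_ne (by omega)]
  have hq0 := hq 0 hs.cnt_pos
  simp only [add_zero] at hq0
  refine ⟨hs.visit_row hxe.1 hxV, by omega, ?_, by have := hs.le_cnt; omega, fun i hi y hy => ?_,
    fun _ => ?_, fun h' => absurd h' (by omega), hthr, hs.a_pos⟩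
  · rw [hq0]
    exact hs.visit_linked hh hxe.2.1
  · rw [hq i (by omega)] at hy
    exact .inl (hs.done i hi y hy)
  · rw [hq h hh]
    rw [hlow (3 * (n * n) + _) (by omega)]
    refine ⟨hj, fun i hi => ?_⟩
    have h1 := (hE _ hv).le
    have h2 := cell_lt hv (show i < n by omega)
    rw [hlow _ (by omega)]
    rcases (Nat.lt_succ_iff.mp hi).lt_or_eq with hi | rfl
    · exact .inl ((hs.cur hh).2 i hi)
    · exact .inr hxj

/-- When the queue is exhausted, the visited set is the component, and the test `thr` is the
defining condition of the sample. -/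
theorem sampleValue_of_done (hs : Search G M V m a cnt h j) (hh : h = cnt) :
    sampleValue M (compSizeAt G (m (3 * (n * n) + n))) a = cnt := by
  have : compSizeAt G (m (3 * (n * n) + n)) = cnt := by
    refine hs.row.compSizeAt_eq hs.root.1 hs.linked hs.root.2 fun x y hx hxy => ?_
    obtain ⟨h1, h2⟩ := hs.row.pos x hxy.1 hx
    refine hs.done _ (hh ▸ h1) y ?_
    rwa [h2]
  rw [this, sampleValue, if_pos hs.thr]

/-- An unvisited neighbour shows that the component has at least `cnt + 1` vertices, too many for
the threshold; so the value is zero although its size is unknown. -/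
theorem sampleValue_of_fail (hs : Search G M V m a cnt h j) (hE : Stores n (arcs G) m) (hh : h < cnt)
    (hj : j < m (3 * (n * n) + m (3 * (n * n) + n + h))) {x : ℕ}
    (hxj : m (n * n + m (3 * (n * n) + n + h) * n + j) = x) (hxV : ¬ V x)
    (hthr : M < (cnt + 1) * (cnt + 1) * a) :
    sampleValue M (compSizeAt G (m (3 * (n * n) + n))) a = 0 := by
  have hxe := (hE _ (hs.row.elem h hh).1).elem j hj
  simp only [hxj] at hxe
  have hle := (hs.visit_row hxe.1 hxV).le_compSizeAt hs.root.1 (hs.visit_linked hh hxe.2.1)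
  rw [sampleValue, if_neg]
  have := Nat.mul_le_mul_right a (Nat.mul_le_mul hle hle)
  omega

end Search

/-! ### The sampler -/

namespace RamProg

/-- Start a search at the vertex in register `41`; register `33` holds the threshold minus one. -/
def initSearch : RamProg := block
  [.op .add 33 33 15, .store 10 41, .op .add 42 11 41, .store 42 16, .const 34 1, .const 35 0,
   .const 36 0, .const 30 1]

/-- Draw a sample. -/
def startSample : RamProg := .seq (.rand 41 4) (.seq (.rand 33 17) initSearch)

/-- The current component was explored. -/
def finishSample : RamProg := block [.op .add 32 32 34, .op .add 31 31 15, .const 30 0]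

/-- Visit the vertex in register `43`, whose position cell is in register `44`. -/
def visitVertex : RamProg := block
  [.op .add 47 10 34, .store 47 43, .store 44 34, .op .add 34 34 15, .op .mul 47 34 34,
   .op .mul 47 47 33, .op .lt 46 17 47, .ite 46 (block [.const 30 0, .op .add 31 31 15]) .skip]

/-- Follow the next arc from the vertex in register `41`. -/
def followArc : RamProg := block
  [.op .mul 43 41 4, .op .add 43 5 43, .op .add 43 43 36, .load 43 43, .op .add 36 36 15,
   .op .add 44 11 43, .load 45 44, .op .lt 46 45 34,
   .ite 46 (block [.op .add 47 10 45, .load 47 47, .op .eq 46 47 43]) .skip,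
   .ite 46 .skip visitVertex]

/-- One step of a search. -/
def stepSearch : RamProg := block
  [.op .lt 40 35 34,
   .ite 40 (block [.op .add 41 10 35, .load 41 41, .op .add 42 7 41, .load 42 42, .op .lt 43 36 42,
     .ite 43 followArc (block [.op .add 35 35 15, .const 36 0])]) finishSample]

/-- One step of the sampler. -/
def sampleStep : RamProg :=
  .ite 30 stepSearch (.seq (.op .lt 40 31 18) (.ite 40 startSample .skip))

end RamProg

/-- The state of the sampler between two samples. -/
structure SamplerIdle (P : Params) (s : RamState) : Prop where
  r30 : s.reg 30 = 0
  idx : s.reg 31 ≤ P.r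
  sum : s.reg 32 ≤ s.reg 31 * P.Q

/-- The state of the sampler during a search. -/
structure SamplerBusy (P : Params) (G : SimpleGraph (Fin P.n)) (s : RamState) : Prop where
  r30 : s.reg 30 = 1
  idx : s.reg 31 < P.r
  sum : s.reg 32 ≤ s.reg 31 * P.Q
  search : ∃ V, Search G (P.Q * P.Q) V s.mem (s.reg 33) (s.reg 34) (s.reg 35) (s.reg 36)

/-- The relative number of components. -/
noncomputable def density (P : Params) (G : SimpleGraph (Fin P.n)) : ℝ := numCC G / P.n

/-- The potential of the sampler, if `m` steps remain. -/
noncomputable def samplerPotential (P : Params) (G : SimpleGraph (Fin P.n)) (m : ℝ)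
    (s : RamState) : ℝ :=
  if s.reg 30 = 0 then
    -- Once all samples are drawn, time no longer matters and the time term is dropped.
    if s.reg 31 = P.r then deviation P.Q P.r (density P G) (s.reg 32) 0
    else potential P.Q P.g P.r (density P G) (s.reg 32) (P.r - s.reg 31) m
  -- During a search its final value is already determined by the root and the threshold, so it is
  -- counted in advance, as is the full cost. The progress `h (X + 1) + j` is credited back, and the
  -- `1` is the step that started the search.
  else potential P.Q P.g P.r (density P G)
    (s.reg 32 + sampleValue (P.Q * P.Q)
      (compSizeAt G (s.mem (3 * (P.n * P.n) + P.n))) (s.reg 33)) (P.r - (s.reg 31 + 1))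
    (m + 1 - (sampleCost (P.Q * P.Q) (s.reg 33) : ℝ) +
      (s.reg 35 * (Nat.sqrt (P.Q * P.Q / s.reg 33) + 1) + s.reg 36 : ℕ))

theorem samplerPotential_idle_le {P : Params} {G : SimpleGraph (Fin P.n)} {m : ℝ} {s : RamState}
    (h : s.reg 30 = 0) : samplerPotential P G m s ≤
      potential P.Q P.g P.r (density P G) (s.reg 32) (P.r - s.reg 31) m := by
  rw [samplerPotential, if_pos h]
  split_ifs with h1
  · rw [h1, Nat.sub_self]
    exact deviation_le_potential _ _ _
  · exact le_rfl

/-- The sampler works on the graph `G`. -/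
def SamplerInv (P : Params) (G : SimpleGraph (Fin P.n)) (s : RamState) : Prop :=
  SamplerIdle P s ∨ SamplerBusy P G s

/-- Memory outside the working space of the sampler is unchanged. -/
def KeepsOuter (n : ℕ) (m m' : ℕ → ℕ) : Prop :=
  ∀ x, x < 3 * (n * n) + n ∨ 3 * (n * n) + 3 * n ≤ x → m' x = m x

namespace RamProg

open RamState

variable {w : ℕ} {P : Params} {s : RamState} {G : SimpleGraph (Fin P.n)}

/-- Collects the size bounds that exclude overflow; the partial sum never exceeds `Q` per drawn
sample. -/
theorem sampler_bounds (hw : P.Ok w) {V : ℕ → Prop} {m : ℕ → ℕ} {a cnt h j idx S : ℕ}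
    (hs : Search G (P.Q * P.Q) V m a cnt h j) (hi : idx < P.r) (hS : S ≤ idx * P.Q) :
    cnt ≤ P.Q ∧ S + cnt ≤ (idx + 1) * P.Q ∧ S + cnt < 2 ^ w ∧ idx + 1 < 2 ^ w ∧
      (cnt + 1) * (cnt + 1) < 2 ^ w ∧ (cnt + 1) * (cnt + 1) * a < 2 ^ w := by
  have h1 := hs.thr
  have h2 := hs.a_pos
  have h3 := hs.cnt_pos
  have h4 := hw.thr
  have h5 : cnt * cnt ≤ P.Q * P.Q := by nlinarith
  have h6 : cnt ≤ P.Q := Nat.mul_self_le_mul_self_iff.mp h5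
  have h7 : S + cnt ≤ (idx + 1) * P.Q := by rw [Nat.add_mul]; omega
  have h8 : (idx + 1) * P.Q ≤ P.r * P.Q := Nat.mul_le_mul_right _ hi
  have h9 : P.r * P.Q * 1 ≤ P.r * P.Q * P.n := Nat.mul_le_mul_left _ hw.n_pos
  have h10 := hw.est
  have h11 : (cnt + 1) * (cnt + 1) ≤ 4 * (cnt * cnt) := by nlinarith
  have h12 : (cnt + 1) * (cnt + 1) * a ≤ 4 * (P.Q * P.Q) := by nlinarith
  refine ⟨h6, h7, by omega, by omega, by omega, by omega⟩

theorem sampler_room (hs : SamplerBusy P G s) (hE : Stores P.n (arcs G) s.mem) :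
    ∃ X, X = Nat.sqrt (P.Q * P.Q / s.reg 33) ∧ s.reg 34 ≤ X ∧ s.reg 35 ≤ s.reg 34 ∧
      s.reg 36 ≤ s.reg 34 ∧ sampleCost (P.Q * P.Q) (s.reg 33) = X * (X + 1) + 2 := by
  obtain ⟨V, hV⟩ := hs.search
  exact ⟨_, rfl, hV.cnt_le_sqrt, hV.le_cnt, hV.j_le hE, rfl⟩

/-- Search steps are deterministic. A step that continues the search increases the progress by at
least one, which compensates for the elapsed step; a step that ends it releases the unused part of
the prepaid cost. -/
theorem stepSearch_sure (hw : P.Ok w) (hc : Cfg P s) (hs : SamplerBusy P G s)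
    (hE : Stores P.n (arcs G) s.mem) (m : ℝ) :
    Sure w stepSearch s stepSearch.cost fun s' =>
      SamplerInv P G s' ∧ samplerPotential P G m s' ≤ samplerPotential P G (m + 1) s ∧
        KeepsOuter P.n s.mem s'.mem := by
  obtain ⟨X, hX, hcX, hhc, hjc, hcost⟩ := sampler_room hs hE
  have ⟨V, hV⟩ := hs.search
  obtain ⟨b1, b2, b3, b4, b5, b6⟩ := sampler_bounds hw hV hs.idx hs.sum
  have hmem := hw.mem
  have hcn := hV.row.le
  have hidx := hs.idx
  have hsum := hs.sum
  obtain ⟨v, hv⟩ : ∃ v, s.mem (3 * (P.n * P.n) + P.n + s.reg 35) = v := ⟨_, rfl⟩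
  obtain ⟨d, hd⟩ : ∃ d, s.mem (3 * (P.n * P.n) + v) = d := ⟨_, rfl⟩
  obtain ⟨x, hx⟩ : ∃ x, s.mem (P.n * P.n + v * P.n + s.reg 36) = x := ⟨_, rfl⟩
  obtain ⟨p, hp⟩ : ∃ p, s.mem (3 * (P.n * P.n) + 2 * P.n + x) = p := ⟨_, rfl⟩
  -- The postcondition is hidden behind an opaque predicate of the sampler registers and the memory,
  -- so that simplifying the precondition leaves it as an atom.
  obtain ⟨Φ, hΦ⟩ : ∃ Φ : ℕ → ℕ → ℕ → ℕ → ℕ → ℕ → ℕ → (ℕ → ℕ) → Prop,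
      Φ = fun r30 r31 r32 r33 r34 r35 r36 mem => ∀ s' : RamState, s'.reg 30 = r30 →
        s'.reg 31 = r31 → s'.reg 32 = r32 → s'.reg 33 = r33 → s'.reg 34 = r34 → s'.reg 35 = r35 →
        s'.reg 36 = r36 → s'.mem = mem → SamplerInv P G s' ∧
          samplerPotential P G m s' ≤ samplerPotential P G (m + 1) s ∧
          KeepsOuter P.n s.mem s'.mem := ⟨_, rfl⟩
  have hold : samplerPotential P G (m + 1) s = potential P.Q P.g P.r (density P G)
      (s.reg 32 + sampleValue (P.Q * P.Q)
        (compSizeAt G (s.mem (3 * (P.n * P.n) + P.n))) (s.reg 33)) (P.r - (s.reg 31 + 1))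
      (m - X * (X + 1) + (s.reg 35 * (X + 1) + s.reg 36)) := by
    rw [samplerPotential, hs.r30, if_neg one_ne_zero, hcost, ← hX]
    congr 1
    push_cast
    ring
  have busy : ∀ r34 r35 r36 mem V', Search G (P.Q * P.Q) V' mem (s.reg 33) r34 r35 r36 →
      KeepsOuter P.n s.mem mem → mem (3 * (P.n * P.n) + P.n) = s.mem (3 * (P.n * P.n) + P.n) →
      s.reg 35 * (X + 1) + s.reg 36 + 1 ≤ r35 * (X + 1) + r36 →
      Φ 1 (s.reg 31) (s.reg 32) (s.reg 33) r34 r35 r36 mem := by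
    intro r34 r35 r36 mem V' hS' hk hroot hφ
    rw [hΦ]
    intro s' e0 e1 e2 e3 e4 e5 e6 e7
    refine ⟨.inr ⟨e0, by omega, by rwa [e1, e2], V', ?_⟩, ?_, e7 ▸ hk⟩
    · rwa [e3, e4, e5, e6, e7]
    · rw [hold, samplerPotential, e0, if_neg one_ne_zero, e1, e2, e3, e5, e6, e7, hroot, hcost, ← hX]
      refine potential_anti _ _ ?_
      have : ((s.reg 35 * (X + 1) + s.reg 36 + 1 : ℕ) : ℝ) ≤ ((r35 * (X + 1) + r36 : ℕ) : ℝ) := by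
        exact_mod_cast hφ
      push_cast at this ⊢
      linarith
  have idle : ∀ y r34 r35 r36 mem,
      sampleValue (P.Q * P.Q) (compSizeAt G (s.mem (3 * (P.n * P.n) + P.n))) (s.reg 33) = y →
      y ≤ s.reg 34 → KeepsOuter P.n s.mem mem → s.reg 35 * (X + 1) + s.reg 36 ≤ X * (X + 1) →
      Φ 0 (s.reg 31 + 1) (s.reg 32 + y) (s.reg 33) r34 r35 r36 mem := by
    intro y r34 r35 r36 mem hy hy' hk hφ
    rw [hΦ]
    intro s' e0 e1 e2 e3 e4 e5 e6 e7
    refine ⟨.inl ⟨e0, by omega, by rw [e1, e2]; omega⟩, ?_, e7 ▸ hk⟩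
    rw [hold]
    refine (samplerPotential_idle_le e0).trans ?_
    rw [e1, e2, hy]
    refine potential_anti _ _ ?_
    have : ((s.reg 35 * (X + 1) + s.reg 36 : ℕ) : ℝ) ≤ ((X * (X + 1) : ℕ) : ℝ) := by
      exact_mod_cast hφ
    push_cast at this ⊢
    linarith
  -- The weight `X + 1` of a queue position exceeds every `j`, because `j ≤ cnt ≤ X`; this bounds
  -- the progress and makes moving to the next vertex count as progress.
  have hφ : s.reg 35 < s.reg 34 → s.reg 35 * (X + 1) + s.reg 36 ≤ X * (X + 1) := by
    intro h
    have : (s.reg 35 + 1) * (X + 1) ≤ X * (X + 1) := Nat.mul_le_mul_right _ (by omega)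
    rw [Nat.add_mul] at this
    omega
  refine Sure.mono (Q := fun s' => Φ (s'.reg 30) (s'.reg 31) (s'.reg 32) (s'.reg 33) (s'.reg 34)
    (s'.reg 35) (s'.reg 36) s'.mem) (Sure.of_wp ?_) fun s' h => by
      rw [hΦ] at h; exact h s' rfl rfl rfl rfl rfl rfl rfl rfl
  simp only [stepSearch, followArc, visitVertex, finishSample, block, wp, reg_setReg, mem_setReg,
    reg_setMem, mem_setMem, Nat.reduceEqDiff, reduceIte, hc.r4, hc.r5, hc.r7, hc.r10, hc.r11, hc.r15,
    hc.r17, ne_eq, one_ne_zero, not_false_eq_true, not_true_eq_false, true_implies, false_implies,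
    true_and, and_true, hv, hd, hx, hp, hs.r30]
  refine ⟨by omega, fun h1 => ?_, fun h1 => ?_⟩
  · have hvn := (hV.row.elem _ h1).1
    simp only [hv] at hvn
    have hrow := hE v hvn
    have hdn := hrow.le
    have hcur := hV.cur h1
    rw [hv, hd] at hcur
    rw [hd] at hdn
    refine ⟨by omega, by omega, by omega, fun h2 => ?_, fun h2 => ⟨by omega, ?_⟩⟩
    · have hxn := (hrow.elem (s.reg 36) (by rw [hd]; exact h2)).1
      simp only [hx] at hxn
      have hcell := cell_lt hvn (show s.reg 36 < P.n by omega)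
      have hxV := hV.row.mem_iff hxn
      rw [hp] at hxV
      have new : ¬ V x → 3 * (P.n * P.n) + P.n + s.reg 34 < 2 ^ w ∧ s.reg 34 + 1 < 2 ^ w ∧
          (s.reg 34 + 1) * (s.reg 34 + 1) < 2 ^ w ∧
          (s.reg 34 + 1) * (s.reg 34 + 1) * s.reg 33 < 2 ^ w ∧ 1 < 2 ^ w ∧
          (P.Q * P.Q < (s.reg 34 + 1) * (s.reg 34 + 1) * s.reg 33 → 0 < 2 ^ w ∧ s.reg 31 + 1 < 2 ^ w ∧
            Φ 0 (s.reg 31 + 1) (s.reg 32) (s.reg 33) (s.reg 34 + 1) (s.reg 35) (s.reg 36 + 1)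
              (Function.update (Function.update s.mem (3 * (P.n * P.n) + P.n + s.reg 34) x)
                (3 * (P.n * P.n) + 2 * P.n + x) (s.reg 34))) ∧
          ((s.reg 34 + 1) * (s.reg 34 + 1) * s.reg 33 ≤ P.Q * P.Q →
            Φ 1 (s.reg 31) (s.reg 32) (s.reg 33) (s.reg 34 + 1) (s.reg 35) (s.reg 36 + 1)
              (Function.update (Function.update s.mem (3 * (P.n * P.n) + P.n + s.reg 34) x)
                (3 * (P.n * P.n) + 2 * P.n + x) (s.reg 34))) := by
        intro hnV
        have hlt := hV.row.lt_of_not_mem hxn hnV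
        have hk : KeepsOuter P.n s.mem
            (Function.update (Function.update s.mem (3 * (P.n * P.n) + P.n + s.reg 34) x)
              (3 * (P.n * P.n) + 2 * P.n + x) (s.reg 34)) := by
          intro y hy
          rw [Function.update_of_ne (by omega), Function.update_of_ne (by omega)]
        have hj : s.reg 36 < s.mem (3 * (P.n * P.n) + s.mem (3 * (P.n * P.n) + P.n + s.reg 35)) := by
          rw [hv, hd]; exact h2
        have hxj : s.mem (P.n * P.n + s.mem (3 * (P.n * P.n) + P.n + s.reg 35) * P.n + s.reg 36) = x := by
          rw [hv, hx]
        refine ⟨by omega, by omega, b5, b6, by omega, fun h3 => ⟨by omega, b4, ?_⟩, fun h3 => ?_⟩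
        · exact idle 0 _ _ _ _ (hV.sampleValue_of_fail hE h1 hj hxj hnV h3) (Nat.zero_le _) hk
            (hφ h1)
        · refine busy _ _ _ _ _ (hV.visit hE h1 hj hxj hnV h3) hk ?_ le_rfl
          have := hV.cnt_pos
          rw [Function.update_of_ne (by omega), Function.update_of_ne (by omega)]
      refine ⟨by omega, by omega, by omega, by omega, by omega, by omega,
        fun h3 => ⟨by omega, by omega, fun h4 => ?_, fun h4 => ?_⟩, fun h3 => ?_⟩
      · exact busy _ _ _ _ V (hV.seen h1 (by rw [hv, hd]; exact h2)
          (by rw [hv, hx]; exact hxV.mpr ⟨h3, h4⟩)) (fun _ _ => rfl) rfl le_rfl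
      · exact new fun h => h4 (hxV.mp h).2
      · exact new fun h => by have := (hxV.mp h).1; omega
    · refine ⟨by omega, busy _ _ _ _ V (hV.next hE h1 (by rw [hv, hd]; exact h2))
        (fun _ _ => rfl) rfl ?_⟩
      rw [Nat.add_mul]
      omega
  · have heq : s.reg 35 = s.reg 34 := by omega
    refine ⟨b3, b4, by omega, idle _ _ _ _ _ (hV.sampleValue_of_done heq) le_rfl
      (fun _ _ => rfl) ?_⟩
    rw [hV.fin heq]
    exact Nat.mul_le_mul_right _ (by omega)

theorem initSearch_sure (hw : P.Ok w) (hc : Cfg P s) (h31 : s.reg 31 < P.r)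
    (h32 : s.reg 32 ≤ s.reg 31 * P.Q) (h33 : s.reg 33 < P.Q * P.Q) (h41 : s.reg 41 < P.n) (m : ℝ) :
    Sure w initSearch s initSearch.cost fun s' => (SamplerInv P G s' ∧ KeepsOuter P.n s.mem s'.mem) ∧
      samplerPotential P G m s' = potential P.Q P.g P.r (density P G)
        (s.reg 32 + sampleValue (P.Q * P.Q) (compSizeAt G (s.reg 41)) (s.reg 33 + 1))
        (P.r - (s.reg 31 + 1)) (m + 1 - sampleCost (P.Q * P.Q) (s.reg 33 + 1)) := by
  have hmem := hw.mem
  have hthr := hw.thr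
  obtain ⟨mem, hm⟩ : ∃ mem, mem = Function.update (Function.update s.mem (3 * (P.n * P.n) + P.n)
      (s.reg 41)) (3 * (P.n * P.n) + 2 * P.n + s.reg 41) 0 := ⟨_, rfl⟩
  refine Sure.mono (Q := fun s' => s'.reg 30 = 1 ∧ s'.reg 31 = s.reg 31 ∧ s'.reg 32 = s.reg 32 ∧
    s'.reg 33 = s.reg 33 + 1 ∧ s'.reg 34 = 1 ∧ s'.reg 35 = 0 ∧ s'.reg 36 = 0 ∧ s'.mem = mem)
    (Sure.of_wp ?_) ?_
  · simp only [initSearch, block, wp, reg_setReg, mem_setReg,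
      reg_setMem, mem_setMem, Nat.reduceEqDiff, reduceIte, hc.r10, hc.r11, hc.r15, hc.r16, hm, and_true]
    omega
  · rintro s' ⟨e0, e1, e2, e3, e4, e5, e6, e7⟩
    refine ⟨⟨.inr ⟨e0, by omega, by rwa [e1, e2], fun v => v = s.reg 41, ?_⟩, ?_⟩, ?_⟩
    · rw [e3, e4, e5, e6, e7, hm]
      exact Search.init h41 (by omega) (by omega)
    · intro x hx
      rw [e7, hm, Function.update_of_ne (by omega), Function.update_of_ne (by omega)]
    · rw [samplerPotential, e0, if_neg one_ne_zero, e1, e2, e3, e5, e6, e7, hm,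
        Function.update_of_ne (by omega), Function.update_self]
      congr 1
      push_cast
      ring

/-- The only random step of the sampling itself: the average over vertex and threshold of the
potential after the start is bounded by `sum_potential_le`. -/
theorem startSample_spec (hw : P.Ok w) (hc : Cfg P s) (h31 : s.reg 31 < P.r)
    (h32 : s.reg 32 ≤ s.reg 31 * P.Q) (m : ℝ) :
    Spec w startSample s startSample.cost
      (fun s' => SamplerInv P G s' ∧ KeepsOuter P.n s.mem s'.mem)
      (fun s' => ENNReal.ofReal (samplerPotential P G m s'))
      (ENNReal.ofReal (potential P.Q P.g P.r (density P G) (s.reg 32) (P.r - s.reg 31) (m + 1))) := by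
  have hQ := P.Q_pos hw
  have hn := hw.n_pos
  set F : ℕ → ℕ → ℝ := fun u a => potential P.Q P.g P.r (density P G)
    (s.reg 32 + sampleValue (P.Q * P.Q) (compSizeAt G u) (a + 1))
    (P.r - (s.reg 31 + 1)) (m + 1 - sampleCost (P.Q * P.Q) (a + 1)) with hF
  have hF0 : ∀ u a, 0 ≤ F u a := fun u a => potential_nonneg _ _ _
  set F₁ : ℕ → ℝ := fun u => (∑ a ∈ Finset.range (P.Q * P.Q), F u a) / (P.Q * P.Q : ℕ) with hF₁
  have hF₁0 : ∀ u, 0 ≤ F₁ u := fun u => div_nonneg (Finset.sum_nonneg fun a _ => hF0 u a)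
    (Nat.cast_nonneg _)
  refine Spec.conseq (c := ENNReal.ofReal ((∑ u ∈ Finset.range P.n, F₁ u) / P.n))
    (Spec.seq (Q := fun s₁ => ∃ u < P.n, s₁ = s.setReg 41 u) (T₁ := 1)
      (T₂ := 1 + initSearch.cost + 1)
      (g := fun s₁ => ENNReal.ofReal (F₁ (s₁.reg 41))) ?_ ?_) (fun _ h => h) (fun _ _ => le_rfl) ?_
  · refine Spec.conseq (Spec.rand (d := 41) (by rw [hc.r4]; omega)
      fun x hx => ⟨x, by rwa [hc.r4] at hx, rfl⟩) (fun _ h => h) (fun _ _ => le_rfl) ?_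
    simp only [reg_setReg, reduceIte, hc.r4]
    rw [ENNReal.sum_ofReal_div hn _ hF₁0]
  · rintro s₁ ⟨u, hu, rfl⟩
    have hc₁ : Cfg P (s.setReg 41 u) := hc.frame fun r _ hr => by
      rw [reg_setReg, if_neg (by omega)]
    refine Spec.seq (Q := fun s₂ => ∃ a < P.Q * P.Q, s₂ = (s.setReg 41 u).setReg 33 a)
      (g := fun s₂ => ENNReal.ofReal (F u (s₂.reg 33))) ?_ ?_
    · refine Spec.conseq (Spec.rand (d := 33) (by rw [hc₁.r17]; positivity)
        fun x hx => ⟨x, by rwa [hc₁.r17] at hx, rfl⟩) (fun _ h => h) (fun _ _ => le_rfl) ?_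
      simp only [hc₁.r17]
      simp only [reg_setReg, reduceIte]
      rw [ENNReal.sum_ofReal_div (by positivity) _ (hF0 u)]
    · rintro s₂ ⟨a, ha, rfl⟩
      have hc₂ : Cfg P ((s.setReg 41 u).setReg 33 a) := hc₁.frame fun r _ hr => by
        rw [reg_setReg, if_neg (by omega)]
      refine Spec.conseq ((initSearch_sure hw hc₂ (by simpa [reg_setReg] using h31)
        (by simpa [reg_setReg] using h32) (by simpa [reg_setReg] using ha)
        (by simpa [reg_setReg] using hu) m).spec
          (f := fun s' => ENNReal.ofReal (samplerPotential P G m s')) ?_) (fun s' h => h.1)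
          (fun _ _ => le_rfl) le_rfl
      intro s' h
      rw [h.2]
      simp only [reg_setReg, Nat.reduceEqDiff, reduceIte, hF]
      exact le_rfl
  · refine ENNReal.ofReal_le_ofReal ?_
    have hν : ∑ u ∈ Finset.range P.n, (compSizeAt G u : ℝ)⁻¹ = P.n * density P G := by
      rw [sum_inv_compSizeAt, density, mul_div_cancel₀ _ (by positivity)]
    have := sum_potential_le (r := P.r) hn hQ P.Q_le (compSizeAt G) (fun u _ => compSizeAt_pos G u) hν
      (s.reg 32) (P.r - (s.reg 31 + 1)) (m + 1)
    rwa [show P.r - (s.reg 31 + 1) + 1 = P.r - s.reg 31 by omega] at this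

theorem sampleStep_avoids {r : ℕ} (hr : r < 30 ∨ 37 ≤ r ∧ r < 40 ∨ 50 ≤ r) :
    sampleStep.Avoids r := by
  simp only [sampleStep, stepSearch, followArc, visitVertex, finishSample, startSample, initSearch,
    block, Avoids, true_and, and_true]
  omega

/-- A step of the sampler preserves its invariants, and the potential is a supermartingale. -/
theorem sampleStep_spec (hw : P.Ok w) (hc : Cfg P s) (hs : SamplerInv P G s)
    (hE : Stores P.n (arcs G) s.mem) (m : ℝ) :
    Spec w sampleStep s sampleStep.cost
      (fun s' => (SamplerInv P G s' ∧ KeepsOuter P.n s.mem s'.mem) ∧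
        ∀ r, sampleStep.Avoids r → s'.reg r = s.reg r)
      (fun s' => ENNReal.ofReal (samplerPotential P G m s'))
      (ENNReal.ofReal (samplerPotential P G (m + 1) s)) := by
  refine Spec.frame ?_
  have h1 := hw.mem
  refine (Spec.ite (T := max stepSearch.cost (1 + (max startSample.cost 1 + 1) + 1))
    (fun h => ?_) fun h => ?_)
  · have hb : SamplerBusy P G s := hs.resolve_left fun h' => h h'.r30
    refine Spec.mono_time ?_ (le_max_left _ _)
    exact Spec.conseq ((stepSearch_sure hw hc hb hE m).spec
      (f := fun s' => ENNReal.ofReal (samplerPotential P G m s'))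
      fun s' h => ENNReal.ofReal_le_ofReal h.2.1) (fun s' h => ⟨h.1, h.2.2⟩)
      (fun _ _ => le_rfl) le_rfl
  · have hi : SamplerIdle P s := hs.resolve_right fun h' => by have := h'.r30; omega
    refine Spec.mono_time ?_ (le_max_right _ _)
    refine Sure.seq_spec (T₁ := 1) (Q := fun s₁ => s₁.mem = s.mem ∧
      (s₁.reg 40 ≠ 0 ↔ s.reg 31 < P.r) ∧ ∀ r, r ≠ 40 → s₁.reg r = s.reg r) ?_ ?_
    · refine Sure.of_wp (P := .op .lt 40 31 18) ?_
      simp only [wp, reg_setReg, mem_setReg, reduceIte, hc.r18]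
      refine ⟨by omega, fun h' => ⟨trivial, by simpa using h', fun r hr => if_neg hr⟩,
        fun h' => ⟨trivial, by simpa using h', fun r hr => if_neg hr⟩⟩
    · rintro s₁ ⟨hm, h40, hr⟩
      have hc₁ : Cfg P s₁ := hc.frame fun r _ hr' => hr r (by omega)
      have h30 : s₁.reg 30 = 0 := by rw [hr 30 (by omega), h]
      have h31 := hr 31 (by omega)
      have h32 := hr 32 (by omega)
      rw [samplerPotential, if_pos h, ← h31, ← h32, ← hm]
      refine Spec.ite (fun h' => ?_) fun h' => ?_
      · rw [if_neg (by have := h40.mp h'; omega)]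
        refine Spec.mono_time (startSample_spec hw hc₁ ?_ ?_ m) (le_max_left _ _)
        · rw [h31]; exact h40.mp h'
        · rw [h31, h32]; exact hi.sum
      · have hir : s₁.reg 31 = P.r := by
          have : ¬ s.reg 31 < P.r := fun h'' => h40.mpr h'' h'
          have := hi.idx
          omega
        -- All samples are drawn: the potential does not depend on the remaining time, so idling is
        -- free.
        refine Spec.mono_time (Spec.skip ⟨.inl ⟨h30, hir.le, ?_⟩, fun _ _ => rfl⟩ ?_)
          (le_max_right _ _)
        · rw [h31, h32]; exact hi.sum
        · rw [samplerPotential, if_pos h30]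
          simp only [hir, reduceIte]
          exact le_rfl

end RamProg

/-! ### The estimate -/

/-- The difference between the number of components of the graph that is sampled and the number that
is to be estimated. -/
def Params.stale (P : Params) : ℕ := if P.Small then 0 else 4 * P.H

/-- The estimate from the sum of the samples. -/
def Params.estimate (P : Params) (S : ℕ) : ℕ := (S * P.n + S * P.n + P.r) / (P.r + P.r)

/-- The estimate with an offset. -/
def Params.output (P : Params) (E j : ℕ) : ℕ := E + j * (2 * P.R + 1) + P.R - P.Rb

/-- The indicator of the event that the output is far from `c`. -/
noncomputable def farFrom (P : Params) (c : ℕ) (s : RamState) : ℝ≥0∞ :=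
  if |(s.reg 0 : ℤ) - c| ≤ P.R then 0 else 1

namespace Params

variable {P : Params} {w : ℕ}

/-- `estimate` is `S n / r` rounded to a nearest integer; the numerator `2 S n + r` over `2 r` adds
the half before the floor. -/
theorem abs_estimate_sub_le (hw : P.Ok w) (S : ℕ) :
    |(P.estimate S : ℝ) - S * P.n / P.r| ≤ 1 / 2 := by
  have hr : 0 < P.r := P.r_pos hw
  have hr' : (0 : ℝ) < P.r := by exact_mod_cast hr
  have h1 := Nat.div_mul_le_self (S * P.n + S * P.n + P.r) (P.r + P.r)
  have h2 := Nat.lt_div_mul_add (a := S * P.n + S * P.n + P.r) (show 0 < P.r + P.r by omega)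
  change P.estimate S * (P.r + P.r) ≤ _ at h1
  change _ < P.estimate S * (P.r + P.r) + _ at h2
  have h3 : (P.estimate S : ℝ) * (P.r + P.r) ≤ S * P.n + S * P.n + P.r := by exact_mod_cast h1
  have h4 : (S : ℝ) * P.n + S * P.n + P.r < P.estimate S * (P.r + P.r) + (P.r + P.r) := by
    exact_mod_cast h2
  have h5 : (S : ℝ) * P.n = (S * P.n / P.r) * P.r := by field_simp
  rw [abs_le]
  constructor
  · by_contra! h
    nlinarith
  · by_contra! h
    nlinarith

theorem four_H_le (hw : P.Ok w) : (4 * P.H : ℝ) ≤ P.n / (4 * P.qb) := by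
  have hq : (0 : ℝ) < P.qb := by exact_mod_cast hw.qb_pos
  have h : (P.H : ℝ) ≤ (P.n : ℝ) / ((16 * P.qb : ℕ) : ℝ) := Nat.cast_div_le
  have : (P.n : ℝ) / (4 * P.qb) = 4 * ((P.n : ℝ) / ((16 * P.qb : ℕ) : ℝ)) := by
    push_cast; field_simp; norm_num
  rw [this]
  linarith

/-- If the sum of the samples is close to its mean, then the estimate is good. -/
theorem abs_estimate_sub_le_Rb (hw : P.Ok w) {G : SimpleGraph (Fin P.n)} {S c : ℕ}
    (h1 : (S : ℝ) ≤ P.r * (density P G + 2 * (P.Q : ℝ)⁻¹))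
    (h2 : P.r * (density P G - 3 * (P.Q : ℝ)⁻¹) ≤ (S : ℝ))
    (hc : |(numCC G : ℤ) - c| ≤ P.stale) : |(P.estimate S : ℤ) - c| ≤ P.Rb := by
  have hr : (0 : ℝ) < P.r := by exact_mod_cast P.r_pos hw
  have hn : (0 : ℝ) < P.n := by exact_mod_cast hw.n_pos
  have hQ : (0 : ℝ) < P.Q := by exact_mod_cast P.Q_pos hw
  have hq : (0 : ℝ) < P.qb := by exact_mod_cast hw.qb_pos
  have h3 : |(S : ℝ) * P.n / P.r - numCC G| ≤ 3 * P.n / P.Q := by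
    have e1 : (P.r : ℝ) * (density P G + 2 * (P.Q : ℝ)⁻¹) * P.n / P.r =
        numCC G + 2 * P.n / P.Q := by
      rw [density]; field_simp
    have e2 : (P.r : ℝ) * (density P G - 3 * (P.Q : ℝ)⁻¹) * P.n / P.r =
        numCC G - 3 * P.n / P.Q := by
      rw [density]; field_simp
    have h4 : (S : ℝ) * P.n / P.r ≤ (P.r : ℝ) * (density P G + 2 * (P.Q : ℝ)⁻¹) * P.n / P.r := by
      gcongr
    have h5 : (P.r : ℝ) * (density P G - 3 * (P.Q : ℝ)⁻¹) * P.n / P.r ≤ (S : ℝ) * P.n / P.r := by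
      gcongr
    rw [e1] at h4
    rw [e2] at h5
    have h6 : 2 * (P.n : ℝ) / P.Q ≤ 3 * P.n / P.Q := by gcongr; norm_num
    rw [abs_le]
    constructor <;> linarith
  have h4 := abs_estimate_sub_le hw S
  have hc' : |(numCC G : ℝ) - c| ≤ (P.stale : ℝ) := by exact_mod_cast hc
  have h5 : |(P.estimate S : ℝ) - c| ≤ 1 / 2 + 3 * P.n / P.Q + P.stale := by
    rw [abs_le] at *
    constructor <;> linarith
  -- In a small graph, sampling error `3/8` and rounding `1/2` add up to less than one, so two
  -- integers coincide and the claim holds even if `Rb = 0`. In a large graph the shares of `n / qb`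
  -- are `3/8` for sampling and `1/4` for staleness; the half from rounding fits into the rest
  -- because `n / qb ≥ 16`.
  by_cases hs : P.Small
  · have hQe : (P.Q : ℝ) = 8 * P.n := by
      rw [Q, if_pos hs]; push_cast; ring
    have hst : (P.stale : ℝ) = 0 := by rw [stale, if_pos hs]; simp
    have h6 : 3 * (P.n : ℝ) / P.Q = 3 / 8 := by rw [hQe]; field_simp
    have h7 : |(P.estimate S : ℝ) - c| < 1 := by rw [h6, hst] at h5; linarith
    have h8 : |(P.estimate S : ℤ) - c| < 1 := by exact_mod_cast h7
    omega
  · have hQe : (P.Q : ℝ) = 8 * P.qb := by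
      rw [Q, if_neg hs]; push_cast; ring
    have hst : (P.stale : ℝ) = 4 * P.H := by rw [stale, if_neg hs]; push_cast; ring
    have h6 : 3 * (P.n : ℝ) / P.Q = 3 / 8 * (P.n / P.qb) := by rw [hQe]; field_simp
    have h7 := four_H_le hw
    have h8 : (P.n : ℝ) / (4 * P.qb) = 1 / 4 * (P.n / P.qb) := by field_simp
    have h9 : (16 : ℝ) ≤ P.n / P.qb := by
      rw [le_div_iff₀ hq]
      unfold Small at hs
      exact_mod_cast not_lt.mp hs
    have h10 : |(P.estimate S : ℝ) - c| ≤ (P.n : ℝ) / P.qb := by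
      rw [h6, hst] at h5
      linarith
    obtain ⟨N, hN⟩ : ∃ N : ℕ, (N : ℤ) = |(P.estimate S : ℤ) - c| := ⟨_, Int.natCast_natAbs _⟩
    have h11 : (N : ℝ) = |(P.estimate S : ℝ) - c| := by exact_mod_cast congrArg (Int.cast (R := ℝ)) hN
    rw [← hN, Rb]
    rw [← h11, le_div_iff₀ hq] at h10
    exact_mod_cast (Nat.le_div_iff_mul_le hw.qb_pos).mpr (by exact_mod_cast h10)

/-- One of the offsets corrects the estimate. -/
theorem exists_output (hw : P.Ok w) {E c : ℕ} (h : |(E : ℤ) - c| ≤ P.Rb) :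
    ∃ j < P.J, |(P.output E j : ℤ) - c| ≤ P.R := by
  obtain ⟨h1, h2⟩ := abs_le.mp h
  have hcov := hw.cover
  have hd : c + P.Rb - E ≤ 2 * P.Rb := by omega
  have h3 := Nat.div_mul_le_self (c + P.Rb - E) (2 * P.R + 1)
  have h4 := Nat.lt_div_mul_add (a := c + P.Rb - E) (show 0 < 2 * P.R + 1 by omega)
  -- The index of the window containing `c`. The truncated subtraction here is exact, as `E ≤ c +
  -- Rb`; truncation in `output` can only bring it closer to `c ≥ 0`.
  refine ⟨(c + P.Rb - E) / (2 * P.R + 1), ?_, ?_⟩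
  · rw [Nat.div_lt_iff_lt_mul (by omega)]
    omega
  · rw [output, abs_le]
    generalize (c + P.Rb - E) / (2 * P.R + 1) * (2 * P.R + 1) = z at *
    omega

theorem sum_farFrom_le (hw : P.Ok w) {E c : ℕ} (h : |(E : ℤ) - c| ≤ P.Rb) :
    ∑ j ∈ Finset.range P.J, (if |(P.output E j : ℤ) - c| ≤ P.R then (0 : ℝ) else 1) ≤ P.J - 1 := by
  obtain ⟨j, hj, hj'⟩ := exists_output hw h
  rw [← Finset.add_sum_erase _ _ (Finset.mem_range.mpr hj), if_pos hj', zero_add]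
  refine (Finset.sum_le_card_nsmul _ _ 1 fun i _ => by split_ifs <;> norm_num).trans ?_
  rw [Finset.card_erase_of_mem (Finset.mem_range.mpr hj), Finset.card_range, nsmul_eq_mul, mul_one,
    Nat.cast_sub hw.J_pos, Nat.cast_one]

end Params

namespace RamProg

/-- Compute the estimate. -/
def computeEstimate : RamProg := block
  [.op .mul 40 32 4, .op .add 40 40 40, .op .add 40 40 18, .op .add 41 18 18, .op .div 40 40 41]

/-- Output the estimate with an offset, and reset the sampler. -/
def outputEstimate : RamProg := block
  [.op .mul 41 41 20, .op .add 40 40 41, .op .add 40 40 21, .op .sub 0 40 22, .const 30 0,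
   .const 31 0, .const 32 0]

/-- Publish a new estimate. -/
def publish : RamProg := .seq computeEstimate (.seq (.rand 41 19) outputEstimate)

/-- Make as many steps of the sampler as register `50` says. -/
def sampleLoop : RamProg := .loop 50 (.seq sampleStep (.op .sub 50 50 15))

/-- Make as many steps of the sampler as register `23` says. -/
def repeatSample : RamProg := .seq (.op .add 50 23 16) sampleLoop

/-- A bound on the time of the loop. -/
def repeatTime (b : ℕ) : ℕ := 1 + (b * (sampleStep.cost + 1 + 1 + 1) + 1) + 1

open RamState

variable {w : ℕ} {P : Params} {s : RamState} {G : SimpleGraph (Fin P.n)}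

theorem sum_le_of_samplerInv (hs : SamplerInv P G s) : s.reg 32 ≤ P.r * P.Q := by
  rcases hs with h | h
  · exact h.sum.trans (Nat.mul_le_mul_right _ h.idx)
  · exact h.sum.trans (Nat.mul_le_mul_right _ h.idx.le)

/-- At the end of the budget either samples are missing and the time term is at least one, or the
sum deviates and `deviation` is at least one, or the estimate is good. -/
theorem one_le_or_near (hw : P.Ok w) (hs : SamplerInv P G s) (hE : Stores P.n (arcs G) s.mem)
    {c : ℕ} (hc : |(numCC G : ℤ) - c| ≤ P.stale) :
    1 ≤ samplerPotential P G 0 s ∨ |(P.estimate (s.reg 32) : ℤ) - c| ≤ P.Rb := by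
  rcases hs with h | h
  · rw [samplerPotential, if_pos h.r30]
    split_ifs with h31
    · by_cases hfar : P.r * (density P G + 2 * (P.Q : ℝ)⁻¹) ≤ s.reg 32 ∨
          (s.reg 32 : ℝ) ≤ P.r * (density P G - 3 * (P.Q : ℝ)⁻¹)
      · exact .inl (one_le_deviation _ hfar)
      · push Not at hfar
        exact .inr (Params.abs_estimate_sub_le_Rb hw hfar.1.le hfar.2.le hc)
    · exact .inl (one_le_potential_of_missing _ le_rfl)
  · obtain ⟨X, hX, hcX, hhc, hjc, hcost⟩ := sampler_room h hE
    rw [samplerPotential, h.r30, if_neg one_ne_zero, hcost, ← hX]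
    refine .inl (one_le_potential_of_missing _ ?_)
    obtain ⟨V, hV⟩ := h.search
    have h1 : s.reg 35 * (X + 1) + s.reg 36 ≤ X * (X + 1) := by
      rcases hhc.lt_or_eq with h1 | h1
      · have : (s.reg 35 + 1) * (X + 1) ≤ X * (X + 1) := Nat.mul_le_mul_right _ (by omega)
        rw [Nat.add_mul] at this
        omega
      · rw [hV.fin h1]
        exact Nat.mul_le_mul_right _ (by omega)
    have : ((s.reg 35 * (X + 1) + s.reg 36 : ℕ) : ℝ) ≤ ((X * (X + 1) : ℕ) : ℝ) := by exact_mod_cast h1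
    push_cast at this ⊢
    linarith

/-- If the estimate is good, at most `J - 1` of the `J` offsets fail; otherwise the potential is at
least one and pays for the remaining offset. -/
theorem publish_spec (hw : P.Ok w) (hc : Cfg P s) (hs : SamplerInv P G s)
    (hE : Stores P.n (arcs G) s.mem) {c : ℕ} (hcc : |(numCC G : ℤ) - c| ≤ P.stale) :
    Spec w publish s publish.cost
      (fun s' => (s'.reg 30 = 0 ∧ s'.reg 31 = 0 ∧ s'.reg 32 = 0 ∧ s'.mem = s.mem) ∧
        ∀ r, publish.Avoids r → s'.reg r = s.reg r)
      (farFrom P c)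
      (ENNReal.ofReal ((P.J - 1 + samplerPotential P G 0 s) / P.J)) := by
  refine Spec.frame ?_
  have hmem := hw.mem
  have hest := hw.est
  have h2r := hw.two_r
  have hshift := hw.shift
  have hS := sum_le_of_samplerInv hs
  have hSn : s.reg 32 * P.n ≤ P.r * P.Q * P.n := Nat.mul_le_mul_right _ hS
  have hr := P.r_pos hw
  have hJ := hw.J_pos
  have hEe : P.estimate (s.reg 32) ≤ P.Q * P.n := by
    refine Nat.lt_succ_iff.mp ((Nat.div_lt_iff_lt_mul (by omega)).mpr ?_)
    have : (P.Q * P.n + 1) * (P.r + P.r) = 2 * (P.r * P.Q * P.n) + 2 * P.r := by ring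
    rw [Nat.succ_eq_add_one, this]
    omega
  have hfin : ∀ j < P.J, ∀ s₂ : RamState, Cfg P s₂ → s₂.reg 40 = P.estimate (s.reg 32) →
      s₂.reg 41 = j → s₂.mem = s.mem → Sure w outputEstimate s₂ outputEstimate.cost fun s' =>
        (s'.reg 30 = 0 ∧ s'.reg 31 = 0 ∧ s'.reg 32 = 0 ∧ s'.mem = s.mem) ∧
          s'.reg 0 = P.output (P.estimate (s.reg 32)) j := by
    intro j hj s₂ hc₂ h40 h41 hm
    have h1 : j * (2 * P.R + 1) ≤ P.J * (2 * P.R + 1) := Nat.mul_le_mul_right _ hj.le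
    refine Sure.of_wp ?_
    simp only [outputEstimate, block, wp, reg_setReg, mem_setReg, Nat.reduceEqDiff, reduceIte,
      hc₂.r20, hc₂.r21, hc₂.r22, h40, h41, hm, and_true, Params.output]
    omega
  unfold publish
  refine Sure.seq_spec (T₁ := computeEstimate.cost) (T₂ := 1 + outputEstimate.cost + 1)
    (Q := fun s₁ => s₁.reg 40 = P.estimate (s.reg 32) ∧ s₁.mem = s.mem ∧ Cfg P s₁) ?_ ?_
  · refine (Sure.of_wp (Q := fun s₁ => s₁.reg 40 = P.estimate (s.reg 32) ∧ s₁.mem = s.mem)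
      ?_).frame.mono fun s₁ h => ⟨h.1.1, h.1.2, hc.frame fun r _ hr => h.2 r ?_⟩
    · simp only [computeEstimate, block, wp, reg_setReg, mem_setReg, Nat.reduceEqDiff, reduceIte,
        hc.r4, hc.r18, and_true]
      exact ⟨by omega, by omega, by omega, by omega, hEe.trans_lt (by omega), rfl⟩
    · simp only [computeEstimate, block, Avoids]
      omega
  · rintro s₁ ⟨h40, hm, hc₁⟩
    refine Spec.conseq (Spec.seq (Q := fun s₂ => ∃ j < P.J, s₂ = s₁.setReg 41 j)
      (g := fun s₂ => if |(P.output (P.estimate (s.reg 32)) (s₂.reg 41) : ℤ) - c| ≤ P.R then 0 else 1)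
      (Spec.rand (d := 41) (by rw [hc₁.r19]; omega) fun x hx => ⟨x, by rwa [hc₁.r19] at hx, rfl⟩) ?_)
      (fun s' h => h.1) (f := farFrom P c) (fun _ _ => le_rfl) ?_
      (Q := fun s' => (s'.reg 30 = 0 ∧ s'.reg 31 = 0 ∧ s'.reg 32 = 0 ∧ s'.mem = s.mem) ∧ True)
    · rintro s₂ ⟨j, hj, rfl⟩
      have hc₂ : Cfg P (s₁.setReg 41 j) := hc₁.frame fun r _ hr => by
        rw [reg_setReg, if_neg (by omega)]
      refine Spec.conseq ((hfin j hj _ hc₂ (by simpa [reg_setReg] using h40) (by simp [reg_setReg])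
        hm).spec (f := farFrom P c) ?_) (fun s' h => ⟨h.1, trivial⟩) (fun _ _ => le_rfl) le_rfl
      intro s' h
      rw [farFrom, h.2]
      simp [reg_setReg]
    · simp only [hc₁.r19, reg_setReg, reduceIte]
      have hJ' : (0 : ℝ) < P.J := by exact_mod_cast hJ
      have hsum : ∑ j ∈ Finset.range P.J,
          (if |(P.output (P.estimate (s.reg 32)) j : ℤ) - c| ≤ P.R then (0 : ℝ) else 1) ≤
          P.J - 1 + samplerPotential P G 0 s := by
        rcases one_le_or_near hw hs hE hcc with h | h
        · refine (Finset.sum_le_card_nsmul _ _ 1 fun i _ => by split_ifs <;> norm_num).trans ?_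
          rw [Finset.card_range, nsmul_eq_mul, mul_one]
          linarith
        · refine (Params.sum_farFrom_le hw h).trans (le_add_of_nonneg_right ?_)
          unfold samplerPotential
          split_ifs
          exacts [deviation_nonneg _ _, potential_nonneg _ _ _, potential_nonneg _ _ _]
      have := ENNReal.sum_ofReal_div hJ (fun j =>
        if |(P.output (P.estimate (s.reg 32)) j : ℤ) - c| ≤ P.R then (0 : ℝ) else 1)
        (fun j => by split_ifs <;> norm_num)
      refine le_trans (le_of_eq ?_) (this.le.trans (ENNReal.ofReal_le_ofReal ?_))
      · congr 1
        refine Finset.sum_congr rfl fun j _ => ?_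
        split_ifs <;> simp
      · gcongr

theorem samplerPotential_congr {s' : RamState} {m : ℝ}
    (hr : ∀ r, 30 ≤ r → r < 37 → s'.reg r = s.reg r)
    (hm : s'.mem (3 * (P.n * P.n) + P.n) = s.mem (3 * (P.n * P.n) + P.n)) :
    samplerPotential P G m s' = samplerPotential P G m s := by
  unfold samplerPotential
  rw [hr 30 (by omega) (by omega), hr 31 (by omega) (by omega), hr 32 (by omega) (by omega),
    hr 33 (by omega) (by omega), hr 35 (by omega) (by omega), hr 36 (by omega) (by omega), hm]

theorem SamplerInv.congr {s' : RamState} (hs : SamplerInv P G s)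
    (hr : ∀ r, 30 ≤ r → r < 37 → s'.reg r = s.reg r) (hm : s'.mem = s.mem) : SamplerInv P G s' := by
  have h30 := hr 30 (by omega) (by omega)
  have h31 := hr 31 (by omega) (by omega)
  have h32 := hr 32 (by omega) (by omega)
  rcases hs with h | h
  · exact .inl ⟨h30.trans h.r30, h31 ▸ h.idx, by rw [h31, h32]; exact h.sum⟩
  · obtain ⟨V, hV⟩ := h.search
    refine .inr ⟨h30.trans h.r30, h31 ▸ h.idx, by rw [h31, h32]; exact h.sum, V, ?_⟩
    rwa [hm, hr 33 (by omega) (by omega), hr 34 (by omega) (by omega), hr 35 (by omega) (by omega),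
      hr 36 (by omega) (by omega)]

theorem Stores.keepsOuter {n : ℕ} {E : ℕ → ℕ → Prop} {m m' : ℕ → ℕ} (h : Stores n E m)
    (hk : KeepsOuter n m m') : Stores n E m' :=
  h.congr (fun _ _ _ _ => Iff.rfl) fun x _ hx => hk x (.inl hx)

theorem repeatSample_avoids {r : ℕ} (hr : r < 30 ∨ 37 ≤ r ∧ r < 40) : repeatSample.Avoids r := by
  refine ⟨?_, sampleStep_avoids (by omega), ?_⟩ <;> simp only [Avoids] <;> omega

theorem b_lt (hw : P.Ok w) : P.b < 2 ^ w := by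
  have := hw.steps
  have := Nat.div_le_self P.W P.H
  unfold Params.b
  split_ifs <;> omega

/-- The supermartingale property iterated: the loop counter is the number of remaining steps in the
potential. -/
theorem sampleLoop_spec (hw : P.Ok w) (hc : Cfg P s) (hs : SamplerInv P G s)
    (hE : Stores P.n (arcs G) s.mem) {k : ℕ} (hk : k < 2 ^ w) (h50 : s.reg 50 = k) (m : ℝ) :
    Spec w sampleLoop s (k * (sampleStep.cost + 1 + 1 + 1) + 1)
      (fun s' => SamplerInv P G s' ∧ KeepsOuter P.n s.mem s'.mem)
      (fun s' => ENNReal.ofReal (samplerPotential P G m s'))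
      (ENNReal.ofReal (samplerPotential P G (m + k) s)) := by
  refine Spec.conseq (Spec.loop (I := fun i s' => s'.reg 50 = i ∧ i ≤ k ∧ SamplerInv P G s' ∧
    Cfg P s' ∧ KeepsOuter P.n s.mem s'.mem)
    (g := fun i s' => ENNReal.ofReal (samplerPotential P G (m + i) s'))
    (T := sampleStep.cost + 1 + 1) ?_ ?_ ?_ k s ⟨h50, le_rfl, hs, hc, fun _ _ => rfl⟩)
    (fun s' h => ⟨h.2.2.1, h.2.2.2.2⟩) (fun s' _ => ?_) le_rfl
  · exact fun s h => h.1
  · exact fun i s h => by rw [h.1]; omega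
  · rintro i s₂ ⟨h50, hi, hs₂, hc₂, hm₂⟩
    have hstep := sampleStep_spec hw hc₂ hs₂ (Stores.keepsOuter hE hm₂) (m + i)
    rw [show m + ↑i + 1 = m + ((i + 1 : ℕ) : ℝ) by push_cast; ring] at hstep
    refine Spec.seq hstep ?_
    rintro s₃ ⟨⟨hs₃, hm₃⟩, hr₃⟩
    have hc₃ : Cfg P s₃ := hc₂.frame fun r _ hr => hr₃ r (sampleStep_avoids (by omega))
    have h50₃ : s₃.reg 50 = i + 1 := by rw [hr₃ 50 (sampleStep_avoids (by omega)), h50]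
    refine (Sure.of_wp (P := .op .sub 50 50 15) (Q := fun s' => s'.reg 50 = i ∧ s'.mem = s₃.mem ∧
      ∀ r, r ≠ 50 → s'.reg r = s₃.reg r) ?_).spec ?_ |>.conseq ?_ (fun _ _ => le_rfl) le_rfl
    · simp only [wp, reg_setReg, mem_setReg, reduceIte, hc₃.r15, h50₃]
      exact ⟨by omega, by omega, trivial, fun r hr => if_neg hr⟩
    · rintro s' ⟨h1, h2, h3⟩
      rw [samplerPotential_congr (fun r _ _ => h3 r (by omega)) (congrFun h2 _)]
    · rintro s' ⟨h1, h2, h3⟩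
      refine ⟨h1, by omega, SamplerInv.congr hs₃ (fun r _ _ => h3 r (by omega)) h2,
        hc₃.frame fun r _ _ => h3 r (by omega), fun x hx => ?_⟩
      rw [h2, hm₃ x hx, hm₂ x hx]
  · simp

theorem repeatSample_spec (hw : P.Ok w) (hc : Cfg P s) (hs : SamplerInv P G s)
    (hE : Stores P.n (arcs G) s.mem) (m : ℝ) :
    Spec w repeatSample s (repeatTime P.b)
      (fun s' => (SamplerInv P G s' ∧ KeepsOuter P.n s.mem s'.mem) ∧
        ∀ r, repeatSample.Avoids r → s'.reg r = s.reg r)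
      (fun s' => ENNReal.ofReal (samplerPotential P G m s'))
      (ENNReal.ofReal (samplerPotential P G (m + P.b) s)) := by
  have hb := b_lt hw
  refine Spec.frame ?_
  unfold repeatSample repeatTime
  refine Sure.seq_spec (T₁ := 1) (Q := fun s₁ => s₁.reg 50 = P.b ∧ s₁.mem = s.mem ∧
    ∀ r, r ≠ 50 → s₁.reg r = s.reg r) ?_ ?_
  · refine Sure.of_wp (P := .op .add 50 23 16) ?_
    simp only [wp, reg_setReg, mem_setReg, reduceIte, hc.r23, hc.r16]
    exact ⟨by omega, rfl, trivial, fun r hr => if_neg hr⟩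
  · rintro s₁ ⟨h50, hm, hr⟩
    rw [← samplerPotential_congr (fun r _ _ => hr r (by omega)) (congrFun hm _), ← hm]
    exact sampleLoop_spec hw (hc.frame fun r _ _ => hr r (by omega))
      (SamplerInv.congr hs (fun r _ _ => hr r (by omega)) hm) (hm ▸ hE) hb h50 m

end RamProg

/-! ### The update program -/

/-- A search may be interrupted between updates: writing to the update buffer, which lies above the
memory used by the search, does not disturb it. -/
theorem Search.congr {n M a cnt h j : ℕ} {G : SimpleGraph (Fin n)} {V : ℕ → Prop} {m m' : ℕ → ℕ}
    (hs : Search G M V m a cnt h j) (hE : Stores n (arcs G) m)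
    (hm : ∀ x < 3 * (n * n) + 3 * n, m' x = m x) : Search G M V m' a cnt h j := by
  have hn := hs.row.le
  have hq : ∀ i < n, m' (3 * (n * n) + n + i) = m (3 * (n * n) + n + i) := fun i hi =>
    hm _ (by omega)
  have hroot : m' (3 * (n * n) + n) = m (3 * (n * n) + n) := hm _ (by have := hs.cnt_pos; omega)
  refine ⟨hs.row.congr (fun _ _ => Iff.rfl) hq fun v hv => hm _ (by omega), hs.cnt_pos,
    hroot ▸ hs.linked, hs.le_cnt, fun i hi y => ?_, fun hh => ?_, hs.fin, hs.thr, hs.a_pos⟩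
  · rw [hq i (by have := hs.le_cnt; omega)]
    exact hs.done i hi y
  · rw [hq h (by omega)]
    obtain ⟨hlt, -⟩ := hs.row.elem h hh
    obtain ⟨h1, h2⟩ := hs.cur hh
    have hd := (hE _ hlt).le
    rw [hm _ (by omega)]
    refine ⟨h1, fun i hi => ?_⟩
    have := cell_lt hlt (show i < n by omega)
    rw [hm _ (by omega)]
    exact h2 i hi

theorem SamplerInv.congr_of_lt {P : Params} {G : SimpleGraph (Fin P.n)} {s s' : RamState}
    (hs : SamplerInv P G s) (hE : Stores P.n (arcs G) s.mem)
    (hr : ∀ r, 30 ≤ r → r < 37 → s'.reg r = s.reg r)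
    (hm : ∀ x < 3 * (P.n * P.n) + 3 * P.n, s'.mem x = s.mem x) : SamplerInv P G s' := by
  have h30 := hr 30 (by omega) (by omega)
  have h31 := hr 31 (by omega) (by omega)
  have h32 := hr 32 (by omega) (by omega)
  rcases hs with h | h
  · exact .inl ⟨h30.trans h.r30, h31 ▸ h.idx, by rw [h31, h32]; exact h.sum⟩
  · obtain ⟨V, hV⟩ := h.search
    refine .inr ⟨h30.trans h.r30, h31 ▸ h.idx, by rw [h31, h32]; exact h.sum, V, ?_⟩
    rw [hr 33 (by omega) (by omega), hr 34 (by omega) (by omega), hr 35 (by omega) (by omega),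
      hr 36 (by omega) (by omega)]
    exact hV.congr hE hm

namespace Params

/-- The failure probability. -/
noncomputable def fail (P : Params) : ℝ := (P.J - 1 + 3 * Real.exp (-P.l)) / P.J

theorem fail_nonneg {P : Params} {w : ℕ} (hw : P.Ok w) : 0 ≤ P.fail := by
  have : (1 : ℝ) ≤ P.J := by exact_mod_cast hw.J_pos
  have := Real.exp_nonneg (-P.l)
  exact div_nonneg (by linarith) (by linarith)

end Params

namespace RamProg

/-- Copy the input to the registers that are read by `applyOp`. -/
def moveInput : RamProg := block [.op .add 37 2 16, .op .add 38 3 16, .op .add 39 1 16]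

/-- The update program for small graphs. -/
def smallUpdate : RamProg := .seq moveInput (.seq applyOp (.seq repeatSample publish))

/-- Fetch the next update of the previous phase from the buffer. -/
def fetch : RamProg := block
  [.op .add 40 12 27, .load 39 40, .op .add 40 13 27, .load 37 40, .op .add 40 14 27, .load 38 40,
   .op .add 27 27 15]

/-- Apply the next update of the previous phase. -/
def applyNext : RamProg := .seq fetch applyOp

/-- Write the input to the buffer. -/
def record : RamProg := block
  [.op .add 40 12 26, .store 40 1, .op .add 40 13 26, .store 40 2, .op .add 40 14 26, .store 40 3,
   .op .add 26 26 15]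

/-- At the end of a phase, publish a new estimate and start a new phase. -/
def tick : RamProg := .seq (.op .eq 40 26 25)
  (.ite 40 (.seq publish (block [.const 26 0, .const 27 0])) .skip)

/-- In the first half of a phase, apply updates of the previous phase; in the second half, run the
sampler. -/
def phaseStep : RamProg := .seq (.op .lt 40 26 24)
  (.ite 40 (.seq applyNext applyNext) repeatSample)

/-- The update program for large graphs. -/
def largeUpdate : RamProg := .seq phaseStep (.seq record tick)

/-- The update program.  It does nothing if register `8` holds `0`. -/
def update : RamProg := .ite 8 (.ite 9 smallUpdate largeUpdate) .skip

/-- A bound on the time of an update with `b` steps of the sampler. -/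
def updateTime (b : ℕ) : ℕ :=
  repeatTime b + (moveInput.cost + 3 * applyOp.cost + 2 * publish.cost + 2 * fetch.cost + record.cost +
    20)

/-- The sampler is ready for a new run. -/
def Fresh (s : RamState) : Prop := s.reg 30 = 0 ∧ s.reg 31 = 0 ∧ s.reg 32 = 0

open RamState

variable {w : ℕ} {P : Params} {s : RamState} {G : SimpleGraph (Fin P.n)}

theorem Fresh.samplerInv (h : Fresh s) : SamplerInv P G s :=
  .inl ⟨h.1, by rw [h.2.1]; exact Nat.zero_le _, by rw [h.2.2]; exact Nat.zero_le _⟩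

theorem Fresh.potential_le (hw : P.Ok w) (h : Fresh s) {m : ℕ} (hm : P.W ≤ m) :
    samplerPotential P G m s ≤ 3 * Real.exp (-P.l) := by
  refine (samplerPotential_idle_le h.1).trans ?_
  rw [h.2.1, h.2.2]
  exact potential_init (P.Q_pos hw) rfl hm

theorem Fresh.congr {s' : RamState} (h : Fresh s) (hr : ∀ r, 30 ≤ r → r < 37 → s'.reg r = s.reg r) :
    Fresh s' :=
  ⟨(hr _ (by omega) (by omega)).trans h.1, (hr _ (by omega) (by omega)).trans h.2.1,
    (hr _ (by omega) (by omega)).trans h.2.2⟩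

theorem reg_receive {n : ℕ} (s : RamState) (e : EdgeUpdate n) {r : ℕ} (hr : r = 0 ∨ 4 ≤ r) :
    (s.receive e).reg r = s.reg r := by
  rw [e.receive_eq, reg_setReg, if_neg (by omega), reg_setReg, if_neg (by omega), reg_setReg,
    if_neg (by omega)]

theorem mem_receive {n : ℕ} (s : RamState) (e : EdgeUpdate n) : (s.receive e).mem = s.mem := by
  rw [e.receive_eq]; rfl

theorem input_receive {n : ℕ} (s : RamState) (e : EdgeUpdate n) :
    (s.receive e).reg 1 = e.kind ∧ (s.receive e).reg 2 = e.fst ∧ (s.receive e).reg 3 = e.snd := by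
  rw [e.receive_eq]
  simp [reg_setReg]

theorem kind_le {n : ℕ} (e : EdgeUpdate n) : e.kind ≤ 1 := by
  cases e <;> simp [EdgeUpdate.kind]

theorem publish_avoids {r : ℕ} (hr : 1 ≤ r) (hr' : r < 30 ∨ 50 ≤ r) : publish.Avoids r := by
  simp only [publish, computeEstimate, outputEstimate, block, Avoids]
  omega

/-- The state of the algorithm for small graphs. -/
structure SmallState (P : Params) (G : SimpleGraph (Fin P.n)) (s : RamState) : Prop where
  cfg : Cfg P s
  stores : Stores P.n (arcs G) s.mem
  fresh : Fresh s

theorem samplerPotential_nonneg (m : ℝ) : 0 ≤ samplerPotential P G m s := by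
  unfold samplerPotential
  split_ifs
  exacts [deviation_nonneg _ _, potential_nonneg _ _ _, potential_nonneg _ _ _]

/-- The failure probability after publishing, from the one before. -/
noncomputable def failWith (P : Params) (x : ℝ≥0∞) : ℝ≥0∞ :=
  ENNReal.ofReal ((P.J - 1) / P.J) + ENNReal.ofReal (1 / P.J) * x

theorem failWith_ofReal (hw : P.Ok w) {x : ℝ} (hx : 0 ≤ x) :
    failWith P (ENNReal.ofReal x) = ENNReal.ofReal ((P.J - 1 + x) / P.J) := by
  have hJ : (1 : ℝ) ≤ P.J := by exact_mod_cast hw.J_pos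
  rw [failWith, ← ENNReal.ofReal_mul (by positivity),
    ← ENNReal.ofReal_add (div_nonneg (by linarith) (by linarith)) (by positivity)]
  congr 1
  ring

theorem failWith_le (hw : P.Ok w) {x : ℝ≥0∞} (hx : x ≤ ENNReal.ofReal (3 * Real.exp (-P.l))) :
    failWith P x ≤ ENNReal.ofReal P.fail := by
  rw [Params.fail, ← failWith_ofReal hw (by positivity)]
  unfold failWith
  gcongr

/-- For a small graph a whole run fits into one update, so every update yields a fresh estimate of
the current graph. -/
theorem runSampler_spec (hw : P.Ok w) (hs : SmallState P G s) (hsmall : P.Small) :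
    Spec w (.seq repeatSample publish) s (repeatTime P.b + publish.cost + 1)
      (SmallState P G) (farFrom P (numCC G)) (ENNReal.ofReal P.fail) := by
  have hb : P.b = P.W := if_pos hsmall
  refine Spec.seq (g := fun s' => failWith P (ENNReal.ofReal (samplerPotential P G 0 s')))
    (Q := fun s₁ => SamplerInv P G s₁ ∧ Stores P.n (arcs G) s₁.mem ∧ Cfg P s₁) ?_ ?_
  · refine ((repeatSample_spec hw hs.cfg (hs.fresh.samplerInv (G := G)) hs.stores 0).affine
      (ENNReal.ofReal ((P.J - 1) / P.J)) (ENNReal.ofReal (1 / P.J))).conseq ?_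
      (fun _ _ => le_rfl) (failWith_le hw (ENNReal.ofReal_le_ofReal ?_))
    · rintro s' ⟨⟨h1, h2⟩, h3⟩
      exact ⟨h1, Stores.keepsOuter hs.stores h2,
        hs.cfg.frame fun r _ _ => h3 r (repeatSample_avoids (by omega))⟩
    · rw [hb, zero_add]
      exact hs.fresh.potential_le hw le_rfl
  · rintro s₁ ⟨h1, h2, h3⟩
    rw [failWith_ofReal hw (samplerPotential_nonneg _)]
    refine (publish_spec hw h3 h1 h2 (c := numCC G) (by simp)).conseq ?_ (fun _ _ => le_rfl) le_rfl
    rintro s' ⟨⟨h30, h31, h32, hm⟩, hr⟩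
    exact ⟨h3.frame fun r hr1 hr2 => hr r (publish_avoids (by omega) (by omega)), by rwa [hm],
      h30, h31, h32⟩

theorem smallUpdate_spec (hw : P.Ok w) (hs : SmallState P G s) (hsmall : P.Small)
    (e : EdgeUpdate P.n) :
    Spec w smallUpdate (s.receive e)
      (moveInput.cost + (applyOp.cost + (repeatTime P.b + publish.cost + 1) + 1) + 1)
      (SmallState P (e.apply G)) (farFrom P (numCC (e.apply G))) (ENNReal.ofReal P.fail) := by
  have hm := hw.mem
  have hn : P.n ≤ P.n * P.n := Nat.le_mul_self _
  have hu := e.fst.2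
  have hv := e.snd.2
  have hk := kind_le e
  obtain ⟨h1, h2, h3⟩ := input_receive s e
  have hc : Cfg P (s.receive e) := hs.cfg.frame fun r _ _ => reg_receive s e (by omega)
  have hE : Stores P.n (arcs G) (s.receive e).mem := by rw [mem_receive]; exact hs.stores
  have hf : Fresh (s.receive e) := hs.fresh.congr fun r _ _ => reg_receive s e (by omega)
  refine Sure.seq_spec (Q := fun s₁ => (s₁.reg 37 = e.fst ∧ s₁.reg 38 = e.snd ∧
    s₁.reg 39 = e.kind ∧ s₁.mem = (s.receive e).mem) ∧
      ∀ r, moveInput.Avoids r → s₁.reg r = (s.receive e).reg r) (Sure.frame (Sure.of_wp ?_)) ?_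
  · simp only [moveInput, block, wp, reg_setReg, mem_setReg, Nat.reduceEqDiff, reduceIte, h1, h2,
      h3, hc.r16, and_true]
    omega
  · rintro s₁ ⟨⟨h37, h38, h39, hmem⟩, hr⟩
    have hr' : ∀ r, r < 37 → s₁.reg r = (s.receive e).reg r := fun r h => hr r (by
      simp only [moveInput, block, Avoids]; omega)
    have hc₁ : Cfg P s₁ := hc.frame fun r _ _ => hr' r (by omega)
    refine Sure.seq_spec (applyOp_sure hw hc₁ (hmem ▸ hE) e h37 h38 h39) ?_
    rintro s₂ ⟨h4, h5⟩
    exact runSampler_spec hw ⟨hc₁.frame fun r _ _ => h5 r (by omega), h4.stores,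
      (hf.congr fun r _ _ => hr' r (by omega)).congr fun r _ _ => h5 r (by omega)⟩ hsmall

/-! ### Large graphs -/

/-- From position `a` on, the buffer holds the updates in `l`. -/
def Buf (P : Params) (l : List (EdgeUpdate P.n)) (a : ℕ) (m : ℕ → ℕ) : Prop :=
  ∀ i (h : i < l.length), a ≤ i → m (3 * (P.n * P.n) + 3 * P.n + i) = l[i].kind ∧
    m (3 * (P.n * P.n) + 4 * P.n + i) = l[i].fst ∧ m (3 * (P.n * P.n) + 5 * P.n + i) = l[i].snd

/-- The state of the algorithm for large graphs: `old` are the updates of the previous phase, of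
which `a` were already applied to the stored graph, and `new` are the updates of this phase. -/
structure LargeState (P : Params) (G : SimpleGraph (Fin P.n)) (old new : List (EdgeUpdate P.n))
    (a : ℕ) (s : RamState) : Prop where
  cfg : Cfg P s
  r26 : s.reg 26 = new.length
  r27 : s.reg 27 = a
  stores : Stores P.n (arcs (updatedGraph G (old.take a))) s.mem
  newBuf : Buf P new 0 s.mem
  oldBuf : Buf P old a s.mem
  inv : SamplerInv P (updatedGraph G old) s
  fresh : a < old.length → Fresh s

variable {old new : List (EdgeUpdate P.n)} {a : ℕ}

/-- The sampler has to be idle while the stored graph changes, since its invariant refers to a fixed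
graph; for a fresh sampler the invariant holds for every graph. -/
theorem applyNext_sure (hw : P.Ok w) (hs : LargeState P G old new a s) (ha : a < old.length)
    (hl : old.length ≤ P.n) :
    Sure w applyNext s applyNext.cost fun s' => LargeState P G old new (a + 1) s' ∧
      (∀ r, r < 27 ∨ 30 ≤ r ∧ r < 37 → s'.reg r = s.reg r) ∧
      ∀ x, 3 * (P.n * P.n) + P.n ≤ x → s'.mem x = s.mem x := by
  have hm := hw.mem
  have hn : P.n ≤ P.n * P.n := Nat.le_mul_self _
  have hc := hs.cfg
  obtain ⟨hb1, hb2, hb3⟩ := hs.oldBuf a ha le_rfl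
  refine Sure.seq (T₁ := fetch.cost) (T₂ := applyOp.cost) (Q := fun s₁ => (s₁.reg 37 = old[a].fst ∧
    s₁.reg 38 = old[a].snd ∧ s₁.reg 39 = old[a].kind ∧ s₁.reg 27 = a + 1 ∧ s₁.mem = s.mem) ∧
      ∀ r, fetch.Avoids r → s₁.reg r = s.reg r) (Sure.frame (Sure.of_wp ?_)) ?_
  · simp only [fetch, block, wp, reg_setReg, mem_setReg, Nat.reduceEqDiff, reduceIte, hc.r12,
      hc.r13, hc.r14, hc.r15, hs.r27, hb1, hb2, hb3, and_true]
    omega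
  · rintro s₁ ⟨⟨h37, h38, h39, h27, hmem⟩, hr⟩
    have hr' : ∀ r, r < 27 ∨ 28 ≤ r ∧ r < 37 → s₁.reg r = s.reg r := fun r h => hr r (by
      simp only [fetch, block, Avoids]; omega)
    have hc₁ : Cfg P s₁ := hc.frame fun r _ _ => hr' r (by omega)
    refine (applyOp_sure hw hc₁ (hmem ▸ hs.stores) old[a] h37 h38 h39).mono ?_
    rintro s₂ ⟨h4, h5⟩
    have h6 : ∀ x, 3 * (P.n * P.n) + P.n ≤ x → s₂.mem x = s.mem x := fun x hx => by
      rw [h4.out x (.inr hx), hmem]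
    have h7 : ∀ r, r < 27 ∨ 30 ≤ r ∧ r < 37 → s₂.reg r = s.reg r := fun r h => by
      rw [h5 r (by omega), hr' r (by omega)]
    have hfr := (hs.fresh ha).congr fun r _ _ => h7 r (by omega)
    refine ⟨⟨hc.frame fun r _ _ => h7 r (by omega), by rw [h7 26 (by omega), hs.r26],
      by rw [h5 27 (by omega), h27], ?_, fun i hi _ => ?_, fun i hi hai => ?_, hfr.samplerInv,
      fun _ => hfr⟩, h7, h6⟩
    · rw [List.take_add_one, List.getElem?_eq_getElem ha, Option.toList_some, updatedGraph_append]
      exact h4.stores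
    · rw [h6 _ (by omega), h6 _ (by omega), h6 _ (by omega)]
      exact hs.newBuf i hi (Nat.zero_le _)
    · rw [h6 _ (by omega), h6 _ (by omega), h6 _ (by omega)]
      exact hs.oldBuf i hi (by omega)

/-- The number of remaining steps of the sampler in the phase, after `t` updates. -/
def remaining (P : Params) (t : ℕ) : ℕ := min P.H (2 * P.H - t) * P.b

theorem two_H_le (hw : P.Ok w) : 2 * P.H ≤ P.n := by
  have h1 := Nat.div_mul_le_self P.n (16 * P.qb)
  have h2 : P.H * 2 ≤ P.H * (16 * P.qb) := Nat.mul_le_mul_left _ (by have := hw.qb_pos; omega)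
  change P.H * (16 * P.qb) ≤ P.n at h1
  omega

/-- Two old updates per new one finish all `2 H` old updates within `H` steps of the phase. From
then on the graph is frozen, and each update spends `b` steps of the budget `remaining`. -/
theorem phaseStep_spec (hw : P.Ok w) (hs : LargeState P G old new (min (2 * new.length) (2 * P.H)) s)
    (hold : old.length = 2 * P.H) (hnew : new.length < 2 * P.H) :
    Spec w phaseStep s (1 + (max (applyNext.cost + applyNext.cost + 1) (repeatTime P.b) + 1) + 1)
      (fun s' => LargeState P G old new (min (2 * (new.length + 1)) (2 * P.H)) s' ∧
        ∀ r, r < 26 → s'.reg r = s.reg r)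
      (fun s' => ENNReal.ofReal
        (samplerPotential P (updatedGraph G old) (remaining P (new.length + 1)) s'))
      (ENNReal.ofReal (samplerPotential P (updatedGraph G old) (remaining P new.length) s)) := by
  have hm := hw.mem
  have hn : P.n ≤ P.n * P.n := Nat.le_mul_self _
  have hH := two_H_le hw
  refine Sure.seq_spec (Q := fun s₁ => s₁.reg 40 = (if new.length < P.H then 1 else 0) ∧
    s₁.mem = s.mem ∧ ∀ r, r ≠ 40 → s₁.reg r = s.reg r)
    (Sure.of_wp (P := .op .lt 40 26 24) ?_) ?_
  · simp only [wp, reg_setReg, mem_setReg, reduceIte, hs.cfg.r24, hs.r26]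
    refine ⟨by omega, fun h => ⟨by simp [h], trivial, fun r hr => if_neg hr⟩,
      fun h => ⟨by simp [h], trivial, fun r hr => if_neg hr⟩⟩
  · rintro s₁ ⟨h40, hmem, hr⟩
    have hs₁ : LargeState P G old new (min (2 * new.length) (2 * P.H)) s₁ :=
      ⟨hs.cfg.frame fun r _ _ => hr r (by omega), by rw [hr _ (by omega), hs.r26],
        by rw [hr _ (by omega), hs.r27], hmem ▸ hs.stores, hmem ▸ hs.newBuf, hmem ▸ hs.oldBuf,
        SamplerInv.congr hs.inv (fun r _ _ => hr r (by omega)) hmem,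
        fun h => (hs.fresh h).congr fun r _ _ => hr r (by omega)⟩
    rw [← samplerPotential_congr (s' := s₁) (fun r _ _ => hr r (by omega)) (congrFun hmem _)]
    have hr0 : ∀ r, r < 26 → s₁.reg r = s.reg r := fun r h => hr r (by omega)
    clear hr hmem hs
    refine Spec.ite (fun h => ?_) fun h => ?_
    · have hlt : new.length < P.H := by
        by_contra h'
        exact h (by rw [h40, if_neg h'])
      have e1 : remaining P new.length = P.H * P.b := by
        rw [remaining, min_eq_left (by omega)]
      have e2 : remaining P (new.length + 1) = P.H * P.b := by
        rw [remaining, min_eq_left (by omega)]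
      rw [e1, e2, show min (2 * (new.length + 1)) (2 * P.H) = 2 * new.length + 1 + 1 by omega]
      rw [show min (2 * new.length) (2 * P.H) = 2 * new.length by omega] at hs₁
      refine Spec.mono_time ?_ (le_max_left _ _)
      refine (Sure.seq (applyNext_sure hw hs₁ (by omega) (by omega)) (Q' := fun s' =>
        LargeState P G old new (2 * new.length + 1 + 1) s' ∧
        (∀ r, r < 26 ∨ 30 ≤ r ∧ r < 37 → s'.reg r = s₁.reg r) ∧
        ∀ x, 3 * (P.n * P.n) + P.n ≤ x → s'.mem x = s₁.mem x) ?_).spec ?_ |>.conseq ?_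
          (fun _ _ => le_rfl) le_rfl
      · rintro s₂ ⟨hs₂, hr₂, hm₂⟩
        refine (applyNext_sure hw hs₂ (by omega) (by omega)).mono ?_
        rintro s₃ ⟨hs₃, hr₃, hm₃⟩
        exact ⟨hs₃, fun r h => by rw [hr₃ r (by omega), hr₂ r (by omega)],
          fun x hx => by rw [hm₃ x hx, hm₂ x hx]⟩
      · rintro s' ⟨h1, h2, h3⟩
        rw [samplerPotential_congr (fun r _ _ => h2 r (by omega)) (h3 _ le_rfl)]
      · rintro s' ⟨h1, h2, h3⟩
        exact ⟨h1, fun r h => by rw [h2 r (by omega), hr0 r h]⟩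
    · have hge : P.H ≤ new.length := by
        by_contra! h'
        rw [h40, if_pos h'] at h
        omega
      have e1 : remaining P new.length = remaining P (new.length + 1) + P.b := by
        rw [remaining, remaining, min_eq_right (by omega), min_eq_right (by omega),
          show 2 * P.H - new.length = 2 * P.H - (new.length + 1) + 1 by omega, Nat.add_mul, one_mul]
      rw [show min (2 * (new.length + 1)) (2 * P.H) = 2 * P.H by omega]
      rw [show min (2 * new.length) (2 * P.H) = 2 * P.H by omega] at hs₁
      have hst := hs₁.stores
      rw [← hold, List.take_length] at hst
      refine Spec.mono_time ?_ (le_max_right _ _)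
      rw [e1]
      push_cast
      refine (repeatSample_spec hw hs₁.cfg hs₁.inv hst _).conseq ?_ (fun _ _ => le_rfl) le_rfl
      rintro s' ⟨⟨h1, h2⟩, h3⟩
      have h4 : ∀ r, r < 30 → s'.reg r = s₁.reg r := fun r h => h3 r (repeatSample_avoids (by omega))
      refine ⟨⟨hs₁.cfg.frame fun r _ _ => h4 r (by omega), by rw [h4 _ (by omega), hs₁.r26],
        by rw [h4 _ (by omega), hs₁.r27], Stores.keepsOuter hs₁.stores h2, fun i hi _ => ?_,
        fun i hi hai => by omega, h1, fun h => by omega⟩, fun r h => by rw [h4 r (by omega), hr0 r h]⟩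
      rw [h2 _ (by omega), h2 _ (by omega), h2 _ (by omega)]
      exact hs₁.newBuf i hi (Nat.zero_le _)

/-- Old and new updates share one buffer. Reading proceeds at twice the speed of writing, so the
overwritten position has been read, which is what `new.length < a` says. -/
theorem record_sure (hw : P.Ok w) (hs : LargeState P G old new a s) (ha : new.length < a)
    (hl : new.length < P.n) (hold : old.length ≤ P.n) (e : EdgeUpdate P.n) (h1 : s.reg 1 = e.kind) (h2 : s.reg 2 = e.fst)
    (h3 : s.reg 3 = e.snd) :
    Sure w record s record.cost fun s' => LargeState P G old (new ++ [e]) a s' ∧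
      (∀ r, r < 26 ∨ 30 ≤ r ∧ r < 37 → s'.reg r = s.reg r) ∧
      ∀ x, x < 3 * (P.n * P.n) + 3 * P.n → s'.mem x = s.mem x := by
  have hm := hw.mem
  have hn : P.n ≤ P.n * P.n := Nat.le_mul_self _
  have hc := hs.cfg
  refine (Sure.frame (Q := fun s' => s'.reg 26 = new.length + 1 ∧ s'.mem =
    Function.update (Function.update (Function.update s.mem
      (3 * (P.n * P.n) + 3 * P.n + new.length) e.kind)
      (3 * (P.n * P.n) + 4 * P.n + new.length) e.fst)
      (3 * (P.n * P.n) + 5 * P.n + new.length) e.snd) (Sure.of_wp ?_)).mono ?_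
  · simp only [record, block, wp, reg_setReg, mem_setReg, reg_setMem, mem_setMem, Nat.reduceEqDiff,
      reduceIte, hc.r12, hc.r13, hc.r14, hc.r15, hs.r26, h1, h2, h3, and_true]
    omega
  · rintro s' ⟨⟨h26, hmem⟩, hr⟩
    have hr' : ∀ r, r < 26 ∨ 27 ≤ r ∧ r < 37 → s'.reg r = s.reg r := fun r h => hr r (by
      simp only [record, block, Avoids, true_and]; omega)
    have hlow : ∀ x, x < 3 * (P.n * P.n) + 3 * P.n → s'.mem x = s.mem x := fun x hx => by
      rw [hmem, Function.update_of_ne (by omega), Function.update_of_ne (by omega),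
        Function.update_of_ne (by omega)]
    have hbuf : ∀ i < P.n, i ≠ new.length →
        s'.mem (3 * (P.n * P.n) + 3 * P.n + i) = s.mem (3 * (P.n * P.n) + 3 * P.n + i) ∧
        s'.mem (3 * (P.n * P.n) + 4 * P.n + i) = s.mem (3 * (P.n * P.n) + 4 * P.n + i) ∧
        s'.mem (3 * (P.n * P.n) + 5 * P.n + i) = s.mem (3 * (P.n * P.n) + 5 * P.n + i) := by
      intro i hi hne
      rw [hmem]
      refine ⟨?_, ?_, ?_⟩ <;> rw [Function.update_of_ne (by omega), Function.update_of_ne (by omega),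
        Function.update_of_ne (by omega)]
    have hst : Stores P.n (arcs (updatedGraph G (old.take a))) s'.mem :=
      hs.stores.congr (fun _ _ _ _ => Iff.rfl) fun x _ hx => hlow x (by omega)
    refine ⟨⟨hc.frame fun r _ _ => hr' r (by omega), by simp [h26], by rw [hr' 27 (by omega), hs.r27],
      hst, fun i hi _ => ?_, fun i hi hai => ?_, ?_, fun h =>
        (hs.fresh h).congr fun r _ _ => hr' r (by omega)⟩, fun r h => hr' r (by omega), hlow⟩
    · rcases eq_or_ne i new.length with rfl | hne
      · have e1 : s'.mem (3 * (P.n * P.n) + 3 * P.n + new.length) = e.kind := by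
          rw [hmem, Function.update_of_ne (by omega), Function.update_of_ne (by omega),
            Function.update_self]
        have e2 : s'.mem (3 * (P.n * P.n) + 4 * P.n + new.length) = e.fst := by
          rw [hmem, Function.update_of_ne (by omega), Function.update_self]
        have e3 : s'.mem (3 * (P.n * P.n) + 5 * P.n + new.length) = e.snd := by
          rw [hmem, Function.update_self]
        simpa using ⟨e1, e2, e3⟩
      · have hi' : i < new.length := by rw [List.length_append, List.length_singleton] at hi; omega
        obtain ⟨b1, b2, b3⟩ := hbuf i (by omega) hne
        rw [b1, b2, b3, List.getElem_append_left hi']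
        exact hs.newBuf i hi' (Nat.zero_le _)
    · obtain ⟨b1, b2, b3⟩ := hbuf i (by omega) (by omega)
      rw [b1, b2, b3]
      exact hs.oldBuf i hi hai
    · by_cases h : a < old.length
      · exact ((hs.fresh h).congr fun r _ _ => hr' r (by omega)).samplerInv
      · have := hs.stores
        rw [List.take_of_length_le (not_lt.mp h)] at this
        exact SamplerInv.congr_of_lt hs.inv this (fun r _ _ => hr' r (by omega)) hlow

end RamProg

/-! ### Ending a phase, and one update of a large graph -/

namespace RamProg

open RamState

variable {w : ℕ} {P : Params} {s : RamState} {G : SimpleGraph (Fin P.n)}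
  {old new : List (EdgeUpdate P.n)} {a : ℕ}

theorem LargeState.frame {s' : RamState} (hs : LargeState P G old new a s)
    (hr : ∀ r, 4 ≤ r → r < 37 → s'.reg r = s.reg r) (hm : s'.mem = s.mem) :
    LargeState P G old new a s' :=
  ⟨hs.cfg.frame fun r _ _ => hr r (by omega) (by omega), by rw [hr _ (by omega) (by omega), hs.r26],
    by rw [hr _ (by omega) (by omega), hs.r27], hm ▸ hs.stores, hm ▸ hs.newBuf, hm ▸ hs.oldBuf,
    SamplerInv.congr hs.inv (fun r _ _ => hr r (by omega) (by omega)) hm,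
    fun h => (hs.fresh h).congr fun r _ _ => hr r (by omega) (by omega)⟩

/-- A bound on the time of `tick`. -/
def tickTime : ℕ := 1 + (publish.cost + 3 + 1 + 1) + 1

theorem compare_sure (hw : P.Ok w) (hs : LargeState P G old new a s) :
    Sure w (.op .eq 40 26 25) s 1 fun s₁ =>
      s₁.reg 40 = (if new.length = 2 * P.H then 1 else 0) ∧
      (∀ r, r ≠ 40 → s₁.reg r = s.reg r) ∧ s₁.mem = s.mem := by
  have hm := hw.mem
  refine Sure.of_wp (P := .op .eq 40 26 25) ?_
  simp only [wp, reg_setReg, mem_setReg, reduceIte, hs.cfg.r25, hs.r26]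
  exact ⟨by omega, fun h => ⟨by simp [h], fun r hr => if_neg hr, trivial⟩,
    fun h => ⟨by simp [h], fun r hr => if_neg hr, trivial⟩⟩

theorem tick_sure (hw : P.Ok w) (hs : LargeState P G old new a s) (ht : new.length ≠ 2 * P.H) :
    Sure w tick s tickTime fun s' => (∀ r, r ≠ 40 → s'.reg r = s.reg r) ∧ s'.mem = s.mem := by
  refine Sure.seq (compare_sure hw hs) ?_
  rintro s₁ ⟨h40, h⟩
  rw [if_neg ht] at h40
  exact Spec.ite (fun h => absurd h40 h) fun _ => Spec.mono_time (Sure.of_wp (P := .skip) h) (by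
    change 1 ≤ _
    omega)

theorem tick_spec (hw : P.Ok w) (hs : LargeState P G old new (2 * P.H) s)
    (hold : old.length = 2 * P.H) (hnew : new.length = 2 * P.H) {c : ℕ}
    (hc : |(numCC (updatedGraph G old) : ℤ) - c| ≤ P.stale) :
    Spec w tick s tickTime (LargeState P (updatedGraph G old) new [] 0) (farFrom P c)
      (failWith P (ENNReal.ofReal (samplerPotential P (updatedGraph G old) 0 s))) := by
  refine Sure.seq_spec (compare_sure hw hs) ?_
  rintro s₁ ⟨h40, hr, hm⟩
  rw [← samplerPotential_congr (s' := s₁) (fun r _ _ => hr r (by omega)) (congrFun hm _)]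
  have hs₁ := hs.frame (fun r _ _ => hr r (by omega)) hm
  rw [if_pos hnew] at h40
  refine Spec.ite (fun _ => ?_) fun h => by omega
  have hst := hs₁.stores
  rw [← hold, List.take_length] at hst
  rw [failWith_ofReal hw (samplerPotential_nonneg _)]
  refine Spec.seq (publish_spec hw hs₁.cfg hs₁.inv hst hc) ?_
  rintro s₂ ⟨⟨h30, h31, h32, hm₂⟩, hr₂⟩
  have hc₂ : Cfg P s₂ := hs₁.cfg.frame fun r _ _ => hr₂ r (publish_avoids (by omega) (by omega))
  have h0 : 0 < 2 ^ w := by positivity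
  refine (Sure.of_wp (P := block [.const 26 0, .const 27 0]) (Q := fun s' => s'.reg 26 = 0 ∧
    s'.reg 27 = 0 ∧ s'.mem = s₂.mem ∧ ∀ r, r < 26 ∨ 28 ≤ r → s'.reg r = s₂.reg r) ?_).spec ?_
    |>.conseq ?_ (fun _ _ => le_rfl) le_rfl
  · simp only [block, wp, reg_setReg, mem_setReg, Nat.reduceEqDiff, reduceIte, true_and]
    refine ⟨h0, h0, fun r h => ?_⟩
    rw [if_neg (by omega), if_neg (by omega)]
  · rintro s' ⟨-, -, -, h⟩
    rw [farFrom, farFrom, h 0 (by omega)]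
  · rintro s' ⟨h26, h27, hm', hr'⟩
    have hf : Fresh s' := Fresh.congr ⟨h30, h31, h32⟩ fun r _ _ => hr' r (by omega)
    have hmem : s'.mem = s₁.mem := by rw [hm', hm₂]
    refine ⟨hc₂.frame fun r _ _ => hr' r (by omega), h26, h27, ?_, fun i hi => by simp at hi, ?_,
      hf.samplerInv, fun _ => hf⟩
    · rw [hmem]
      exact hst
    · rw [hmem]
      exact hs₁.newBuf

/-- A bound on the time of `largeUpdate`. -/
def largeTime (b : ℕ) : ℕ :=
  1 + (max (applyNext.cost + applyNext.cost + 1) (repeatTime b) + 1) + 1 +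
    (record.cost + tickTime + 1) + 1

/-- The part of an update common to both kinds of phase steps. The affine form covers passing on the
expected potential (`α = 0`, `β = 1`) and converting it into a failure probability (`failWith`). -/
theorem largeUpdate_of_tick (hw : P.Ok w)
    (hs : LargeState P G old new (min (2 * new.length) (2 * P.H)) s)
    (hold : old.length = 2 * P.H) (hnew : new.length < 2 * P.H) (e : EdgeUpdate P.n)
    {Q : RamState → Prop} {f : RamState → ℝ≥0∞} {α β : ℝ≥0∞}
    (htick : ∀ s', LargeState P G old (new ++ [e]) (min (2 * (new.length + 1)) (2 * P.H)) s' →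
      s'.reg 0 = s.reg 0 → Spec w tick s' tickTime Q f (α + β * ENNReal.ofReal
        (samplerPotential P (updatedGraph G old) (remaining P (new.length + 1)) s'))) :
    Spec w largeUpdate (s.receive e) (largeTime P.b) Q f (α + β * ENNReal.ofReal
        (samplerPotential P (updatedGraph G old) (remaining P new.length) s)) := by
  have hH := two_H_le hw
  obtain ⟨h1, h2, h3⟩ := input_receive s e
  have hr : ∀ r, 4 ≤ r → r < 37 → (s.receive e).reg r = s.reg r := fun r h _ =>
    reg_receive s e (.inr h)
  have hs₁ := hs.frame hr (mem_receive s e)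
  rw [← samplerPotential_congr (s' := s.receive e) (fun r _ _ => hr r (by omega) (by omega))
    (congrFun (mem_receive s e) _)]
  refine Spec.seq ((phaseStep_spec hw hs₁ hold hnew).affine α β) ?_
  rintro s₂ ⟨hs₂, hr₂⟩
  refine Sure.seq_spec (record_sure hw hs₂ (by omega) (by omega) (by omega) e
    (by rw [hr₂ _ (by omega), h1]) (by rw [hr₂ _ (by omega), h2])
    (by rw [hr₂ _ (by omega), h3])) ?_
  rintro s₃ ⟨hs₃, hr₃, hm₃⟩
  have hn := hw.n_pos
  rw [← samplerPotential_congr (s' := s₃) (fun r _ _ => hr₃ r (by omega)) (hm₃ _ (by omega))]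
  exact htick s₃ hs₃ (by rw [hr₃ 0 (by omega), hr₂ 0 (by omega), reg_receive s e (.inl rfl)])

theorem largeUpdate_continue (hw : P.Ok w)
    (hs : LargeState P G old new (min (2 * new.length) (2 * P.H)) s)
    (hold : old.length = 2 * P.H) (hnew : new.length + 1 < 2 * P.H) (e : EdgeUpdate P.n) :
    Spec w largeUpdate (s.receive e) (largeTime P.b)
      (fun s' => LargeState P G old (new ++ [e]) (min (2 * (new ++ [e]).length) (2 * P.H)) s' ∧
        s'.reg 0 = s.reg 0)
      (fun s' => ENNReal.ofReal
        (samplerPotential P (updatedGraph G old) (remaining P (new ++ [e]).length) s'))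
      (ENNReal.ofReal (samplerPotential P (updatedGraph G old) (remaining P new.length) s)) := by
  rw [List.length_append, List.length_singleton]
  have := largeUpdate_of_tick hw hs hold (by omega) e (α := 0) (β := 1)
    (Q := fun s' => LargeState P G old (new ++ [e]) (min (2 * (new.length + 1)) (2 * P.H)) s' ∧
        s'.reg 0 = s.reg 0) (f := fun s' => ENNReal.ofReal
        (samplerPotential P (updatedGraph G old) (remaining P (new.length + 1)) s')) ?_
  · simpa only [zero_add, one_mul] using this
  · intro s' hs' h0
    rw [zero_add, one_mul]
    refine ((tick_sure hw hs' ?_).spec ?_).conseq ?_ (fun _ _ => le_rfl) le_rfl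
    · rw [List.length_append, List.length_singleton]
      omega
    · rintro s'' ⟨h, hm⟩
      rw [samplerPotential_congr (fun r _ _ => h r (by omega)) (congrFun hm _)]
    · rintro s'' ⟨h, hm⟩
      exact ⟨hs'.frame (fun r _ _ => h r (by omega)) hm, by rw [h 0 (by omega), h0]⟩

/-- The estimate published at the end of a phase is about the graph at the beginning of that phase,
which becomes the reference graph of the next phase. -/
theorem largeUpdate_finish (hw : P.Ok w)
    (hs : LargeState P G old new (min (2 * new.length) (2 * P.H)) s)
    (hold : old.length = 2 * P.H) (hnew : new.length + 1 = 2 * P.H) (e : EdgeUpdate P.n) {c : ℕ}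
    (hc : |(numCC (updatedGraph G old) : ℤ) - c| ≤ P.stale) :
    Spec w largeUpdate (s.receive e) (largeTime P.b)
      (LargeState P (updatedGraph G old) (new ++ [e]) [] 0) (farFrom P c)
      (failWith P (ENNReal.ofReal
        (samplerPotential P (updatedGraph G old) (remaining P new.length) s))) := by
  refine largeUpdate_of_tick hw hs hold (by omega) e fun s' hs' _ => ?_
  rw [show min (2 * (new.length + 1)) (2 * P.H) = 2 * P.H by omega] at hs'
  rw [show remaining P (new.length + 1) = 0 by rw [remaining, hnew]; simp, Nat.cast_zero]
  exact tick_spec hw hs' hold (by simpa using hnew) hc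

/-! ### The algorithm -/

theorem Spec.after {R : RamProg} {T : ℕ} {Q : RamState → Prop} {f : RamState → ℝ≥0∞} {c : ℝ≥0∞}
    (h : Spec w R s T Q f c) : Big w R s T (R.after w T s) ∧
      (∀ s' ∈ (R.after w T s).support, Q s') ∧ (R.after w T s).expect f ≤ c := by
  obtain ⟨μ, h1, h2⟩ := h
  rw [h1.after_eq]
  exact ⟨h1, h2⟩

/-- The state of the algorithm after the preprocessing. -/
structure Ready (P : Params) (G : SimpleGraph (Fin P.n)) (s : RamState) : Prop where
  cfg : Cfg P s
  stores : Stores P.n (arcs G) s.mem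
  fresh : Fresh s
  r26 : s.reg 26 = 0
  r27 : s.reg 27 = 0
  zero : ∀ x, 3 * (P.n * P.n) + 3 * P.n ≤ x → s.mem x = 0

theorem apply_insert_self {n : ℕ} (G : SimpleGraph (Fin n)) (u : Fin n) :
    (EdgeUpdate.insert u u).apply G = G := by
  simp [EdgeUpdate.apply]

theorem updatedGraph_replicate_insert_self {n : ℕ} (G : SimpleGraph (Fin n)) (u : Fin n) (k : ℕ) :
    updatedGraph G (List.replicate k (.insert u u)) = G := by
  induction k with
  | zero => rfl
  | succ k ih =>
    rw [List.replicate_succ, updatedGraph, List.foldl_cons, apply_insert_self]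
    exact ih

/-- The first phase needs a predecessor: an all-zero buffer encodes insertions of a self-loop at
vertex `0`, which have no effect. -/
theorem Ready.largeState (h : Ready P G s) (u : Fin P.n) (hu : (u : ℕ) = 0) :
    LargeState P G (List.replicate (2 * P.H) (.insert u u)) [] 0 s := by
  refine ⟨h.cfg, h.r26, h.r27, h.stores, fun i hi => by simp at hi, fun i hi _ => ?_,
    h.fresh.samplerInv, fun _ => h.fresh⟩
  rw [List.getElem_replicate, h.zero _ (by omega), h.zero _ (by omega), h.zero _ (by omega)]
  exact ⟨rfl, hu.symm, hu.symm⟩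

theorem one_le_farFrom {c : ℕ} (h : ¬ |(s.reg 0 : ℝ) - c| ≤ P.R) : 1 ≤ farFrom P c s := by
  rw [farFrom, if_neg]
  intro h'
  exact h (by exact_mod_cast h')

/-- The second half of a phase has `H` updates with `W / H + 1` steps each. -/
theorem W_le_remaining (hw : P.Ok w) (hP : ¬ P.Small) : P.W ≤ remaining P 0 := by
  have hH : 0 < P.H := Nat.div_pos (not_lt.mp hP) (by have := hw.qb_pos; omega)
  rw [remaining, min_eq_left (by omega), Params.b, if_neg hP, Nat.mul_add, mul_one]
  exact (Nat.lt_mul_div_succ P.W hH).le.trans (by rw [Nat.mul_add, mul_one])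

theorem update_small {T : ℕ} {Q : RamState → Prop} {f : RamState → ℝ≥0∞} {c : ℝ≥0∞}
    (hc : Cfg P s) (hP : P.Small) (h : Spec w smallUpdate s T Q f c) :
    Spec w update s (T + 1 + 1) Q f c :=
  Spec.ite (fun _ => Spec.ite (fun _ => h) fun h => by rw [hc.r9, if_pos hP] at h; omega)
    fun h => by rw [hc.r8] at h; omega

theorem update_large {T : ℕ} {Q : RamState → Prop} {f : RamState → ℝ≥0∞} {c : ℝ≥0∞}
    (hc : Cfg P s) (hP : ¬ P.Small) (h : Spec w largeUpdate s T Q f c) :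
    Spec w update s (T + 1 + 1) Q f c :=
  Spec.ite (fun _ => Spec.ite (fun h => by rw [hc.r9, if_neg hP] at h; omega) fun _ => h)
    fun h => by rw [hc.r8] at h; omega

variable {A : DynamicAlgorithm} {k : ℕ} {par : Fin k → ℕ}

/-- If the preprocessing establishes the invariant, then the algorithm works. -/
theorem maintains_of_small (hw : P.Ok w) (hA : A.upd = update) (hP : P.Small)
    (hpre : ∀ G : SimpleGraph (Fin P.n), ∃ T₀,
      Spec w A.pre (initialState par G) T₀ (Ready P G) (farFrom P (numCC G))
        (ENNReal.ofReal P.fail)) :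
    A.MaintainsNumCC w par P.n P.R P.fail (updateTime P.b) := by
  refine DynamicAlgorithm.maintainsNumCC_of_invariant (P.fail_nonneg hw) (fun G ops μ =>
    (∀ s ∈ μ.support, SmallState P (updatedGraph G ops) s) ∧
      μ.expect (farFrom P (numCC (updatedGraph G ops))) ≤ ENNReal.ofReal P.fail) ?_ ?_ ?_
  · intro G
    obtain ⟨T₀, μ, h1, h2, h3⟩ := hpre G
    exact ⟨T₀, μ, h1, fun s hs => ⟨(h2 s hs).cfg, (h2 s hs).stores, (h2 s hs).fresh⟩, h3⟩
  · rintro G ops e μ ⟨h1, h2⟩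
    rw [updatedGraph_append, hA]
    have key : ∀ s ∈ μ.support, _ := fun s hs =>
      (Spec.mono_time (T₁ := updateTime P.b) (update_small
        ((h1 s hs).cfg.frame fun r _ _ => reg_receive s e (by omega)) hP
        (smallUpdate_spec hw (h1 s hs) hP e)) (by unfold updateTime; omega)).after
    refine ⟨fun s => update.after w (updateTime P.b) (s.receive e), fun s hs => (key s hs).1,
      fun s' hs' => ?_, ?_⟩
    · rw [PMF.mem_support_bind_iff] at hs'
      obtain ⟨s, hs, hs'⟩ := hs'
      exact (key s hs).2.1 s' hs'
    · rw [PMF.expect_bind]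
      exact PMF.expect_le_of_le fun s hs => (key s hs).2.2
  · rintro G ops μ ⟨h1, h2⟩
    exact ⟨_, h2, fun s hs h => one_le_farFrom h⟩

/-- `G'` is the graph to which the published estimate refers, `old` and `new` are the updates of the
previous and the current phase. The invariant of the law bounds the expected potential of the
current run, and the failure probability with respect to every number `c` within the permitted
staleness of `numCC G'`. Quantifying over `c` lets the true count move while the output stays
unchanged. -/
theorem maintains_of_large (hw : P.Ok w) (hA : A.upd = update) (hP : ¬ P.Small)
    (hpre : ∀ G : SimpleGraph (Fin P.n), ∃ T₀, ∀ c : ℕ, |(numCC G : ℤ) - c| ≤ P.stale →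
      Spec w A.pre (initialState par G) T₀ (Ready P G) (farFrom P c) (ENNReal.ofReal P.fail)) :
    A.MaintainsNumCC w par P.n P.R P.fail (updateTime P.b) := by
  have hH : 0 < P.H := Nat.div_pos (not_lt.mp hP) (by have := hw.qb_pos; omega)
  have hst : P.stale = 4 * P.H := if_neg hP
  have hW := W_le_remaining hw hP
  have htime : largeTime P.b + 1 + 1 ≤ updateTime P.b := by
    have : applyNext.cost = fetch.cost + applyOp.cost + 1 := rfl
    unfold largeTime updateTime tickTime
    omega
  have hcast : ∀ G' : SimpleGraph (Fin P.n), ∀ l : List (EdgeUpdate P.n),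
      |(numCC G' : ℤ) - numCC (updatedGraph G' l)| ≤ l.length := fun G' l => by
    have := numCC_updatedGraph_le G' l
    rw [abs_le]
    omega
  refine DynamicAlgorithm.maintainsNumCC_of_invariant (P.fail_nonneg hw) (fun G ops μ =>
    ∃ G' old new, old.length = 2 * P.H ∧ new.length < 2 * P.H ∧
      updatedGraph (updatedGraph G' old) new = updatedGraph G ops ∧
      (∀ s ∈ μ.support, LargeState P G' old new (min (2 * new.length) (2 * P.H)) s) ∧
      μ.expect (fun s => ENNReal.ofReal
        (samplerPotential P (updatedGraph G' old) (remaining P new.length) s)) ≤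
        ENNReal.ofReal (3 * Real.exp (-P.l)) ∧
      ∀ c : ℕ, |(numCC G' : ℤ) - c| ≤ P.stale →
        μ.expect (farFrom P c) ≤ ENNReal.ofReal P.fail) ?_ ?_ ?_
  · intro G
    obtain ⟨T₀, hT₀⟩ := hpre G
    obtain ⟨h1, h2, -⟩ := (hT₀ (numCC G) (by simp)).after
    refine ⟨T₀, _, h1, G, List.replicate (2 * P.H) (.insert ⟨0, hw.n_pos⟩ ⟨0, hw.n_pos⟩), [],
      List.length_replicate, by simpa using hH, ?_, fun s hs => ?_, ?_,
      fun c hc => (hT₀ c hc).after.2.2⟩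
    · rw [updatedGraph_replicate_insert_self]
    · simpa using (h2 s hs).largeState ⟨0, hw.n_pos⟩ rfl
    · refine PMF.expect_le_of_le fun s hs => ENNReal.ofReal_le_ofReal ?_
      exact (h2 s hs).fresh.potential_le hw hW
  · rintro G ops e μ ⟨G', old, new, hold, hnew, hG, hs, hpot, hfail⟩
    rw [hA]
    refine ⟨fun s => update.after w (updateTime P.b) (s.receive e), ?_⟩
    have hcfg : ∀ s ∈ μ.support, Cfg P (s.receive e) := fun s h =>
      (hs s h).cfg.frame fun r _ _ => reg_receive s e (by omega)
    have hG' : updatedGraph (updatedGraph G' old) (new ++ [e]) = updatedGraph G (ops ++ [e]) := by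
      rw [updatedGraph_append, updatedGraph_append, hG]
    rcases (show new.length + 1 ≤ 2 * P.H by omega).lt_or_eq with hlt | heq
    · have key : ∀ s ∈ μ.support, _ := fun s h =>
        (Spec.mono_time (update_large (hcfg s h) hP (largeUpdate_continue hw (hs s h) hold hlt e))
          htime).after
      refine ⟨fun s h => (key s h).1, G', old, new ++ [e], hold, by simpa using hlt, hG',
        fun s' hs' => ?_, ?_, fun c hc => ?_⟩
      · rw [PMF.mem_support_bind_iff] at hs'
        obtain ⟨s, h, hs'⟩ := hs'
        exact ((key s h).2.1 s' hs').1
      · rw [PMF.expect_bind]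
        exact (PMF.expect_mono fun s h => (key s h).2.2).trans hpot
      · rw [PMF.expect_bind]
        refine (PMF.expect_mono fun s h => ?_).trans (hfail c hc)
        refine PMF.expect_le_of_le fun s' hs' => ?_
        rw [farFrom, farFrom, ((key s h).2.1 s' hs').2]
    · have key : ∀ s ∈ μ.support, ∀ c : ℕ, |(numCC (updatedGraph G' old) : ℤ) - c| ≤ P.stale → _ :=
        fun s h c hc => (Spec.mono_time (update_large (hcfg s h) hP
          (largeUpdate_finish hw (hs s h) hold heq e hc)) htime).after
      have key' : ∀ s ∈ μ.support, _ := fun s h =>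
        key s h (numCC (updatedGraph G' old)) (by simp)
      have hsupp : ∀ s' ∈ (μ.bind fun s => update.after w (updateTime P.b) (s.receive e)).support,
          LargeState P (updatedGraph G' old) (new ++ [e]) [] 0 s' := by
        intro s' hs'
        rw [PMF.mem_support_bind_iff] at hs'
        obtain ⟨s, h, hs'⟩ := hs'
        exact (key' s h).2.1 s' hs'
      refine ⟨fun s h => (key' s h).1, updatedGraph G' old, new ++ [e], [], by simpa using heq,
        by simpa using hH, hG', by simpa using hsupp, ?_, fun c hc => ?_⟩
      · refine PMF.expect_le_of_le fun s h => ENNReal.ofReal_le_ofReal ?_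
        refine ((hsupp s h).fresh ?_).potential_le hw hW
        rw [List.length_append, List.length_singleton]
        omega
      · rw [PMF.expect_bind]
        refine (PMF.expect_mono fun s h => (key s h c hc).2.2).trans ?_
        have : μ.expect (fun s => failWith P (ENNReal.ofReal
            (samplerPotential P (updatedGraph G' old) (remaining P new.length) s))) =
            failWith P (μ.expect fun s => ENNReal.ofReal
            (samplerPotential P (updatedGraph G' old) (remaining P new.length) s)) := by
          simp only [failWith, PMF.expect_add, PMF.expect_const, PMF.expect_const_mul]
        rw [this]
        exact failWith_le hw hpot
  · rintro G ops μ ⟨G', old, new, hold, hnew, hG, hs, hpot, hfail⟩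
    refine ⟨_, hfail (numCC (updatedGraph G ops)) ?_, fun s _ h => one_le_farFrom h⟩
    -- Between `G'` and the current graph lie at most two phases, hence at most `4 H` updates.
    rw [← hG, hst]
    have h1 := hcast G' old
    have h2 := hcast (updatedGraph G' old) new
    rw [abs_le] at *
    omega

end RamProg

/-! ### The preprocessing program -/

/-- The memory holds the adjacency matrix of the graph, followed by zeros. -/
structure IsInput {n : ℕ} (G : SimpleGraph (Fin n)) (m : ℕ → ℕ) : Prop where
  adj : ∀ u < n, ∀ v < n, m (u * n + v) ≠ 0 ↔ arcs G u v
  zero : ∀ x, n * n ≤ x → m x = 0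

theorem isInput_initialState {k n : ℕ} (par : Fin k → ℕ) (G : SimpleGraph (Fin n)) :
    IsInput G (initialState par G).mem := by
  refine ⟨fun u hu v hv => ?_, fun x hx => ?_⟩
  · simp only [initialState, ne_eq, ite_eq_right_iff, one_ne_zero, imp_false, not_not]
    constructor
    · rintro ⟨u', v', h, h'⟩
      obtain ⟨rfl, rfl⟩ := cell_inj hv v'.2 h
      exact ⟨hu, hv, h'⟩
    · rintro ⟨hu, hv, h⟩
      exact ⟨_, _, rfl, h⟩
  · simp only [initialState, ite_eq_right_iff, one_ne_zero, imp_false]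
    rintro ⟨u, v, rfl, -⟩
    have := cell_lt u.2 v.2
    omega

namespace RamProg

/-- Compute the layout of the memory and the offsets. -/
def setLayout : RamProg := block
  [.const 15 1, .const 16 0, .const 8 1, .op .add 4 60 16, .op .mul 5 4 4, .op .add 6 5 5,
   .op .add 7 6 5, .op .add 10 7 4, .op .add 11 10 4, .op .add 12 11 4, .op .add 13 12 4,
   .op .add 14 13 4, .op .add 19 64 16, .op .div 21 4 61, .op .add 20 21 21, .op .add 20 20 15,
   .op .div 22 4 62]

/-- Compute the length of a phase and the precision. -/
def setMode : RamProg := block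
  [.const 65 16, .op .mul 65 65 62, .op .lt 9 4 65, .op .div 24 4 65, .op .add 25 24 24,
   .const 66 8, .ite 9 (.op .mul 66 66 4) (.op .mul 66 66 62)]

/-- Compute the number of samples, and prepare the computation of a logarithm. -/
def setSamples : RamProg := block
  [.op .mul 17 66 66, .op .mul 18 17 63, .const 67 0, .const 68 1, .op .lt 69 68 66]

/-- Double a power of two, and compare it with the precision. -/
def doublePower : RamProg := block [.op .add 68 68 68, .op .add 67 67 15, .op .lt 69 68 66]

/-- Compute the binary logarithm of the precision. -/
def setLog : RamProg := .loop 69 doublePower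

/-- Compute the number of steps of the sampler, and reset the sampler and the clock. -/
def setSteps : RamProg := block
  [.const 70 4, .op .mul 71 70 67, .const 72 3, .op .add 71 71 72, .op .mul 70 70 18,
   .op .mul 50 70 71, .ite 9 (.op .add 23 50 16) (.seq (.op .div 23 50 24) (.op .add 23 23 15)),
   .const 26 0, .const 27 0, .const 30 0, .const 31 0, .const 32 0]

/-- Compute all constants. -/
def setConstants : RamProg :=
  .seq setLayout (.seq setMode (.seq setSamples (.seq setLog setSteps)))

/-- Copy the arc in the current cell of the adjacency matrix. -/
def copyArc : RamProg := .seq (block [.op .sub 73 73 15, .load 74 73])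
  (.ite 74 (.seq (block [.op .div 37 73 4, .op .mod 38 73 4]) insertArc) .skip)

/-- Build the adjacency lists. -/
def copyGraph : RamProg := .seq (.op .add 73 5 16) (.loop 73 copyArc)

/-- Initialize the algorithm, given the parameters in registers `60`, …, `64`. -/
def setup : RamProg := .seq setConstants (.seq copyGraph (.seq sampleLoop publish))

open RamState

/-- The parameters are in their registers. -/
structure Given (P : Params) (s : RamState) : Prop where
  r60 : s.reg 60 = P.n
  r61 : s.reg 61 = P.q
  r62 : s.reg 62 = P.qb
  r63 : s.reg 63 = P.l
  r64 : s.reg 64 = P.J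

/-- The layout of the memory and the offsets are in their registers. -/
structure Layout (P : Params) (s : RamState) : Prop where
  r4 : s.reg 4 = P.n
  r5 : s.reg 5 = P.n * P.n
  r6 : s.reg 6 = 2 * (P.n * P.n)
  r7 : s.reg 7 = 3 * (P.n * P.n)
  r8 : s.reg 8 = 1
  r10 : s.reg 10 = 3 * (P.n * P.n) + P.n
  r11 : s.reg 11 = 3 * (P.n * P.n) + 2 * P.n
  r12 : s.reg 12 = 3 * (P.n * P.n) + 3 * P.n
  r13 : s.reg 13 = 3 * (P.n * P.n) + 4 * P.n
  r14 : s.reg 14 = 3 * (P.n * P.n) + 5 * P.n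
  r15 : s.reg 15 = 1
  r16 : s.reg 16 = 0
  r19 : s.reg 19 = P.J
  r20 : s.reg 20 = 2 * P.R + 1
  r21 : s.reg 21 = P.R
  r22 : s.reg 22 = P.Rb

theorem Layout.frame {P : Params} {s s' : RamState} (h : Layout P s)
    (hr : ∀ r, (4 ≤ r ∧ r < 9) ∨ (10 ≤ r ∧ r < 17) ∨ (19 ≤ r ∧ r < 23) → s'.reg r = s.reg r) :
    Layout P s' := by
  constructor <;> rw [hr _ (by norm_num)]
  exacts [h.r4, h.r5, h.r6, h.r7, h.r8, h.r10, h.r11, h.r12, h.r13, h.r14, h.r15, h.r16, h.r19,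
    h.r20, h.r21, h.r22]

variable {w : ℕ} {P : Params} {s : RamState} {G : SimpleGraph (Fin P.n)}

theorem setLayout_sure (hw : P.Ok w) (hs : Given P s) :
    Sure w setLayout s setLayout.cost fun s' => (Layout P s' ∧ s'.mem = s.mem) ∧
      ∀ r, 60 ≤ r → s'.reg r = s.reg r := by
  have hm := hw.mem
  have hsh := hw.shift
  have hJ := hw.J_pos
  have h1 : 2 * P.R + 1 ≤ P.J * (2 * P.R + 1) := Nat.le_mul_of_pos_left _ hJ
  have h2 : P.J ≤ P.J * (2 * P.R + 1) := Nat.le_mul_of_pos_right _ (by omega)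
  have h3 : P.Rb ≤ P.n := Nat.div_le_self _ _
  have eR : P.n / P.q = P.R := rfl
  have eRb : P.n / P.qb = P.Rb := rfl
  refine (Sure.frame (Q := fun s' => s'.reg 4 = P.n ∧ s'.reg 5 = P.n * P.n ∧
    s'.reg 6 = 2 * (P.n * P.n) ∧ s'.reg 7 = 3 * (P.n * P.n) ∧ s'.reg 8 = 1 ∧
    s'.reg 10 = 3 * (P.n * P.n) + P.n ∧ s'.reg 11 = 3 * (P.n * P.n) + 2 * P.n ∧
    s'.reg 12 = 3 * (P.n * P.n) + 3 * P.n ∧ s'.reg 13 = 3 * (P.n * P.n) + 4 * P.n ∧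
    s'.reg 14 = 3 * (P.n * P.n) + 5 * P.n ∧ s'.reg 15 = 1 ∧ s'.reg 16 = 0 ∧ s'.reg 19 = P.J ∧
    s'.reg 20 = 2 * P.R + 1 ∧ s'.reg 21 = P.R ∧ s'.reg 22 = P.Rb ∧ s'.mem = s.mem)
    (Sure.of_wp ?_)).mono ?_
  · simp only [setLayout, block, wp, reg_setReg, mem_setReg, Nat.reduceEqDiff, reduceIte, hs.r60,
      hs.r61, hs.r62, hs.r64, and_true, true_and, add_zero, eR, eRb]
    omega
  rintro s' ⟨⟨a1, a2, a3, a4, a5, a6, a7, a8, a9, a10, a11, a12, a13, a14, a15, a16, a17⟩, hr⟩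
  refine ⟨⟨⟨a1, a2, a3, a4, a5, a6, a7, a8, a9, a10, a11, a12, a13, a14, a15, a16⟩, a17⟩,
    fun r h => hr r ?_⟩
  simp only [setLayout, block, Avoids]
  omega

theorem setMode_sure (hw : P.Ok w) (hs : Given P s) (hl : Layout P s) :
    Sure w setMode s setMode.cost fun s' => ((s'.reg 9 = if P.Small then 1 else 0) ∧
      s'.reg 24 = P.H ∧ s'.reg 25 = 2 * P.H ∧ s'.reg 66 = P.Q ∧ s'.mem = s.mem) ∧
      ∀ r, r < 9 ∨ 10 ≤ r ∧ r < 24 ∨ 26 ≤ r ∧ r < 65 → s'.reg r = s.reg r := by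
  have hm := hw.mem
  have hth := hw.thr
  have hsm := hw.small
  have hqb := hw.qb_pos
  have hH : P.n / (16 * P.qb) ≤ P.n := Nat.div_le_self _ _
  have hQ : P.Q ≤ P.Q * P.Q := Nat.le_mul_self _
  refine (Sure.frame (Sure.of_wp ?_)).mono fun s' h => ⟨h.1, fun r hr => h.2 r ?_⟩
  · simp only [setMode, block, wp, reg_setReg, mem_setReg, Nat.reduceEqDiff, reduceIte, hs.r62,
      hl.r4, and_true, ne_eq, one_ne_zero, not_false_eq_true, not_true_eq_false, true_implies,
      false_implies, true_and, Params.Small, Params.H]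
    by_cases hP : P.n < 16 * P.qb
    · have e : P.Q = 8 * P.n := if_pos hP
      simp only [hP, if_true, true_implies, true_and]
      omega
    · have e : P.Q = 8 * P.qb := if_neg hP
      simp only [hP, if_false, false_implies, true_and]
      omega
  · simp only [setMode, block, Avoids]
    omega

theorem setSamples_sure (hw : P.Ok w) (hs : Given P s) (h66 : s.reg 66 = P.Q) :
    Sure w setSamples s setSamples.cost fun s' => (s'.reg 17 = P.Q * P.Q ∧ s'.reg 18 = P.r ∧
      s'.reg 67 = 0 ∧ s'.reg 68 = 1 ∧ (s'.reg 69 = if 1 < P.Q then 1 else 0) ∧ s'.mem = s.mem) ∧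
      ∀ r, r < 17 ∨ 19 ≤ r ∧ r < 67 → s'.reg r = s.reg r := by
  have hth := hw.thr
  have hr := hw.two_r
  have er : P.Q * P.Q * P.l = P.r := rfl
  have hQ : P.Q ≤ P.Q * P.Q := Nat.le_mul_self _
  have hQ' := P.Q_pos hw
  refine (Sure.frame (Sure.of_wp ?_)).mono fun s' h => ⟨h.1, fun r hr => h.2 r ?_⟩
  · simp only [setSamples, block, wp, reg_setReg, mem_setReg, Nat.reduceEqDiff, reduceIte, hs.r63,
      h66, and_true, true_and, er]
    split_ifs <;> omega
  · simp only [setSamples, block, Avoids]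
    omega

/-- The ceiling of the logarithm is the first `i` with `Q ≤ 2 ^ i`; doubling stops there, so the
powers stay below `2 Q`. -/
theorem setLog_sure (hw : P.Ok w) (h15 : s.reg 15 = 1) (h66 : s.reg 66 = P.Q) (h67 : s.reg 67 = 0)
    (h68 : s.reg 68 = 1) (h69 : s.reg 69 = if 1 < P.Q then 1 else 0) :
    Sure w setLog s (P.g * (doublePower.cost + 1) + 1) fun s' =>
      (s'.reg 67 = P.g ∧ s'.mem = s.mem) ∧ ∀ r, r < 67 → s'.reg r = s.reg r := by
  have hth := hw.thr
  have hQ : P.Q ≤ P.Q * P.Q := Nat.le_mul_self _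
  have hQ' := P.Q_pos hw
  have hg : ∀ i, i < P.g ↔ 2 ^ i < P.Q := fun i => Nat.lt_clog_iff_pow_lt (by norm_num)
  refine (Sure.frame (Spec.conseq (Spec.loop (T := doublePower.cost)
    (I := fun k s' => k ≤ P.g ∧ s'.reg 67 = P.g - k ∧
    s'.reg 68 = 2 ^ (P.g - k) ∧ (s'.reg 69 = if P.g - k < P.g then 1 else 0) ∧ s'.reg 15 = 1 ∧
    s'.reg 66 = P.Q ∧ s'.mem = s.mem) (g := fun _ _ => 0) ?_ ?_ ?_ P.g s ?_)
    (Q' := fun s' => s'.reg 67 = P.g ∧ s'.mem = s.mem)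
    (fun s' h => ⟨h.2.1, h.2.2.2.2.2.2⟩) (fun _ _ => le_rfl) le_rfl)).mono
    fun s' h => ⟨h.1, fun r hr => h.2 r ?_⟩
  · rintro s ⟨-, -, -, h, -⟩
    rw [h, if_neg (by omega)]
  · rintro m s ⟨h', -, -, h, -⟩
    rw [h, if_pos (by omega)]
    norm_num
  · rintro m s' ⟨h1, h2, h3, -, h5, h6, h7⟩
    have hlt := (hg (P.g - (m + 1))).mp (by omega)
    have e : P.g - m = P.g - (m + 1) + 1 := by omega
    refine Sure.of_wp ?_
    have hp : 2 ^ (P.g - m) = 2 ^ (P.g - (m + 1)) + 2 ^ (P.g - (m + 1)) := by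
      rw [e, pow_succ]; ring
    have hgm := hg (P.g - m)
    have hlt' := Nat.lt_two_pow_self (n := P.g - (m + 1))
    simp only [doublePower, block, wp, reg_setReg, mem_setReg, Nat.reduceEqDiff, reduceIte, h2, h3, h5,
      h6, h7, and_true, true_and, hp, hgm]
    split_ifs <;> omega
  · rw [Nat.sub_self, h69]
    refine ⟨le_rfl, h67, h68, ?_, h15, h66, rfl⟩
    simp only [hg 0, pow_zero]
  · simp only [doublePower, block, Avoids]
    omega

theorem setSteps_sure (hw : P.Ok w) (h9 : s.reg 9 = if P.Small then 1 else 0)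
    (h15 : s.reg 15 = 1) (h16 : s.reg 16 = 0) (h18 : s.reg 18 = P.r) (h24 : s.reg 24 = P.H)
    (h67 : s.reg 67 = P.g) :
    Sure w setSteps s setSteps.cost fun s' => (s'.reg 50 = P.W ∧ s'.reg 23 = P.b ∧ s'.reg 26 = 0 ∧
      s'.reg 27 = 0 ∧ Fresh s' ∧ s'.mem = s.mem) ∧
      ∀ r, r < 23 ∨ 24 ≤ r ∧ r < 26 → s'.reg r = s.reg r := by
  have hst := hw.steps
  have hr := P.r_pos hw
  have hb := b_lt hw
  have eW : 4 * P.r * (4 * P.g + 3) = P.W := rfl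
  have h1 : 4 * P.r ≤ P.W := Nat.le_mul_of_pos_right _ (by omega)
  have h2 : 4 * P.g + 3 ≤ P.W := Nat.le_mul_of_pos_left _ (by omega)
  refine (Sure.frame (Sure.of_wp ?_)).mono fun s' h => ⟨h.1, fun r hr => h.2 r ?_⟩
  · simp only [setSteps, block, wp, reg_setReg, mem_setReg, Nat.reduceEqDiff, reduceIte, h9, h15,
      h16, h18, h24, h67, and_true, true_and, eW, Fresh]
    by_cases hP : P.Small
    · have e : P.b = P.W := if_pos hP
      simp only [hP, if_true, ne_eq, one_ne_zero, not_false_eq_true, true_implies, false_implies, and_true]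
      omega
    · have e : P.b = P.W / P.H + 1 := if_neg hP
      simp only [hP, if_false, ne_eq, not_true_eq_false, true_implies, false_implies, true_and]
      omega
  · simp only [setSteps, block, Avoids]
    omega

/-- A bound on the time of `setConstants`. -/
def constantsTime (P : Params) : ℕ := setLayout.cost + (setMode.cost +
  (setSamples.cost + (P.g * (doublePower.cost + 1) + 1 + setSteps.cost + 1) + 1) + 1) + 1

theorem setConstants_sure (hw : P.Ok w) (hs : Given P s) :
    Sure w setConstants s (constantsTime P) fun s' => Cfg P s' ∧ s'.reg 50 = P.W ∧ s'.reg 26 = 0 ∧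
      s'.reg 27 = 0 ∧ Fresh s' ∧ s'.mem = s.mem := by
  refine Sure.seq (setLayout_sure hw hs) ?_
  rintro s₁ ⟨⟨hl₁, hm₁⟩, hr₁⟩
  have hs₁ : Given P s₁ := ⟨by rw [hr₁ _ (by omega), hs.r60], by rw [hr₁ _ (by omega), hs.r61],
    by rw [hr₁ _ (by omega), hs.r62], by rw [hr₁ _ (by omega), hs.r63],
    by rw [hr₁ _ (by omega), hs.r64]⟩
  refine Sure.seq (setMode_sure hw hs₁ hl₁) ?_
  rintro s₂ ⟨⟨h9, h24, h25, h66, hm₂⟩, hr₂⟩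
  have hs₂ : Given P s₂ := ⟨by rw [hr₂ _ (by omega), hs₁.r60], by rw [hr₂ _ (by omega), hs₁.r61],
    by rw [hr₂ _ (by omega), hs₁.r62], by rw [hr₂ _ (by omega), hs₁.r63],
    by rw [hr₂ _ (by omega), hs₁.r64]⟩
  have hl₂ : Layout P s₂ := hl₁.frame fun r _ => hr₂ r (by omega)
  refine Sure.seq (setSamples_sure hw hs₂ h66) ?_
  rintro s₃ ⟨⟨h17, h18, h67, h68, h69, hm₃⟩, hr₃⟩
  have hl₃ : Layout P s₃ := hl₂.frame fun r _ => hr₃ r (by omega)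
  refine Sure.seq (setLog_sure hw hl₃.r15 (by rw [hr₃ _ (by omega), h66]) h67 h68 h69) ?_
  rintro s₄ ⟨⟨h67', hm₄⟩, hr₄⟩
  have hl₄ : Layout P s₄ := hl₃.frame fun r _ => hr₄ r (by omega)
  have h9' : s₄.reg 9 = if P.Small then 1 else 0 := by
    rw [hr₄ _ (by omega), hr₃ _ (by omega), h9]
  have h24' : s₄.reg 24 = P.H := by rw [hr₄ _ (by omega), hr₃ _ (by omega), h24]
  have h25' : s₄.reg 25 = 2 * P.H := by rw [hr₄ _ (by omega), hr₃ _ (by omega), h25]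
  have h17' : s₄.reg 17 = P.Q * P.Q := by rw [hr₄ _ (by omega), h17]
  have h18' : s₄.reg 18 = P.r := by rw [hr₄ _ (by omega), h18]
  refine (setSteps_sure hw h9' hl₄.r15 hl₄.r16 h18' h24' h67').mono ?_
  rintro s₅ ⟨⟨h50, h23, h26, h27, hf, hm₅⟩, hr₅⟩
  have hl₅ : Layout P s₅ := hl₄.frame fun r _ => hr₅ r (by omega)
  exact ⟨⟨hl₅.r4, hl₅.r5, hl₅.r6, hl₅.r7, hl₅.r8, by rw [hr₅ _ (by omega), h9'], hl₅.r10, hl₅.r11,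
    hl₅.r12, hl₅.r13, hl₅.r14, hl₅.r15, hl₅.r16, by rw [hr₅ _ (by omega), h17'],
    by rw [hr₅ _ (by omega), h18'], hl₅.r19, hl₅.r20, hl₅.r21, hl₅.r22, h23,
    by rw [hr₅ _ (by omega), h24'], by rw [hr₅ _ (by omega), h25']⟩, h50, h26, h27, hf,
    by rw [hm₅, hm₄, hm₃, hm₂, hm₁]⟩

theorem copyArc_avoids {r : ℕ} (hr : r < 37 ∨ 50 ≤ r ∧ r < 73) : copyArc.Avoids r := by
  simp only [copyArc, insertArc, lookup, block, Avoids, true_and, and_true]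
  omega

/-- A bound on the time of `copyArc`. -/
def copyTime : ℕ := 3 + (max (3 + insertArc.cost + 1) 1 + 1) + 1

/-- Cells are processed downwards, so that the counter is the address, and the arcs stored so far
are those with cell number at least `k`. No arc is inserted into a cell that still has to be read,
since the lists lie behind the matrix. -/
theorem copyArc_sure (hw : P.Ok w) {m : ℕ → ℕ} (hG : IsInput G m) {k : ℕ} (hk : k < P.n * P.n)
    (hc : Cfg P s) (h73 : s.reg 73 = k + 1)
    (hE : Stores P.n (fun u v => arcs G u v ∧ k + 1 ≤ u * P.n + v) s.mem)
    (hm : ∀ x, x < P.n * P.n ∨ 3 * (P.n * P.n) + P.n ≤ x → s.mem x = m x) :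
    Sure w copyArc s copyTime fun s' => s'.reg 73 = k ∧
      Stores P.n (fun u v => arcs G u v ∧ k ≤ u * P.n + v) s'.mem ∧
      ∀ x, x < P.n * P.n ∨ 3 * (P.n * P.n) + P.n ≤ x → s'.mem x = m x := by
  have hmem := hw.mem
  have hn := hw.n_pos
  have hu : k / P.n < P.n := by rwa [Nat.div_lt_iff_lt_mul hn]
  have hv : k % P.n < P.n := Nat.mod_lt _ hn
  have huv : k / P.n * P.n + k % P.n = k := by rw [mul_comm]; exact Nat.div_add_mod _ _
  have hadj := hG.adj _ hu _ hv
  rw [huv] at hadj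
  have hE' : ∀ u < P.n, ∀ v < P.n, ((arcs G u v ∧ k + 1 ≤ u * P.n + v) ∨
      (u = k / P.n ∧ v = k % P.n) ∧ arcs G (k / P.n) (k % P.n)) ↔
      (arcs G u v ∧ k ≤ u * P.n + v) := by
    intro u hu' v hv'
    constructor
    · rintro (⟨h1, h2⟩ | ⟨⟨rfl, rfl⟩, h3⟩)
      · exact ⟨h1, by omega⟩
      · exact ⟨h3, huv.ge⟩
    · rintro ⟨h1, h2⟩
      rcases h2.lt_or_eq with h | h
      · exact .inl ⟨h1, h⟩
      · obtain ⟨rfl, rfl⟩ := cell_inj hv hv' (huv.trans h)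
        exact .inr ⟨⟨rfl, rfl⟩, h1⟩
  refine Sure.seq (T₁ := 3) (Q := fun s₁ => (s₁.reg 73 = k ∧ s₁.reg 74 = m k ∧ s₁.mem = s.mem) ∧
    ∀ r, r < 73 → s₁.reg r = s.reg r) ((Sure.frame (P := block [.op .sub 73 73 15, .load 74 73])
    (Q := fun s₁ => s₁.reg 73 = k ∧ s₁.reg 74 = m k ∧ s₁.mem = s.mem) (Sure.of_wp ?_)).mono
    fun s₁ h => ⟨h.1, fun r hr => h.2 r ?_⟩) ?_
  · simp only [block, wp, reg_setReg, mem_setReg, Nat.reduceEqDiff, reduceIte, h73, hc.r15,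
      Nat.add_sub_cancel, and_true, hm k (.inl hk)]
    omega
  · simp only [block, Avoids]
    omega
  rintro s₁ ⟨⟨h73₁, h74, hm₁⟩, hr₁⟩
  have hc₁ : Cfg P s₁ := hc.frame fun r _ _ => hr₁ r (by omega)
  refine Spec.ite (fun h => ?_) fun h => ?_
  · rw [h74, hadj] at h
    refine Spec.mono_time ?_ (le_max_left _ _)
    refine Sure.seq (T₁ := 3) (Q := fun s₂ => (s₂.reg 37 = k / P.n ∧ s₂.reg 38 = k % P.n ∧
      s₂.mem = s₁.mem) ∧ ∀ r, r < 37 ∨ 39 ≤ r → s₂.reg r = s₁.reg r) ((Sure.frame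
      (P := block [.op .div 37 73 4, .op .mod 38 73 4])
      (Q := fun s₂ => s₂.reg 37 = k / P.n ∧ s₂.reg 38 = k % P.n ∧ s₂.mem = s₁.mem)
      (Sure.of_wp ?_)).mono fun s₁ h => ⟨h.1, fun r hr => h.2 r ?_⟩) ?_
    · simp only [block, wp, reg_setReg, mem_setReg, Nat.reduceEqDiff, reduceIte, h73₁, hc₁.r4,
        and_true]
      omega
    · simp only [block, Avoids]
      omega
    rintro s₂ ⟨⟨h37, h38, hm₂⟩, hr₂⟩
    have hc₂ : Cfg P s₂ := hc₁.frame fun r _ _ => hr₂ r (by omega)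
    have hmem₂ : s₂.mem = s.mem := by rw [hm₂, hm₁]
    refine (insertArc_sure hw hc₂ (hmem₂ ▸ hE) hu hv h37 h38).frame.mono ?_
    rintro s₃ ⟨h3, hr₃⟩
    refine ⟨?_, h3.stores.congr (fun u hu' v hv' => ?_) fun _ _ _ => rfl, fun x hx => ?_⟩
    · rw [hr₃ 73 (by simp [insertArc, lookup, block, Avoids]), hr₂ 73 (by omega), h73₁]
    · rw [← hE' u hu' v hv']
      simp only [h, and_true]
    · rw [h3.out x hx, hmem₂, hm x hx]
  · rw [h74, ← not_not (a := m k = 0), ← ne_eq, hadj] at h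
    refine Spec.mono_time (Sure.of_wp (P := .skip) ⟨h73₁, ?_, ?_⟩) (le_max_right _ _)
    · rw [hm₁]
      refine hE.congr (fun u hu' v hv' => ?_) fun _ _ _ => rfl
      rw [← hE' u hu' v hv']
      simp only [h, and_false, or_false]
    · rwa [hm₁]

theorem copyGraph_sure (hw : P.Ok w) (hc : Cfg P s) (hG : IsInput G s.mem) :
    Sure w copyGraph s (1 + (P.n * P.n * (copyTime + 1) + 1) + 1) fun s' => (Stores P.n (arcs G) s'.mem ∧
      ∀ x, 3 * (P.n * P.n) + P.n ≤ x → s'.mem x = 0) ∧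
      ∀ r, r < 37 ∨ 50 ≤ r ∧ r < 73 → s'.reg r = s.reg r := by
  have hmem := hw.mem
  refine (Sure.frame (Q := fun s' => Stores P.n (arcs G) s'.mem ∧
      ∀ x, 3 * (P.n * P.n) + P.n ≤ x → s'.mem x = 0) (Sure.seq (T₁ := 1)
      (T₂ := P.n * P.n * (copyTime + 1) + 1)
    (Q := fun s₁ => s₁.reg 73 = P.n * P.n ∧ s₁.mem = s.mem ∧ ∀ r, r ≠ 73 → s₁.reg r = s.reg r)
    (Sure.of_wp (P := .op .add 73 5 16) ?_) ?_)).mono fun s' h => ⟨h.1, fun r hr => h.2 r ?_⟩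
  · simp only [wp, reg_setReg, mem_setReg, reduceIte, hc.r5, hc.r16, add_zero, true_and]
    exact ⟨by omega, fun r hr => if_neg hr⟩
  · rintro s₁ ⟨h73, hm₁, hr₁⟩
    refine Spec.conseq (Spec.loop (I := fun k s' => k ≤ P.n * P.n ∧ Cfg P s' ∧ s'.reg 73 = k ∧
      Stores P.n (fun u v => arcs G u v ∧ k ≤ u * P.n + v) s'.mem ∧
      ∀ x, x < P.n * P.n ∨ 3 * (P.n * P.n) + P.n ≤ x → s'.mem x = s.mem x) (g := fun _ _ => 0)
      ?_ ?_ ?_ (P.n * P.n) s₁ ?_) (fun s' h => ?_) (fun _ _ => le_rfl) le_rfl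
    · exact fun s h => h.2.2.1
    · intro k s h
      rw [h.2.2.1]
      omega
    · rintro k s₂ ⟨hk, hc₂, h73, hE, hm⟩
      refine (copyArc_sure hw hG hk hc₂ h73 hE hm).frame.mono ?_
      rintro s₃ ⟨⟨h1, h2, h3⟩, h4⟩
      exact ⟨by omega, hc₂.frame fun r _ _ => h4 r (copyArc_avoids (by omega)), h1, h2, h3⟩
    · refine ⟨le_rfl, hc.frame fun r _ _ => hr₁ r (by omega), h73, fun u hu => ⟨fun j hj => ?_,
        fun v hv h => ?_⟩, fun x _ => by rw [hm₁]⟩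
      · rw [hm₁, hG.zero _ (by omega)] at hj
        omega
      · have := cell_lt hu hv
        omega
    · obtain ⟨-, -, -, h1, h2⟩ := h
      refine ⟨?_, fun x hx => by rw [h2 x (.inr hx), hG.zero x (by omega)]⟩
      simpa using h1
  · refine ⟨?_, copyArc_avoids hr⟩
    change r ≠ 73
    omega

/-- A full run of the sampler during preprocessing makes the very first output reliable. The time
bound is chosen before the state and before `c`. -/
theorem setup_spec (hw : P.Ok w) (G : SimpleGraph (Fin P.n)) :
    ∃ T, ∀ s, Given P s → IsInput G s.mem → ∀ c : ℕ, |(numCC G : ℤ) - c| ≤ P.stale →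
      Spec w setup s T (Ready P G) (farFrom P c) (ENNReal.ofReal P.fail) := by
  have hW := hw.steps
  refine ⟨_, fun s hs hG c hc => Sure.seq_spec (setConstants_sure hw hs)
    (T₂ := 1 + (P.n * P.n * (copyTime + 1) + 1) + 1 +
    (P.W * (sampleStep.cost + 1 + 1 + 1) + 1 + publish.cost + 1) + 1) ?_⟩
  rintro s₁ ⟨hc₁, h50, h26, h27, hf, hm₁⟩
  refine Sure.seq_spec (copyGraph_sure hw hc₁ (hm₁ ▸ hG)) ?_
  rintro s₂ ⟨⟨hE, hz⟩, hr₂⟩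
  have hc₂ : Cfg P s₂ := hc₁.frame fun r _ _ => hr₂ r (by omega)
  have hf₂ : Fresh s₂ := hf.congr fun r _ _ => hr₂ r (by omega)
  refine Spec.seq ((((sampleLoop_spec hw hc₂ (hf₂.samplerInv (G := G)) hE (by omega)
    (by rw [hr₂ _ (by omega), h50]) 0).frame).affine (ENNReal.ofReal ((P.J - 1) / P.J))
    (ENNReal.ofReal (1 / P.J))).conseq (fun _ h => h) (fun _ _ => le_rfl) (failWith_le hw
      (ENNReal.ofReal_le_ofReal ?_))) ?_
  · rw [zero_add]
    exact hf₂.potential_le hw le_rfl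
  · rintro s₃ ⟨⟨h3, h4⟩, hr₃⟩
    have hr₃' : ∀ r, r < 30 → s₃.reg r = s₂.reg r := fun r hr =>
      hr₃ r (repeatSample_avoids (.inl hr)).2
    have hc₃ : Cfg P s₃ := hc₂.frame fun r _ _ => hr₃' r (by omega)
    have hE₃ := Stores.keepsOuter hE h4
    change Spec w publish s₃ publish.cost _ _ (failWith P _)
    rw [failWith_ofReal hw (samplerPotential_nonneg _)]
    refine (publish_spec hw hc₃ h3 hE₃ hc).conseq ?_ (fun _ _ => le_rfl) le_rfl
    rintro s₄ ⟨⟨h30, h31, h32, hm₄⟩, hr₄⟩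
    have hr₄' : ∀ r, 1 ≤ r → r < 28 → s₄.reg r = s₃.reg r := fun r h1 h2 =>
      hr₄ r (publish_avoids h1 (by omega))
    refine ⟨hc₃.frame fun r _ _ => hr₄' r (by omega) (by omega), hm₄ ▸ hE₃, ⟨h30, h31, h32⟩, ?_, ?_,
      fun x hx => ?_⟩
    · rw [hr₄' _ (by omega) (by omega), hr₃' _ (by omega), hr₂ _ (by omega), h26]
    · rw [hr₄' _ (by omega) (by omega), hr₃' _ (by omega), hr₂ _ (by omega), h27]
    · rw [hm₄, h4 x (.inr hx), hz x (by omega)]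

end RamProg

/-! ### The algorithms -/

/-- For `1 ≤ p'` the probability bound is void, so the error may be arbitrary; this settles `n = 1`
in the absolute case, where the permitted error is zero. -/
theorem DynamicAlgorithm.MaintainsNumCC.mono {A : DynamicAlgorithm} {w k n T : ℕ} {par : Fin k → ℕ}
    {err err' p p' : ℝ} (h : A.MaintainsNumCC w par n err p T) (hp : p ≤ p')
    (herr : err ≤ err' ∨ 1 ≤ p') : A.MaintainsNumCC w par n err' p' T := by
  obtain ⟨T₀, h⟩ := h
  refine ⟨T₀, fun G => ⟨(h G).1, fun ops => ⟨((h G).2 ops).1, ?_⟩⟩⟩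
  rcases herr with herr | herr
  · refine (ENNReal.ofReal_le_ofReal (by linarith)).trans (((h G).2 ops).2.trans ?_)
    exact MeasureTheory.measure_mono fun s hs => le_trans (hs) herr
  · rw [ENNReal.ofReal_of_nonpos (by linarith)]
    exact zero_le

/-- The length of the binary representation. -/
def bitLength (n : ℕ) : ℕ := (Nat.digits 2 n).length

theorem bitLength_of_pos {n : ℕ} (hn : 0 < n) : bitLength n = bitLength (n / 2) + 1 := by
  rw [bitLength, Nat.digits_def' (by norm_num) hn]
  rfl

/-- The number `q` is the least positive one with `9 * n * e ^ 3 ≤ q ^ 3 * L ^ 2`, where `L` is the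
length of `n`. -/
structure IsRoot (n e q : ℕ) : Prop where
  pos : 1 ≤ q
  le : 9 * n * e ^ 3 ≤ q ^ 3 * bitLength n ^ 2
  lt : ∀ i, 1 ≤ i → i < q → i ^ 3 * bitLength n ^ 2 < 9 * n * e ^ 3

namespace RamProg

open RamState

variable {w : ℕ} {P : Params} {s : RamState}

theorem maintains_of_ready (hw : P.Ok w) {A : DynamicAlgorithm} {k : ℕ} {par : Fin k → ℕ}
    (hA : A.upd = update)
    (hpre : ∀ G : SimpleGraph (Fin P.n), ∃ T₀, ∀ c : ℕ, |(numCC G : ℤ) - c| ≤ P.stale →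
      Spec w A.pre (initialState par G) T₀ (Ready P G) (farFrom P c) (ENNReal.ofReal P.fail)) :
    A.MaintainsNumCC w par P.n P.R P.fail (updateTime P.b) := by
  by_cases hP : P.Small
  · refine maintains_of_small hw hA hP fun G => ?_
    obtain ⟨T₀, h⟩ := hpre G
    exact ⟨T₀, h _ (by simp)⟩
  · exact maintains_of_large hw hA hP hpre

theorem initialState_reg {k n : ℕ} (par : Fin k → ℕ) (G : SimpleGraph (Fin n)) {i : ℕ} (hi : i < k) :
    (initialState par G).reg (i + 2) = par ⟨i, hi⟩ := by
  simp [initialState, hi]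

theorem initialState_reg_one {k n : ℕ} (par : Fin k → ℕ) (G : SimpleGraph (Fin n)) :
    (initialState par G).reg 1 = n := rfl

theorem initialState_reg_eq_zero {k n : ℕ} (par : Fin k → ℕ) (G : SimpleGraph (Fin n)) {r : ℕ}
    (hr : r = 0 ∨ k + 2 ≤ r) : (initialState par G).reg r = 0 := by
  simp only [initialState]
  rw [if_neg (by omega), dif_neg (by omega)]

/-! #### Relative error -/

/-- Copy the parameters. -/
def loadParams : RamProg := block [.op .add 60 1 0, .op .add 61 3 0, .op .add 62 4 0,
  .op .add 63 5 0, .op .add 64 6 0]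

/-- Output `(n + 1) / 2`. -/
def guess : RamProg := block [.const 9 1, .op .add 0 1 9, .const 9 2, .op .div 0 0 9]

/-- The algorithm that is given the numbers `q`, `qb`, `l`, `J`, and a flag that tells whether to use
them. -/
def relativeAlgorithm : DynamicAlgorithm := ⟨.ite 2 (.seq loadParams setup) guess, update⟩

theorem relativeAlgorithm_maintains (hw : P.Ok w) {par : Fin 5 → ℕ}
    (hpar : par = ![1, P.q, P.qb, P.l, P.J]) (hqb : P.qb < 2 ^ w) (hq : P.q < 2 ^ w)
    (hl : P.l < 2 ^ w) :
    relativeAlgorithm.MaintainsNumCC w par P.n P.R P.fail (updateTime P.b) := by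
  refine maintains_of_ready hw rfl fun G => ?_
  have hmem := hw.mem
  have hsh := hw.shift
  have hJ : P.J ≤ P.J * (2 * P.R + 1) := Nat.le_mul_of_pos_right _ (by omega)
  -- Register `0` is still zero at the start and serves as the neutral summand when registers are
  -- copied.
  have h0 : (initialState par G).reg 0 = 0 := initialState_reg_eq_zero _ _ (.inl rfl)
  have h2 : (initialState par G).reg 2 = 1 := by
    rw [initialState_reg par G (i := 0) (by omega), hpar]; rfl
  have h3 : (initialState par G).reg 3 = P.q := by
    rw [initialState_reg par G (i := 1) (by omega), hpar]; rfl
  have h4 : (initialState par G).reg 4 = P.qb := by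
    rw [initialState_reg par G (i := 2) (by omega), hpar]; rfl
  have h5 : (initialState par G).reg 5 = P.l := by
    rw [initialState_reg par G (i := 3) (by omega), hpar]; rfl
  have h6 : (initialState par G).reg 6 = P.J := by
    rw [initialState_reg par G (i := 4) (by omega), hpar]; rfl
  have hload : ∃ s₁, Big w loadParams (initialState par G) loadParams.cost (PMF.pure s₁) ∧
      Given P s₁ ∧ s₁.mem = (initialState par G).mem := by
    have : loadParams.wp w (fun s' => (s'.reg 60 = P.n ∧ s'.reg 61 = P.q ∧ s'.reg 62 = P.qb ∧
        s'.reg 63 = P.l ∧ s'.reg 64 = P.J) ∧ s'.mem = (initialState par G).mem)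
        (initialState par G) := by
      simp only [loadParams, block, wp, reg_setReg, mem_setReg, Nat.reduceEqDiff, reduceIte, h0, h3,
        h4, h5, h6, initialState_reg_one, and_true, add_zero, if_false,
        OfNat.zero_ne_ofNat]
      omega
    obtain ⟨s₁, h1, h2, h3⟩ := exists_big_of_wp this
    exact ⟨s₁, h1, ⟨h2.1, h2.2.1, h2.2.2.1, h2.2.2.2.1, h2.2.2.2.2⟩, h3⟩
  obtain ⟨s₁, hb, hg, hm⟩ := hload
  obtain ⟨T, hT⟩ := setup_spec hw G
  refine ⟨loadParams.cost + T + 1 + 1, fun c hc => Spec.ite (fun _ => ?_) fun h => by omega⟩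
  refine Spec.seq (Q := fun s => s = s₁) (g := fun _ => ENNReal.ofReal P.fail)
    ⟨_, hb, by simp, (PMF.expect_pure _ _).le⟩ ?_
  rintro _ rfl
  exact hT _ hg (hm ▸ isInput_initialState par G) c hc

/-- The number of components lies between `1` and `n`. The update program returns at once because
register `8` was never set, hence the time `2`. -/
theorem relativeAlgorithm_guess {par : Fin 5 → ℕ} (hpar : par 0 = 0) {n : ℕ} (hn : 1 ≤ n)
    (hw : n + 1 < 2 ^ w) {p : ℝ} (hp : 0 ≤ p) :
    relativeAlgorithm.MaintainsNumCC w par n (n / 2) p 2 := by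
  refine DynamicAlgorithm.maintainsNumCC_of_invariant hp (fun _ _ μ =>
    ∀ s ∈ μ.support, s.reg 0 = (n + 1) / 2 ∧ s.reg 8 = 0) (fun G => ?_) ?_ ?_
  · have h2 : (initialState par G).reg 2 = 0 := by
      rw [initialState_reg par G (i := 0) (by omega)]; exact hpar
    have h8 : (initialState par G).reg 8 = 0 := initialState_reg_eq_zero _ _ (.inr (by omega))
    have : guess.wp w (fun s' => s'.reg 0 = (n + 1) / 2 ∧ s'.reg 8 = 0) (initialState par G) := by
      simp only [guess, block, wp, reg_setReg, Nat.reduceEqDiff, reduceIte, h8,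
        initialState_reg_one, and_true, OfNat.zero_ne_ofNat, OfNat.ofNat_ne_zero, if_false,
        OfNat.one_ne_ofNat]
      omega
    obtain ⟨s₁, h1, h3⟩ := exists_big_of_wp this
    refine ⟨_, _, h1.ite_neg h2, fun s hs => ?_⟩
    rw [PMF.support_pure, Set.mem_singleton_iff] at hs
    exact hs ▸ h3
  · intro G ops e μ h
    refine ⟨fun s => PMF.pure (s.receive e), fun s hs => ?_, fun s' hs' => ?_⟩
    · refine Big.ite_neg ?_ (big_of_step fun k => rfl)
      rw [reg_receive s e (by omega)]
      exact (h s hs).2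
    · rw [PMF.mem_support_bind_iff] at hs'
      obtain ⟨s, hs, hs'⟩ := hs'
      rw [PMF.support_pure, Set.mem_singleton_iff] at hs'
      subst hs'
      rw [reg_receive s e (by omega), reg_receive s e (by omega)]
      exact h s hs
  · intro G ops μ h
    refine ⟨fun _ => 0, by rw [PMF.expect_const]; exact zero_le, fun s hs hbad => absurd ?_ hbad⟩
    rw [(h s hs).1]
    have h1 := numCC_le (updatedGraph G ops)
    have h2 := numCC_pos hn (updatedGraph G ops)
    have h3 : 2 * ((n + 1) / 2) ≤ n + 1 := by omega
    have h4 : n ≤ 2 * ((n + 1) / 2) := by omega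
    have h3' : 2 * (((n + 1) / 2 : ℕ) : ℝ) ≤ n + 1 := by exact_mod_cast h3
    have h4' : (n : ℝ) ≤ 2 * (((n + 1) / 2 : ℕ) : ℝ) := by exact_mod_cast h4
    have h1' : (numCC (updatedGraph G ops) : ℝ) ≤ n := by exact_mod_cast h1
    have h2' : (1 : ℝ) ≤ numCC (updatedGraph G ops) := by exact_mod_cast h2
    rw [abs_le]
    constructor <;> linarith

/-! #### Absolute error -/

/-- Start the computation of the length of `n`. -/
def initLength : RamProg := block [.op .add 60 1 0, .const 64 1, .const 61 1, .const 75 2,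
  .op .add 76 1 0, .const 77 0]

/-- Remove one binary digit. -/
def halve : RamProg := block [.op .div 76 76 75, .op .add 77 77 64]

/-- Start the search for `q`. -/
def initRoot (κ : ℕ) : RamProg := block [.const 78 κ, .op .mul 63 78 77, .op .mul 77 77 77,
  .op .mul 79 2 2, .op .mul 79 79 2, .op .mul 79 79 60, .const 78 9, .op .mul 79 79 78,
  .op .lt 80 77 79]

/-- Try the next `q`. -/
def nextRoot : RamProg := block [.op .add 61 61 64, .op .mul 78 61 61, .op .mul 78 78 61,
  .op .mul 78 78 77, .op .lt 80 78 79]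

/-- Compute the parameters from `n` and the inverse of the relative error. -/
def computeParams (κ : ℕ) : RamProg := .seq initLength (.seq (.loop 76 halve)
  (.seq (initRoot κ) (.seq (.loop 80 nextRoot) (.op .add 62 61 80))))

/-- The algorithm that computes its parameters. -/
def absoluteAlgorithm (κ : ℕ) : DynamicAlgorithm := ⟨.seq (computeParams κ) setup, update⟩

theorem computeParams_sure {n e q κ : ℕ} (hn : 1 ≤ n) (he : 1 ≤ e) (hq : IsRoot n e q)
    (hs0 : s.reg 0 = 0) (hs1 : s.reg 1 = n) (hs2 : s.reg 2 = e) (hw1 : n + 9 < 2 ^ w)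
    (hκ : 1 ≤ κ) (hw2 : κ * bitLength n < 2 ^ w) (hw3 : 9 * n * e ^ 3 < 2 ^ w)
    (hw4 : q ^ 3 * bitLength n ^ 2 < 2 ^ w) :
    ∃ T, Sure w (computeParams κ) s T fun s' =>
      Given ⟨n, q, q, κ * bitLength n, 1⟩ s' ∧ s'.mem = s.mem := by
  have hL : 1 ≤ bitLength n := by rw [bitLength_of_pos hn]; omega
  have hL2 : bitLength n ^ 2 = bitLength n * bitLength n := sq _
  have hLq : bitLength n * bitLength n ≤ q ^ 3 * bitLength n ^ 2 := by
    rw [hL2]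
    exact Nat.le_mul_of_pos_left _ (Nat.pow_pos hq.pos)
  have he3 : e * e * e * n * 9 = 9 * n * e ^ 3 := by ring
  refine ⟨_, Sure.seq (T₁ := initLength.cost) (T₂ := n * 0 + (bitLength n * (halve.cost + 1) + 1 +
    ((initRoot κ).cost + ((q - 1) * (nextRoot.cost + 1) + 1 + 1 + 1) + 1) + 1))
    (Q := fun s₁ => (s₁.reg 60 = n ∧ s₁.reg 61 = 1 ∧ s₁.reg 64 = 1 ∧
    s₁.reg 75 = 2 ∧ s₁.reg 76 = n ∧ s₁.reg 77 = 0 ∧ s₁.reg 2 = e ∧ s₁.mem = s.mem)) (Sure.of_wp ?_) ?_⟩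
  · simp only [initLength, block, wp, reg_setReg, mem_setReg, Nat.reduceEqDiff, reduceIte, hs0, hs1,
      hs2, and_true, add_zero, OfNat.zero_ne_ofNat, OfNat.one_ne_ofNat, if_false]
    omega
  rintro s₁ ⟨a60, a61, a64, a75, a76, a77, a2, am⟩
  rw [mul_zero, zero_add]
  refine Sure.seq (Q := fun s₂ => s₂.reg 60 = n ∧ s₂.reg 61 = 1 ∧ s₂.reg 64 = 1 ∧
    s₂.reg 77 = bitLength n ∧ s₂.reg 2 = e ∧ s₂.mem = s.mem) (Spec.conseq (Spec.loop
    (I := fun k s₂ => bitLength (s₂.reg 76) = k ∧ s₂.reg 77 + k = bitLength n ∧ s₂.reg 60 = n ∧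
    s₂.reg 61 = 1 ∧ s₂.reg 64 = 1 ∧ s₂.reg 75 = 2 ∧ s₂.reg 76 ≤ n ∧ s₂.reg 2 = e ∧ s₂.mem = s.mem)
    (g := fun _ _ => 0) (T := halve.cost) ?_ ?_ ?_ (bitLength n) s₁ ?_) ?_ (fun _ _ => le_rfl) le_rfl) ?_
  · rintro s ⟨h, -⟩
    by_contra h'
    rw [bitLength_of_pos (Nat.pos_of_ne_zero h')] at h
    omega
  · rintro m s ⟨h, -⟩ h'
    rw [h'] at h
    simp [bitLength] at h
  · rintro m s₂ ⟨h1, h2, b60, b61, b64, b75, b76, b2, bm⟩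
    have hpos : 0 < s₂.reg 76 := by
      by_contra h'
      rw [Nat.eq_zero_of_not_pos h'] at h1
      simp [bitLength] at h1
    rw [bitLength_of_pos hpos] at h1
    have hLw : bitLength n < 2 ^ w := (Nat.le_mul_of_pos_left _ hκ).trans_lt hw2
    refine Sure.of_wp ?_
    simp only [halve, block, wp, reg_setReg, mem_setReg, Nat.reduceEqDiff, reduceIte, b60, b61, b64,
      b75, b2, bm, and_true, true_and]
    omega
  · exact ⟨by rw [a76], by omega, a60, a61, a64, a75, a76.le, a2, am⟩
  · rintro s' ⟨h1, h2, b60, b61, b64, b75, b76, b2, bm⟩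
    exact ⟨b60, b61, b64, by omega, b2, bm⟩
  rintro s₂ ⟨b60, b61, b64, b77, b2, bm⟩
  refine Sure.seq (Q := fun s₃ => (s₃.reg 60 = n ∧ s₃.reg 61 = 1 ∧ s₃.reg 63 = κ * bitLength n ∧
    s₃.reg 64 = 1 ∧ s₃.reg 77 = bitLength n ^ 2 ∧ s₃.reg 79 = 9 * n * e ^ 3 ∧
    (s₃.reg 80 = if bitLength n ^ 2 < 9 * n * e ^ 3 then 1 else 0) ∧ s₃.mem = s.mem))
    (Sure.of_wp ?_) ?_
  · have hκ' : κ ≤ κ * bitLength n := Nat.le_mul_of_pos_right _ hL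
    have e1 : e * e ≤ e * e * e := Nat.le_mul_of_pos_right _ he
    have e2 : e * e * e ≤ e * e * e * n := Nat.le_mul_of_pos_right _ hn
    simp only [initRoot, block, wp, reg_setReg, mem_setReg, Nat.reduceEqDiff, reduceIte, b60, b61,
      b64, b77, b2, bm, and_true, true_and, if_false, he3, hL2]
    split_ifs <;> omega
  rintro s₃ ⟨c60, c61, c63, c64, c77, c79, c80, cm⟩
  -- Up to `q`, minimality turns the arithmetic test of the loop into the comparison `i < q`, which
  -- identifies the number of iterations.
  have hcase : ∀ i, 1 ≤ i → i ≤ q → (i ^ 3 * bitLength n ^ 2 < 9 * n * e ^ 3 ↔ i < q) := by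
    intro i hi hiq
    rcases hiq.lt_or_eq with h | rfl
    · exact ⟨fun _ => h, fun _ => hq.lt i hi h⟩
    · exact ⟨fun h => absurd hq.le (not_le.mpr h), fun h => absurd h (lt_irrefl _)⟩
  refine Sure.seq (T₁ := (q - 1) * (nextRoot.cost + 1) + 1) (T₂ := 1) (Q := fun s₄ => s₄.reg 60 = n ∧ s₄.reg 61 = q ∧ s₄.reg 63 = κ * bitLength n ∧
    s₄.reg 64 = 1 ∧ s₄.reg 80 = 0 ∧ s₄.mem = s.mem) (Spec.conseq (Spec.loop
    (I := fun k s₄ => k < q ∧ s₄.reg 60 = n ∧ s₄.reg 61 = q - k ∧ s₄.reg 63 = κ * bitLength n ∧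
    s₄.reg 64 = 1 ∧ s₄.reg 77 = bitLength n ^ 2 ∧ s₄.reg 79 = 9 * n * e ^ 3 ∧
    (s₄.reg 80 = if q - k < q then 1 else 0) ∧ s₄.mem = s.mem)
    (g := fun _ _ => 0) (T := nextRoot.cost) ?_ ?_ ?_ (q - 1) s₃ ?_) ?_ (fun _ _ => le_rfl) le_rfl) ?_
  · rintro s ⟨-, -, -, -, -, -, -, h, -⟩
    rw [h, if_neg (by omega)]
  · rintro m s ⟨h', -, -, -, -, -, -, h, -⟩
    rw [h, if_pos (by omega)]
    norm_num
  · rintro m s₄ ⟨h1, d60, d61, d63, d64, d77, d79, -, dm⟩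
    have hi : q - (m + 1) + 1 = q - m := by omega
    have hle : (q - m) ^ 3 * bitLength n ^ 2 ≤ q ^ 3 * bitLength n ^ 2 :=
      Nat.mul_le_mul_right _ (Nat.pow_le_pow_left (by omega) 3)
    have hp : (q - m) ^ 3 * bitLength n ^ 2 = (q - m) * (q - m) * (q - m) * bitLength n ^ 2 := by ring
    have hc := hcase (q - m) (by omega) (by omega)
    have hpos : 0 < q - m := by omega
    have hLpos : 0 < bitLength n ^ 2 := Nat.pow_pos hL
    have e1 : (q - m) * (q - m) * (q - m) ≤ (q - m) * (q - m) * (q - m) * bitLength n ^ 2 :=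
      Nat.le_mul_of_pos_right _ hLpos
    have e2 : (q - m) * (q - m) ≤ (q - m) * (q - m) * (q - m) := Nat.le_mul_of_pos_right _ hpos
    have e3 : q - m ≤ (q - m) * (q - m) := Nat.le_mul_of_pos_right _ hpos
    rw [hp] at hc hle
    refine Sure.of_wp ?_
    simp only [nextRoot, block, wp, reg_setReg, mem_setReg, Nat.reduceEqDiff, reduceIte, d60, d61,
      d63, d64, d77, d79, dm, and_true, true_and, if_false, hi]
    split_ifs <;> omega
  · refine ⟨by have := hq.pos; omega, c60, by have := hq.pos; omega, c63, c64, c77, c79, ?_, cm⟩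
    have := hcase 1 le_rfl hq.pos
    rw [one_pow, one_mul] at this
    rw [c80, show q - (q - 1) = 1 by have := hq.pos; omega]
    simp only [this]
  · rintro s' ⟨-, d60, d61, d63, d64, -, -, d80, dm⟩
    exact ⟨d60, by simpa using d61, d63, d64, by simpa using d80, dm⟩
  rintro s₄ ⟨d60, d61, d63, d64, d80, dm⟩
  have hqw : q < 2 ^ w := by
    refine lt_of_le_of_lt ?_ hw4
    calc q ≤ q ^ 3 := Nat.le_self_pow (by norm_num) q
      _ ≤ _ := Nat.le_mul_of_pos_right _ (Nat.pow_pos hL)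
  refine (Sure.of_wp (P := .op .add 62 61 80) (Q := fun s₅ => s₅.reg 60 = n ∧ s₅.reg 61 = q ∧
    s₅.reg 62 = q ∧ s₅.reg 63 = κ * bitLength n ∧ s₅.reg 64 = 1 ∧ s₅.mem = s.mem) ?_).mono
    fun s₅ h => ⟨⟨h.1, h.2.1, h.2.2.1, h.2.2.2.1, h.2.2.2.2.1⟩, h.2.2.2.2.2⟩
  simp only [wp, reg_setReg, mem_setReg, reduceIte, Nat.reduceEqDiff, d60, d61, d63, d64, d80, dm,
    add_zero, and_true, if_false]
  exact hqw

theorem absoluteAlgorithm_maintains {n e q κ : ℕ} (hn : 1 ≤ n) (he : 1 ≤ e) (hq : IsRoot n e q)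
    {par : Fin 1 → ℕ} (hpar : par 0 = e) (hP : P = ⟨n, q, q, κ * bitLength n, 1⟩) (hw : P.Ok w)
    (hw1 : n + 9 < 2 ^ w) (hκ : 1 ≤ κ) (hw2 : κ * bitLength n < 2 ^ w)
    (hw3 : 9 * n * e ^ 3 < 2 ^ w) (hw4 : q ^ 3 * bitLength n ^ 2 < 2 ^ w) :
    (absoluteAlgorithm κ).MaintainsNumCC w par P.n P.R P.fail (updateTime P.b) := by
  refine maintains_of_ready hw rfl fun G => ?_
  subst hP
  obtain ⟨T₁, h1⟩ := computeParams_sure (s := initialState par G) hn he hq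
    (initialState_reg_eq_zero _ _ (.inl rfl)) (initialState_reg_one _ _)
    ((initialState_reg par G (i := 0) (by omega)).trans hpar) hw1 hκ hw2 hw3 hw4
  obtain ⟨T₂, h2⟩ := setup_spec hw G
  refine ⟨T₁ + T₂ + 1, fun c hc => Sure.seq_spec h1 ?_⟩
  rintro s₁ ⟨hg, hm⟩
  exact h2 s₁ hg (hm ▸ isInput_initialState par G) c hc

end RamProg

/-! ### Size and time bounds -/

namespace Params

variable {P : Params} {w : ℕ}

/-- All intermediate quantities are polynomial in `N`; the exponents are added up, and `W ≤ N ^ 18`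
is the largest. -/
theorem ok_of_le {N : ℕ} (hN : 2 ≤ N) (hw : N ^ 20 ≤ 2 ^ w) (hn : 1 ≤ P.n) (hn' : P.n ≤ N)
    (hqb : 1 ≤ P.qb) (hqb' : P.qb ≤ N) (hl : 1 ≤ P.l)
    (hl' : P.l ≤ N) (hJ : 1 ≤ P.J) (hJ' : P.J ≤ N) (hc : 2 * P.Rb + 1 ≤ P.J * (2 * P.R + 1)) :
    P.Ok w := by
  have lt : ∀ a, a ≤ N ^ 19 → a < 2 ^ w := fun a h => by
    refine (h.trans_lt ?_).trans_le hw
    exact Nat.pow_lt_pow_right (by omega) (by norm_num)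
  have up : ∀ {a : ℕ} {i j : ℕ}, a ≤ N ^ i → i ≤ j → a ≤ N ^ j := fun h hij =>
    h.trans (Nat.pow_le_pow_right (by omega) hij)
  have mul : ∀ {a b i j : ℕ}, a ≤ N ^ i → b ≤ N ^ j → a * b ≤ N ^ (i + j) := fun h h' => by
    rw [pow_add]; exact Nat.mul_le_mul h h'
  have add : ∀ {a b i : ℕ}, a ≤ N ^ i → b ≤ N ^ i → a + b ≤ N ^ (i + 1) := fun h h' => by
    rw [pow_succ]
    nlinarith
  have h2 : 2 ≤ N ^ 1 := by simpa using hN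
  have h3 : 3 ≤ N ^ 2 := by nlinarith
  have h4 : 4 ≤ N ^ 2 := by nlinarith
  have h1 : 1 ≤ N ^ 1 := by omega
  have h8 : 8 ≤ N ^ 3 := by nlinarith
  have h16 : 16 ≤ N ^ 4 := by nlinarith
  have n1 : P.n ≤ N ^ 1 := by simpa using hn'
  have qb1 : P.qb ≤ N ^ 1 := by simpa using hqb'
  have l1 : P.l ≤ N ^ 1 := by simpa using hl'
  have J1 : P.J ≤ N ^ 1 := by simpa using hJ'
  have R1 : P.R ≤ N ^ 1 := (Nat.div_le_self _ _).trans n1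
  have Q4 : P.Q ≤ N ^ 4 := by
    unfold Q
    split_ifs
    exacts [mul h8 n1, mul h8 qb1]
  have r9 : P.r ≤ N ^ 9 := mul (mul Q4 Q4) l1
  have g4 : P.g ≤ N ^ 4 := by
    refine le_trans (Nat.clog_le_of_le_pow ?_) Q4
    exact Nat.lt_two_pow_self.le
  have W18 : P.W ≤ N ^ 18 := mul (mul h4 r9) (add (mul h4 g4) (up h3 (by norm_num)))
  exact ⟨hn, hqb, hl, hJ,
    lt _ (up (add (up (add (mul h3 (mul n1 n1)) (up (mul (show 6 ≤ N ^ 3 by omega) n1) le_rfl))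
      le_rfl) (up h1 (by norm_num))) (by norm_num)),
    lt _ (up (mul h4 (mul Q4 Q4)) (by norm_num)),
    lt _ (up (add (mul h2 (mul (mul r9 Q4) n1)) (up r9 (by norm_num))) (by norm_num)),
    lt _ (up (add (up (add (mul Q4 n1) (up (mul J1 (add (mul h2 R1) (up h1 (by norm_num)))) (by norm_num)))
      le_rfl) (up R1 (by norm_num))) (by norm_num)),
    lt _ (up (mul h16 qb1) (by norm_num)), lt _ (add W18 (up h1 (by norm_num))),
    lt _ (up (mul h2 r9) (by norm_num)), hc⟩

theorem Q_le_qb : P.Q ≤ 128 * P.qb := by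
  unfold Q
  split_ifs with h
  · unfold Small at h
    omega
  · omega

theorem Q_le_n : P.Q ≤ 8 * P.n := by
  unfold Q
  split_ifs with h
  · exact le_rfl
  · unfold Small at h
    omega

theorem two_pow_g_lt (hw : P.Ok w) : 2 ^ P.g < 2 * P.Q := by
  have h1 : 1 < P.Q := by
    have := hw.n_pos
    have := hw.qb_pos
    unfold Q
    split_ifs <;> omega
  have h2 := Nat.pow_pred_clog_lt_self (b := 2) (by norm_num) h1
  have h3 : 0 < P.g := Nat.clog_pos (by norm_num) h1
  have h4 : 2 ^ P.g = 2 * 2 ^ (P.g - 1) := by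
    rw [← pow_succ', Nat.sub_add_cancel h3]
  change 2 ^ (P.g - 1) < P.Q at h2
  omega

/-- For a small graph `b = W`, where `Q² = 64 n²` and `n³ ≤ (16 qb)³`, which gives the factor `2 ^
20`. For a large graph `n ≤ 32 qb H` turns division by `H` into division by `n`. -/
theorem b_le (hw : P.Ok w) :
    (P.b : ℝ) ≤ 1 + 2 ^ 20 * (P.qb ^ 3 * P.l * (4 * P.g + 3)) / P.n := by
  have hn : (0 : ℝ) < P.n := by exact_mod_cast hw.n_pos
  have hq : (0 : ℝ) < P.qb := by exact_mod_cast hw.qb_pos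
  have hg : (0 : ℝ) ≤ P.l * (4 * P.g + 3) := by positivity
  by_cases hP : P.Small
  · have hb : P.b = 4 * (8 * P.n * (8 * P.n) * P.l) * (4 * P.g + 3) := by
      rw [b, if_pos hP, W, r, Q, if_pos hP]
    have h1 : (P.n : ℝ) ≤ 16 * P.qb := by
      unfold Small at hP
      exact_mod_cast hP.le
    have h2 : (P.n : ℝ) ^ 3 ≤ (16 * P.qb) ^ 3 := by gcongr
    have h3 : (P.b : ℝ) ≤ 2 ^ 20 * (P.qb ^ 3 * P.l * (4 * P.g + 3)) / P.n := by
      rw [le_div_iff₀ hn, hb]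
      push_cast
      nlinarith [mul_le_mul_of_nonneg_right h2 hg]
    linarith
  · have hH : 0 < P.H := Nat.div_pos (not_lt.mp hP) (by have := hw.qb_pos; omega)
    have hH' : (0 : ℝ) < P.H := by exact_mod_cast hH
    have h1 : P.n ≤ 32 * P.qb * P.H := by
      have h := Nat.lt_div_mul_add (a := P.n) (show 0 < 16 * P.qb by have := hw.qb_pos; omega)
      change P.n < P.H * (16 * P.qb) + 16 * P.qb at h
      have : 16 * P.qb ≤ P.H * (16 * P.qb) := Nat.le_mul_of_pos_left _ hH
      have e : 32 * P.qb * P.H = 2 * (P.H * (16 * P.qb)) := by ring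
      omega
    have h1' : (P.n : ℝ) ≤ 32 * P.qb * P.H := by exact_mod_cast h1
    have hW : P.W = 4 * (8 * P.qb * (8 * P.qb) * P.l) * (4 * P.g + 3) := by
      rw [W, r, Q, if_neg hP]
    have h2 : ((P.W / P.H : ℕ) : ℝ) ≤ 2 ^ 20 * (P.qb ^ 3 * P.l * (4 * P.g + 3)) / P.n := by
      refine Nat.cast_div_le.trans ?_
      rw [div_le_div_iff₀ hH' hn, hW]
      push_cast
      have h4 : (0 : ℝ) ≤ P.qb ^ 2 * (P.l * (4 * P.g + 3)) := by positivity
      have h5 := mul_le_mul_of_nonneg_left h1' h4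
      have h6 : (0 : ℝ) ≤ P.qb ^ 2 * (P.l * (4 * P.g + 3)) * (P.qb * P.H) := by positivity
      nlinarith
    rw [b, if_neg hP]
    push_cast
    linarith

end Params

theorem RamProg.updateTime_le (b : ℕ) : RamProg.updateTime b ≤ RamProg.updateTime 1 * (b + 1) := by
  unfold RamProg.updateTime RamProg.repeatTime
  nlinarith [Nat.zero_le (RamProg.sampleStep.cost * b), Nat.zero_le b]

/-- Natural numbers that bound the word length. -/
theorem exists_nat_bound {x : ℝ} (hx : 3 ≤ x) : ∃ Y : ℕ, 3 ≤ Y ∧ x ≤ Y ∧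
    ∀ k w : ℕ, x ^ (2 * k) ≤ 2 ^ w → Y ^ k ≤ 2 ^ w := by
  refine ⟨⌈x⌉₊, ?_, Nat.le_ceil x, fun k w h => ?_⟩
  · exact_mod_cast hx.trans (Nat.le_ceil x)
  · have h1 : (⌈x⌉₊ : ℝ) ≤ x ^ 2 := by
      have := (Nat.ceil_lt_add_one (show 0 ≤ x by linarith)).le
      nlinarith
    have h2 : (⌈x⌉₊ : ℝ) ^ k ≤ (2 : ℝ) ^ w := by
      refine (pow_le_pow_left₀ (Nat.cast_nonneg _) h1 k).trans ?_
      rwa [← pow_mul]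
    exact_mod_cast h2

/-! ### The choice of parameters for a relative error -/

/-- The inverse of the relative error. -/
noncomputable def inverseError (ε : ℝ) : ℕ := ⌈1 / ε⌉₊

/-- The number of offsets. -/
noncomputable def offsets (ε p : ℝ) : ℕ :=
  if p < 1 / 2 then 1 else min ⌊1 / (2 * (1 - p))⌋₊ (inverseError ε)

/-- The logarithm of the inverse of the failure probability of the estimator. -/
noncomputable def logFailure (p : ℝ) : ℕ := if p < 1 / 2 then ⌈Real.log (3 / p)⌉₊ else 2

/-- The parameters for a relative error. -/
noncomputable def relativeParams (n : ℕ) (ε p : ℝ) : Params where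
  n := n
  q := inverseError ε
  qb := 3 * inverseError ε / offsets ε p + 1
  l := logFailure p
  J := offsets ε p

section

variable {n : ℕ} {ε p : ℝ}

theorem inverseError_pos (hε : 0 < ε) : 1 ≤ inverseError ε :=
  Nat.one_le_iff_ne_zero.mpr (Nat.ceil_pos.mpr (by positivity)).ne'

theorem inverseError_le (hε : 0 < ε) (hε' : ε < 1) : (inverseError ε : ℝ) ≤ 2 / ε := by
  have h1 := (Nat.ceil_lt_add_one (show 0 ≤ 1 / ε by positivity)).le
  have h2 : 1 ≤ 1 / ε := by rw [le_div_iff₀ hε]; linarith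
  have h3 : 2 / ε = 1 / ε + 1 / ε := by ring
  unfold inverseError
  linarith

theorem offsets_pos (hε : 0 < ε) (hp : p < 1) : 1 ≤ offsets ε p := by
  unfold offsets
  split_ifs with h
  · exact le_rfl
  · refine le_min (Nat.le_floor ?_) (inverseError_pos hε)
    rw [Nat.cast_one, le_div_iff₀ (by linarith)]
    linarith

theorem offsets_le (hε : 0 < ε) : offsets ε p ≤ inverseError ε := by
  unfold offsets
  split_ifs
  exacts [inverseError_pos hε, min_le_right _ _]

theorem logFailure_pos (hp : 0 < p) : 1 ≤ logFailure p := by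
  unfold logFailure
  split_ifs with h
  · refine Nat.one_le_iff_ne_zero.mpr (Nat.ceil_pos.mpr (Real.log_pos ?_)).ne'
    rw [lt_div_iff₀ hp]
    linarith
  · norm_num

theorem log_three_lt : Real.log 3 < 2 := by
  have := Real.log_lt_sub_one_of_pos (show (0 : ℝ) < 3 by norm_num) (by norm_num)
  linarith

theorem log_three_div (hp : 0 < p) : Real.log (3 / p) = Real.log 3 + Real.log (1 / p) := by
  rw [Real.log_div (by norm_num) hp.ne', Real.log_div (by norm_num) hp.ne', Real.log_one]
  ring

/-- The choice `qb = 3 q / J + 1` gives `qb J ≥ 3 q`. The factor `3`, instead of `1`, absorbs the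
floors in the radii `n / qb` and `n / q` when the windows have to cover. -/
theorem relativeParams_ok {Y w : ℕ} (hn : 1 ≤ n) (hε : 0 < ε) (hp : 0 < p) (hp' : p < 1)
    (hY : 3 ≤ Y) (hX : 2 + (n : ℝ) + 1 / ε + Real.log (1 / p) ≤ Y) (hw : (Y ^ 3) ^ 20 ≤ 2 ^ w) :
    (relativeParams n ε p).Ok w ∧ inverseError ε ≤ Y ^ 3 ∧
      3 * inverseError ε / offsets ε p + 1 ≤ Y ^ 3 ∧ logFailure p ≤ Y ^ 3 := by
  have hlog : 0 < Real.log (1 / p) := Real.log_pos (by rw [lt_div_iff₀ hp]; linarith)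
  have hε1 : 0 < 1 / ε := by positivity
  have hn0 : (1 : ℝ) ≤ n := by exact_mod_cast hn
  have hnY : n ≤ Y := by
    have : (n : ℝ) ≤ Y := by linarith
    exact_mod_cast this
  have hqY : inverseError ε ≤ Y := Nat.ceil_le.mpr (by linarith)
  have hJ := offsets_pos hε hp'
  have hJq := offsets_le (p := p) hε
  have hq := inverseError_pos hε
  have hY3 : 9 * Y ≤ Y ^ 3 := by
    have : 3 * 3 ≤ Y * Y := Nat.mul_le_mul hY hY
    calc 9 * Y ≤ Y * Y * Y := Nat.mul_le_mul_right _ this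
      _ = Y ^ 3 := by ring
  have hqb : 3 * inverseError ε / offsets ε p ≤ 3 * inverseError ε := Nat.div_le_self _ _
  have hlY : logFailure p ≤ Y := by
    unfold logFailure
    split_ifs
    · refine Nat.ceil_le.mpr ?_
      rw [log_three_div hp]
      linarith [log_three_lt]
    · omega
  have hl := logFailure_pos hp
  refine ⟨Params.ok_of_le (N := Y ^ 3) (by omega) hw hn (by change n ≤ _; omega) ?_ ?_ hl ?_ hJ ?_ ?_,
    by omega, by omega, by omega⟩
  · exact Nat.le_add_left _ _
  · change 3 * inverseError ε / offsets ε p + 1 ≤ _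
    omega
  · change logFailure p ≤ _
    omega
  · change offsets ε p ≤ _
    omega
  · change 2 * (n / (3 * inverseError ε / offsets ε p + 1)) + 1 ≤
      offsets ε p * (2 * (n / inverseError ε) + 1)
    generalize hqb' : 3 * inverseError ε / offsets ε p + 1 = qb
    have h1 := Nat.lt_div_mul_add (a := 3 * inverseError ε) (show 0 < offsets ε p by omega)
    have h2 : 3 * inverseError ε ≤ qb * offsets ε p := by
      rw [← hqb', Nat.add_mul, one_mul]
      exact h1.le
    generalize inverseError ε = q at *
    generalize offsets ε p = J at *
    have h3 := Nat.div_mul_le_self n qb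
    have h4 := Nat.lt_div_mul_add (a := n) (show 0 < q by omega)
    generalize n / qb = A at *
    generalize n / q = B at *
    have h5 : 3 * A * q < (B + 1) * J * q := by
      calc 3 * A * q = A * (3 * q) := by ring
        _ ≤ A * (qb * J) := Nat.mul_le_mul_left _ h2
        _ = A * qb * J := by ring
        _ ≤ n * J := Nat.mul_le_mul_right _ h3
        _ < (B * q + q) * J := Nat.mul_lt_mul_of_pos_right h4 (by omega)
        _ = (B + 1) * J * q := by ring
    have h6 := Nat.lt_of_mul_lt_mul_right h5
    have h7 : J * (2 * B + 1) = (B + 1) * J + B * J := by ring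
    omega

/-- For `p < 1/2` there is one offset, and `3 exp (-l) ≤ p`. Otherwise the estimator fails with
probability at most `1/2`, so the total is at most `1 - 1 / (2 J)`, which is at most `p` because `J
≤ 1 / (2 (1 - p))`. -/
theorem relativeParams_fail_le (hε : 0 < ε) (hp : 0 < p) (hp' : p < 1) :
    (relativeParams n ε p).fail ≤ p := by
  change ((offsets ε p : ℝ) - 1 + 3 * Real.exp (-(logFailure p : ℝ))) / offsets ε p ≤ p
  have hJ : (1 : ℝ) ≤ offsets ε p := by exact_mod_cast offsets_pos hε hp'
  by_cases h : p < 1 / 2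
  · rw [offsets, logFailure, if_pos h, if_pos h]
    have h1 : Real.exp (-(⌈Real.log (3 / p)⌉₊ : ℝ)) ≤ p / 3 := by
      have : p / 3 = Real.exp (-Real.log (3 / p)) := by
        rw [← Real.log_inv, Real.exp_log (by positivity), inv_div]
      rw [this]
      exact Real.exp_le_exp.mpr (neg_le_neg (Nat.le_ceil _))
    simp only [Nat.cast_one, sub_self, zero_add, div_one]
    linarith
  · have h1 : (offsets ε p : ℝ) ≤ 1 / (2 * (1 - p)) := by
      refine le_trans ?_ (Nat.floor_le (by have : 0 < 1 - p := by linarith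
                                           positivity))
      rw [offsets, if_neg h]
      exact_mod_cast min_le_left _ _
    rw [le_div_iff₀ (by linarith)] at h1
    have h2 : 3 * Real.exp (-(2 : ℝ)) ≤ 1 / 2 := by
      have h3 : (6 : ℝ) ≤ Real.exp 2 := by
        have := Real.exp_one_gt_d9
        have h4 : Real.exp 2 = Real.exp 1 * Real.exp 1 := by rw [← Real.exp_add]; norm_num
        rw [h4]
        nlinarith
      rw [Real.exp_neg]
      have := inv_anti₀ (by norm_num) h3
      linarith
    rw [logFailure, if_neg h, div_le_iff₀ (by linarith)]
    push_cast
    linarith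

theorem relativeParams_R_le (hε : 0 < ε) : ((relativeParams n ε p).R : ℝ) ≤ ε * n := by
  change ((n / inverseError ε : ℕ) : ℝ) ≤ ε * n
  have h1 : 1 / ε ≤ inverseError ε := Nat.le_ceil _
  have h2 : (0 : ℝ) < inverseError ε := by exact_mod_cast inverseError_pos hε
  refine Nat.cast_div_le.trans ?_
  rw [div_le_iff₀ h2]
  rw [div_le_iff₀ hε] at h1
  have : (0 : ℝ) ≤ n := Nat.cast_nonneg n
  nlinarith

theorem log_two_le_log_inv {x : ℝ} (hx : 0 < x) (hx' : x ≤ 1 / 2) :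
    Real.log 2 ≤ Real.log (1 / x) :=
  Real.log_le_log (by norm_num) (by rw [le_div_iff₀ hx]; linarith)

/-- Either the work is as claimed, or the base error is constant. -/
theorem relativeParams_work_le (hε : 0 < ε) (hε' : ε < 1 / 2) (hp : 0 < p) (hp' : p < 1) :
    ((relativeParams n ε p).qb = 4 ∧ (relativeParams n ε p).l = 2) ∨
    ((relativeParams n ε p).qb : ℝ) ^ 3 * (relativeParams n ε p).l ≤
      2 ^ 12 * (Real.log (1 / p) / ε ^ 3) := by
  change (3 * inverseError ε / offsets ε p + 1 = 4 ∧ logFailure p = 2) ∨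
    ((3 * inverseError ε / offsets ε p + 1 : ℕ) : ℝ) ^ 3 * logFailure p ≤ _
  have hq : (1 : ℝ) ≤ inverseError ε := by exact_mod_cast inverseError_pos hε
  have hq' := inverseError_le hε (by linarith)
  have hJ : (1 : ℝ) ≤ offsets ε p := by exact_mod_cast offsets_pos hε hp'
  have hJq : (offsets ε p : ℝ) ≤ inverseError ε := by exact_mod_cast offsets_le hε
  have hq3 : (inverseError ε : ℝ) ^ 3 ≤ 8 / ε ^ 3 := by
    calc (inverseError ε : ℝ) ^ 3 ≤ (2 / ε) ^ 3 := by gcongr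
      _ = 8 / ε ^ 3 := by rw [div_pow]; norm_num
  have hμ : 0 ≤ Real.log (1 / p) := Real.log_nonneg (by rw [le_div_iff₀ hp]; linarith)
  have hqb : ((3 * inverseError ε / offsets ε p + 1 : ℕ) : ℝ) ≤
      4 * inverseError ε / offsets ε p := by
    push_cast
    have h1 : ((3 * inverseError ε / offsets ε p : ℕ) : ℝ) ≤ 3 * inverseError ε / offsets ε p := by
      exact_mod_cast Nat.cast_div_le (α := ℝ) (m := 3 * inverseError ε) (n := offsets ε p)
    have h2 : (1 : ℝ) ≤ inverseError ε / offsets ε p := by rwa [le_div_iff₀ (by linarith), one_mul]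
    have h3 : (4 * inverseError ε / offsets ε p : ℝ) = 3 * inverseError ε / offsets ε p +
      inverseError ε / offsets ε p := by ring
    linarith
  -- The coarser error saves a factor `J³` of work; a single factor `J` is enough to match `log
  -- (1/p)`.
  have key : ∀ y : ℝ, (logFailure p : ℝ) / offsets ε p ≤ y → 
      ((3 * inverseError ε / offsets ε p + 1 : ℕ) : ℝ) ^ 3 * logFailure p ≤
        64 * (8 / ε ^ 3) * y := by
    intro y hy
    have h1 : (1 : ℝ) / (offsets ε p : ℝ) ^ 3 ≤ 1 / offsets ε p := by
      gcongr
      exact le_self_pow₀ hJ (by norm_num)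
    calc ((3 * inverseError ε / offsets ε p + 1 : ℕ) : ℝ) ^ 3 * logFailure p
        ≤ (4 * inverseError ε / offsets ε p) ^ 3 * logFailure p := by gcongr
      _ = 64 * (inverseError ε : ℝ) ^ 3 * logFailure p * (1 / (offsets ε p : ℝ) ^ 3) := by
        field_simp; ring
      _ ≤ 64 * (inverseError ε : ℝ) ^ 3 * logFailure p * (1 / offsets ε p) := by gcongr
      _ = 64 * (inverseError ε : ℝ) ^ 3 * (logFailure p / offsets ε p) := by ring
      _ ≤ 64 * (8 / ε ^ 3) * y := by gcongr
  by_cases h : p < 1 / 2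
  · right
    have h2 := log_two_le_log_inv hp h.le
    have h3 := Real.log_two_gt_d9
    have h4 : (logFailure p : ℝ) / offsets ε p ≤ 8 * Real.log (1 / p) := by
      rw [offsets, logFailure, if_pos h, if_pos h, Nat.cast_one, div_one]
      have h5 : 0 ≤ Real.log (3 / p) := Real.log_nonneg (by rw [le_div_iff₀ hp]; linarith)
      have h6 := (Nat.ceil_lt_add_one h5).le
      rw [log_three_div hp] at h6 h5 ⊢
      linarith [log_three_lt]
    refine (key _ h4).trans (le_of_eq (by ring))
  · by_cases hJ' : offsets ε p = inverseError ε
    · left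
      refine ⟨?_, if_neg h⟩
      rw [hJ', Nat.mul_div_cancel _ (inverseError_pos hε)]
    · right
      have hl : logFailure p = 2 := if_neg h
      have hfl : offsets ε p = ⌊1 / (2 * (1 - p))⌋₊ := by
        rw [offsets, if_neg h] at hJ' ⊢
        omega
      have h1p : 0 < 1 - p := by linarith
      have h4 : (logFailure p : ℝ) / offsets ε p ≤ 8 * Real.log (1 / p) := by
        have h5 : 1 - p ≤ Real.log (1 / p) := by
          have := Real.one_sub_inv_le_log_of_pos (show 0 < 1 / p by positivity)
          rwa [one_div, inv_inv, ← one_div] at this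
        have h6 : 1 / (2 * (1 - p)) < offsets ε p + 1 := by
          rw [hfl]; exact Nat.lt_floor_add_one _
        -- Taking the floor at most halves a number that is at least one.
        have h7 : 1 / (4 * (1 - p)) ≤ (offsets ε p : ℝ) := by
          have : 1 / (2 * (1 - p)) = 2 * (1 / (4 * (1 - p))) := by field_simp; norm_num
          linarith
        rw [div_le_iff₀ (by positivity)] at h7
        rw [hl, div_le_iff₀ (by linarith)]
        push_cast
        nlinarith
      refine (key _ h4).trans (le_of_eq (by ring))

/-- `2 ^ g` is at most `2 ^ 11 / ε`; the additive constants are absorbed into `log (1/ε)`, which is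
at least `log 2` as `ε < 1/2`. -/
theorem relativeParams_log_le {w : ℕ} (hw : (relativeParams n ε p).Ok w) (hε : 0 < ε)
    (hε' : ε < 1 / 2) :
    4 * ((relativeParams n ε p).g : ℝ) + 3 ≤ 77 * Real.log (1 / ε) := by
  have h1 := Params.two_pow_g_lt hw
  have h2 := (relativeParams n ε p).Q_le_qb
  have hqb : (relativeParams n ε p).qb ≤ 4 * inverseError ε := by
    change 3 * inverseError ε / offsets ε p + 1 ≤ _
    have := Nat.div_le_self (3 * inverseError ε) (offsets ε p)
    have := inverseError_pos hε
    omega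
  have h3 : 2 ^ (relativeParams n ε p).g ≤ 1024 * inverseError ε := by omega
  have h3' : (2 : ℝ) ^ (relativeParams n ε p).g ≤ 1024 * inverseError ε := by exact_mod_cast h3
  have h4 : (2 : ℝ) ^ (relativeParams n ε p).g ≤ 2 ^ 11 * (1 / ε) := by
    have := inverseError_le hε (by linarith)
    refine h3'.trans ?_
    calc 1024 * (inverseError ε : ℝ) ≤ 1024 * (2 / ε) := by gcongr
      _ = 2 ^ 11 * (1 / ε) := by ring
  have h5 := Real.log_le_log (by positivity) h4
  rw [Real.log_mul (by norm_num) (by positivity), Real.log_pow, Real.log_pow] at h5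
  have h6 := log_two_le_log_inv hε hε'.le
  have h7 := Real.log_two_gt_d9
  push_cast at h5
  have h8 : ((relativeParams n ε p).g : ℝ) * 0.69 ≤ (relativeParams n ε p).g * Real.log 2 := by
    gcongr; linarith
  linarith

theorem relativeParams_b_le {w : ℕ} (hw : (relativeParams n ε p).Ok w) (hε : 0 < ε)
    (hε' : ε < 1 / 2) (hp : 0 < p) (hp' : p < 1) :
    ((relativeParams n ε p).b : ℝ) ≤ 2 ^ 40 *
      max 1 (Real.log (1 / ε) * Real.log (1 / p) / (ε ^ 3 * n)) := by
  have hn : (1 : ℝ) ≤ n := by exact_mod_cast hw.n_pos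
  have hb := Params.b_le hw
  change _ ≤ 1 + _ / (n : ℝ) at hb
  have hM := le_max_left 1 (Real.log (1 / ε) * Real.log (1 / p) / (ε ^ 3 * n))
  rcases relativeParams_work_le (n := n) hε hε' hp hp' with ⟨h1, h2⟩ | h1
  · have hg : (relativeParams n ε p).g ≤ 10 := by
      have h3 := Params.two_pow_g_lt hw
      have h4 := (relativeParams n ε p).Q_le_qb
      have h5 : 2 ^ (relativeParams n ε p).g < 2 ^ 11 := by omega
      have := (Nat.pow_lt_pow_iff_right (by norm_num : 1 < 2)).mp h5
      omega
    have hg' : ((relativeParams n ε p).g : ℝ) ≤ 10 := by exact_mod_cast hg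
    rw [h1, h2] at hb
    push_cast at hb
    have h6 : 2 ^ 20 * ((4 : ℝ) ^ 3 * 2 * (4 * (relativeParams n ε p).g + 3)) / n ≤
        2 ^ 20 * ((4 : ℝ) ^ 3 * 2 * (4 * (relativeParams n ε p).g + 3)) :=
      div_le_self (by positivity) hn
    linarith
  · have hμ : 0 ≤ Real.log (1 / p) := Real.log_nonneg (by rw [le_div_iff₀ hp]; linarith)
    have hM' := le_max_right 1 (Real.log (1 / ε) * Real.log (1 / p) / (ε ^ 3 * n))
    have h2 := relativeParams_log_le hw hε hε'
    have h3 : 2 ^ 20 * (((relativeParams n ε p).qb : ℝ) ^ 3 * (relativeParams n ε p).l *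
        (4 * (relativeParams n ε p).g + 3)) / n ≤
        2 ^ 32 * 77 * (Real.log (1 / ε) * Real.log (1 / p) / (ε ^ 3 * n)) := by
      calc _ ≤ 2 ^ 20 * (2 ^ 12 * (Real.log (1 / p) / ε ^ 3) * (77 * Real.log (1 / ε))) / n := by
            gcongr
        _ = _ := by field_simp
    linarith

end

/-- The algorithm with relative error. -/
theorem exists_relative_algorithm : ∃ (A : DynamicAlgorithm) (k : ℕ) (par : ℝ → ℝ → Fin k → ℕ)
    (C : ℝ) (K : ℕ), ∀ (n : ℕ) (ε p : ℝ) (w : ℕ), 1 ≤ n → 0 < ε → ε < 1 → 0 < p → p < 1 →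
      (2 + (n : ℝ) + 1 / ε + Real.log (1 / p)) ^ K ≤ 2 ^ w →
      (∀ i, par ε p i < 2 ^ w) ∧
      ∃ T : ℕ, (T : ℝ) ≤ C * max 1 (Real.log (1 / ε) * Real.log (1 / p) / (ε ^ 3 * n)) ∧
        A.MaintainsNumCC w (par ε p) n (ε * n) p T := by
  classical
  refine ⟨RamProg.relativeAlgorithm, 5, fun ε p => ![if ε < 1 / 2 then 1 else 0, inverseError ε,
    3 * inverseError ε / offsets ε p + 1, logFailure p, offsets ε p],
    -- The exponent needs `Y ^ 60`, with a little slack, for a natural number `Y` above the real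
    -- base; the factor `2` pays for rounding the base up.
    RamProg.updateTime 1 * (2 ^ 40 + 1) + 2, 2 * 63, fun n ε p w hn hε hε' hp hp' => ?_⟩
  have hlog : 0 < Real.log (1 / p) := Real.log_pos (by rw [lt_div_iff₀ hp]; linarith)
  have hε1 : 0 < 1 / ε := by positivity
  have hn0 : (1 : ℝ) ≤ n := by exact_mod_cast hn
  obtain ⟨Y, hY, hXY, hYw⟩ := exists_nat_bound (x := 2 + (n : ℝ) + 1 / ε + Real.log (1 / p))
    (by linarith)
  have hY1 : 1 < Y := by omega
  have hY0 : 0 < Y := by omega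
  intro hw
  have hYw' := hYw 63 w hw
  clear hw
  have h60 : (Y ^ 3) ^ 20 ≤ 2 ^ w := by
    rw [← pow_mul]
    exact (Nat.pow_le_pow_right hY0 (by norm_num)).trans hYw'
  have hle : Y ^ 3 < 2 ^ w := (Nat.pow_lt_pow_right hY1 (by norm_num)).trans_le hYw'
  obtain ⟨hok, h1, h2, h3⟩ := relativeParams_ok hn hε hp hp' hY hXY h60
  have hoff := offsets_le (p := p) hε
  refine ⟨fun i => ?_, ?_⟩
  · fin_cases i
    · change (if ε < 1 / 2 then 1 else 0) < 2 ^ w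
      have : 3 ^ 3 ≤ Y ^ 3 := Nat.pow_le_pow_left hY 3
      split_ifs <;> omega
    · exact h1.trans_lt hle
    · exact h2.trans_lt hle
    · exact h3.trans_lt hle
    · exact (hoff.trans h1).trans_lt hle
  · have hM := le_max_left 1 (Real.log (1 / ε) * Real.log (1 / p) / (ε ^ 3 * n))
    generalize hMe : max 1 (Real.log (1 / ε) * Real.log (1 / p) / (ε ^ 3 * n)) = M at hM ⊢
    by_cases hh : ε < 1 / 2
    · refine ⟨RamProg.updateTime (relativeParams n ε p).b, ?_, ?_⟩
      · have hb := relativeParams_b_le hok hε hh hp hp'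
        rw [hMe] at hb
        have := RamProg.updateTime_le (relativeParams n ε p).b
        have h4 : (RamProg.updateTime (relativeParams n ε p).b : ℝ) ≤
            RamProg.updateTime 1 * ((relativeParams n ε p).b + 1) := by exact_mod_cast this
        calc _ ≤ (RamProg.updateTime 1 : ℝ) * ((relativeParams n ε p).b + 1) := h4
          _ ≤ RamProg.updateTime 1 * (2 ^ 40 * M + M) := by gcongr
          _ = RamProg.updateTime 1 * (2 ^ 40 + 1) * M := by ring
          _ ≤ _ := by gcongr; linarith
      · refine (RamProg.relativeAlgorithm_maintains hok ?_ (h2.trans_lt hle) (h1.trans_lt hle)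
          (h3.trans_lt hle)).mono (relativeParams_fail_le hε hp hp') (.inl (relativeParams_R_le hε))
        simp only [hh, if_true]
        rfl
    -- Here `log (1/ε)` may be arbitrarily small, so only constant time is allowed; the error `n /
    -- 2` is at most `ε n`.
    · refine ⟨2, ?_, (RamProg.relativeAlgorithm_guess (if_neg hh) hn ?_ hp.le).mono le_rfl
        (.inl ?_)⟩
      · have : (0 : ℝ) ≤ RamProg.updateTime 1 := Nat.cast_nonneg _
        push_cast
        nlinarith
      · have := hok.mem
        change 3 * (n * n) + 6 * n + 1 < 2 ^ w at this
        omega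
      · have : (0 : ℝ) ≤ n := by linarith
        nlinarith

/-! ### The choice of parameters for an absolute error -/

section

variable {n e q κ : ℕ}

theorem bitLength_pos (hn : 1 ≤ n) : 1 ≤ bitLength n := by
  rw [bitLength_of_pos hn]
  omega

theorem lt_two_pow_bitLength (n : ℕ) : n < 2 ^ bitLength n :=
  Nat.lt_base_pow_length_digits (by norm_num)

theorem two_pow_bitLength_le (hn : 1 ≤ n) : 2 ^ bitLength n ≤ 2 * n :=
  Nat.base_pow_length_digits_le 2 n (by norm_num) (by omega)

theorem bitLength_le (hn : 1 ≤ n) : bitLength n ≤ n := by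
  have h1 := two_pow_bitLength_le hn
  have h2 := bitLength_pos hn
  obtain ⟨m, hm⟩ := Nat.exists_eq_add_of_le' h2
  rw [hm, pow_succ] at h1
  have := Nat.lt_two_pow_self (n := m)
  omega

theorem bitLength_sq_le (hn : 1 ≤ n) : bitLength n ^ 2 ≤ 4 * n := by
  have h1 := two_pow_bitLength_le hn
  have key : ∀ m : ℕ, m ^ 2 ≤ 2 * 2 ^ m := by
    intro m
    induction m using Nat.strong_induction_on with
    | _ m ih =>
      rcases lt_or_ge m 4 with h | h
      · interval_cases m <;> norm_num
      · obtain ⟨i, rfl⟩ := Nat.exists_eq_add_of_le' (show 1 ≤ m by omega)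
        have := ih i (by omega)
        rw [pow_succ 2 i]
        nlinarith
  have := key (bitLength n)
  omega

theorem log_le_bitLength (hn : 1 ≤ n) : Real.log n ≤ bitLength n := by
  have hn0 : (0 : ℝ) < n := by exact_mod_cast hn
  have h1 : (n : ℝ) ≤ 2 ^ bitLength n := by exact_mod_cast (lt_two_pow_bitLength n).le
  have h2 := Real.log_le_log hn0 h1
  rw [Real.log_pow] at h2
  have h3 : (0 : ℝ) ≤ bitLength n := Nat.cast_nonneg _
  nlinarith [Real.log_two_lt_d9]

theorem bitLength_le_log (hn : 2 ≤ n) : (bitLength n : ℝ) ≤ 3 * Real.log n := by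
  have hn0 : (2 : ℝ) ≤ n := by exact_mod_cast hn
  have h1 : (2 : ℝ) ^ bitLength n ≤ 2 * n := by exact_mod_cast two_pow_bitLength_le (by omega)
  have h2 := Real.log_le_log (by positivity) h1
  rw [Real.log_pow, Real.log_mul (by norm_num) (by linarith)] at h2
  have h3 := Real.log_le_log (by norm_num) hn0
  have h4 := Real.log_two_gt_d9
  have h5 : (bitLength n : ℝ) * 0.69 ≤ bitLength n * Real.log 2 := by gcongr; linarith
  linarith

theorem exists_isRoot (hn : 1 ≤ n) (he : 1 ≤ e) : ∃ q, IsRoot n e q := by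
  classical
  have hX : 1 ≤ 9 * n * e ^ 3 := Nat.one_le_iff_ne_zero.mpr (by positivity)
  have hL := bitLength_pos hn
  have h : ∃ q, 1 ≤ q ∧ 9 * n * e ^ 3 ≤ q ^ 3 * bitLength n ^ 2 := by
    refine ⟨9 * n * e ^ 3, hX, ?_⟩
    calc 9 * n * e ^ 3 ≤ (9 * n * e ^ 3) ^ 3 := Nat.le_self_pow (by norm_num) _
      _ ≤ _ := Nat.le_mul_of_pos_right _ (Nat.pow_pos hL)
  refine ⟨Nat.find h, (Nat.find_spec h).1, (Nat.find_spec h).2, fun i hi hlt => ?_⟩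
  have := Nat.find_min h hlt
  push Not at this
  exact this hi

/-- Minimality at `q - 1 ≥ q / 2` costs a factor `8`. If `q = 1` there is no predecessor, and the
square of the bit length is compared with `n` directly. -/
theorem IsRoot.mul_le (hq : IsRoot n e q) (hn : 1 ≤ n) (he : 1 ≤ e) :
    q ^ 3 * bitLength n ^ 2 ≤ 76 * n * e ^ 3 := by
  have h1 := hq.pos
  have he3 : 1 ≤ e ^ 3 := Nat.one_le_pow _ _ he
  rcases h1.eq_or_lt with h | h
  · rw [← h, one_pow, one_mul]
    have := bitLength_sq_le hn
    nlinarith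
  · have h2 := hq.lt (q - 1) (by omega) (by omega)
    have h3 : q ^ 3 ≤ 8 * (q - 1) ^ 3 := by
      calc q ^ 3 ≤ (2 * (q - 1)) ^ 3 := Nat.pow_le_pow_left (by omega) 3
        _ = 8 * (q - 1) ^ 3 := by ring
    calc q ^ 3 * bitLength n ^ 2 ≤ 8 * (q - 1) ^ 3 * bitLength n ^ 2 := Nat.mul_le_mul_right _ h3
      _ = 8 * ((q - 1) ^ 3 * bitLength n ^ 2) := by ring
      _ ≤ 8 * (9 * n * e ^ 3) := Nat.mul_le_mul_left _ h2.le
      _ ≤ 76 * n * e ^ 3 := by nlinarith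

theorem IsRoot.le_mul (hq : IsRoot n e q) (hn : 1 ≤ n) (he : 1 ≤ e) : q ≤ 76 * n * e ^ 3 := by
  calc q ≤ q ^ 3 := Nat.le_self_pow (by norm_num) _
    _ ≤ q ^ 3 * bitLength n ^ 2 := Nat.le_mul_of_pos_right _ (Nat.pow_pos (bitLength_pos hn))
    _ ≤ _ := hq.mul_le hn he

/-- The parameters for an absolute error. -/
def absoluteParams (n q κ : ℕ) : Params := ⟨n, q, q, κ * bitLength n, 1⟩

theorem absoluteParams_ok {Y w : ℕ} (hn : 1 ≤ n) (he : 1 ≤ e) (hq : IsRoot n e q) (hκ : 1 ≤ κ)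
    (hY : 3 ≤ Y) (hnY : n ≤ Y) (heY : e ≤ Y) (hw : (Y ^ (8 + κ)) ^ 20 ≤ 2 ^ w) :
    (absoluteParams n q κ).Ok w ∧ n + 9 < 2 ^ w ∧ κ * bitLength n < 2 ^ w ∧
      9 * n * e ^ 3 < 2 ^ w ∧ q ^ 3 * bitLength n ^ 2 < 2 ^ w ∧ e < 2 ^ w := by
  have hX : 76 * n * e ^ 3 ≤ Y ^ 8 := by
    calc 76 * n * e ^ 3 ≤ 3 ^ 4 * n * e ^ 3 := by gcongr; norm_num
      _ ≤ Y ^ 4 * Y * Y ^ 3 := by gcongr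
      _ = Y ^ 8 := by ring
  have hY0 : 0 < Y := by omega
  have hY1 : 1 < Y := by omega
  have hN : Y ^ 8 ≤ Y ^ (8 + κ) := Nat.pow_le_pow_right hY0 (by omega)
  have hlt : Y ^ (8 + κ) < 2 ^ w := by
    refine lt_of_lt_of_le ?_ hw
    rw [← pow_mul]
    exact Nat.pow_lt_pow_right hY1 (by omega)
  have hL : κ * bitLength n ≤ Y ^ (8 + κ) := by
    have h1 : κ ≤ Y ^ κ := (Nat.lt_pow_self hY1).le
    calc κ * bitLength n ≤ Y ^ κ * Y ^ 8 :=
          Nat.mul_le_mul h1 ((bitLength_le hn).trans (hnY.trans (Nat.le_self_pow (by norm_num) _)))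
      _ = Y ^ (8 + κ) := by ring
  have hY8 : Y + 9 ≤ Y ^ 8 := by
    calc Y + 9 ≤ Y * 3 + 3 * 3 := by omega
      _ ≤ Y * Y + Y * Y := Nat.add_le_add (Nat.mul_le_mul_left _ hY) (Nat.mul_le_mul hY hY)
      _ = 2 * Y ^ 2 := by ring
      _ ≤ Y * Y ^ 2 := Nat.mul_le_mul_right _ (by omega)
      _ = Y ^ 3 := by ring
      _ ≤ Y ^ 8 := Nat.pow_le_pow_right hY0 (by norm_num)
  have hqN := hq.le_mul hn he
  have hq1 := hq.pos
  have hL1 := bitLength_pos hn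
  have hmul := hq.mul_le hn he
  have h9 : 9 * n * e ^ 3 ≤ 76 * n * e ^ 3 := by gcongr; norm_num
  have h2N : 2 ≤ Y ^ (8 + κ) := by omega
  refine ⟨Params.ok_of_le h2N hw hn ?_ hq1 ?_ ?_ hL le_rfl ?_ ?_, ?_⟩
  · change n ≤ _
    omega
  · change q ≤ _
    omega
  · exact Nat.mul_pos hκ hL1
  · change 1 ≤ _
    omega
  · change 2 * (n / q) + 1 ≤ 1 * (2 * (n / q) + 1)
    omega
  · clear hw
    omega

/-- The confidence `l` and the logarithm `g` each contribute one bit length; `q³ L²` was chosen to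
be of order `n e³`, which cancels `n`. -/
theorem absoluteParams_b_le {w : ℕ} (hw : (absoluteParams n q κ).Ok w) (he : 1 ≤ e)
    (hq : IsRoot n e q) : ((absoluteParams n q κ).b : ℝ) ≤ 2 ^ 31 * (κ + 1) * e ^ 3 := by
  have hn : 1 ≤ n := hw.n_pos
  have hn0 : (1 : ℝ) ≤ n := by exact_mod_cast hn
  have he0 : (1 : ℝ) ≤ e := by exact_mod_cast he
  have hL := bitLength_pos hn
  have hb := Params.b_le hw
  change _ ≤ 1 + 2 ^ 20 * ((q : ℝ) ^ 3 * (κ * bitLength n : ℕ) * _) / (n : ℝ) at hb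
  have hg : (absoluteParams n q κ).g ≤ 3 + bitLength n := by
    have h1 := Params.two_pow_g_lt hw
    have h2 : (absoluteParams n q κ).Q ≤ 8 * n := (absoluteParams n q κ).Q_le_n
    have h3 := lt_two_pow_bitLength n
    have h4 : 2 ^ (absoluteParams n q κ).g < 2 ^ (4 + bitLength n) := by
      rw [pow_add]
      omega
    have := (Nat.pow_lt_pow_iff_right (by norm_num : 1 < 2)).mp h4
    omega
  have hg' : 4 * ((absoluteParams n q κ).g : ℝ) + 3 ≤ 19 * bitLength n := by
    exact_mod_cast (by omega : 4 * (absoluteParams n q κ).g + 3 ≤ 19 * bitLength n)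
  have hm : (q : ℝ) ^ 3 * bitLength n ^ 2 ≤ 76 * n * e ^ 3 := by
    exact_mod_cast hq.mul_le hn he
  have h5 : 2 ^ 20 * ((q : ℝ) ^ 3 * (κ * bitLength n : ℕ) * (4 * (absoluteParams n q κ).g + 3)) / n ≤
      2 ^ 20 * 19 * 76 * κ * e ^ 3 := by
    rw [div_le_iff₀ (by linarith)]
    calc _ ≤ 2 ^ 20 * ((q : ℝ) ^ 3 * (κ * bitLength n : ℕ) * (19 * bitLength n)) := by gcongr
      _ = 2 ^ 20 * 19 * κ * ((q : ℝ) ^ 3 * bitLength n ^ 2) := by push_cast; ring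
      _ ≤ 2 ^ 20 * 19 * κ * (76 * n * e ^ 3) := by gcongr
      _ = _ := by ring
  have h6 : (1 : ℝ) ≤ e ^ 3 := one_le_pow₀ he0
  have h7 : (0 : ℝ) ≤ κ * e ^ 3 := by positivity
  have h8 : (2 : ℝ) ^ 31 * (κ + 1) * e ^ 3 = 2 ^ 31 * (κ * e ^ 3) + 2 ^ 31 * e ^ 3 := by ring
  have h9 : (2 : ℝ) ^ 20 * 19 * 76 * κ * e ^ 3 = 2 ^ 20 * 19 * 76 * (κ * e ^ 3) := by ring
  rw [h8]
  rw [h9] at h5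
  linarith

/-- Since `log n` is at most the bit length, the summand `⌈c⌉₊` yields `n ^ (-c)`; the extra `2`
absorbs the factor `3`. -/
theorem absoluteParams_fail_le {c : ℝ} (hn : 1 ≤ n) :
    (absoluteParams n q (⌈c⌉₊ + 2)).fail ≤ 1 / (n : ℝ) ^ c := by
  change (((1 : ℕ) : ℝ) - 1 + 3 * Real.exp (-(((⌈c⌉₊ + 2) * bitLength n : ℕ) : ℝ))) / (1 : ℕ) ≤ _
  have hn0 : (1 : ℝ) ≤ n := by exact_mod_cast hn
  have hL : (1 : ℝ) ≤ bitLength n := by exact_mod_cast bitLength_pos hn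
  have hlog := log_le_bitLength hn
  have hlog0 := Real.log_nonneg hn0
  have h1 : 3 * Real.exp (-(2 : ℝ)) ≤ 1 := by
    have h3 : (3 : ℝ) ≤ Real.exp 2 := by
      have := Real.add_one_le_exp (2 : ℝ)
      linarith
    rw [Real.exp_neg]
    have := inv_anti₀ (by norm_num) h3
    linarith
  have h2 : 1 / (n : ℝ) ^ c = Real.exp (-(c * Real.log n)) := by
    rw [Real.rpow_def_of_pos (by linarith), one_div, ← Real.exp_neg, mul_comm]
  have h3 : c * Real.log n ≤ ⌈c⌉₊ * bitLength n := by
    calc c * Real.log n ≤ ⌈c⌉₊ * Real.log n := by gcongr; exact Nat.le_ceil c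
      _ ≤ _ := by gcongr
  rw [h2]
  push_cast
  rw [sub_self, zero_add, div_one]
  calc 3 * Real.exp (-((⌈c⌉₊ + 2) * bitLength n : ℝ))
      ≤ 3 * Real.exp (-(2 : ℝ) + -(c * Real.log n)) := by
        gcongr
        linarith
    _ = 3 * Real.exp (-(2 : ℝ)) * Real.exp (-(c * Real.log n)) := by rw [Real.exp_add, mul_assoc]
    _ ≤ 1 * Real.exp (-(c * Real.log n)) := by gcongr
    _ = _ := one_mul _

/-- Both sides are cubed. The `9` in `IsRoot` is the square of the `3` that compares the bit length
with `log n`. -/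
theorem absoluteParams_R_le {ε : ℝ} (hn : 2 ≤ n) (hε : 0 < ε) (he : 1 / ε ≤ e) (hq : IsRoot n e q) :
    ((absoluteParams n q κ).R : ℝ) ≤ ε * (n : ℝ) ^ (2 / 3 : ℝ) * Real.log n ^ (2 / 3 : ℝ) := by
  change ((n / q : ℕ) : ℝ) ≤ _
  have hn0 : (2 : ℝ) ≤ n := by exact_mod_cast hn
  have hq0 : (0 : ℝ) < q := by exact_mod_cast hq.pos
  have hlog : 0 < Real.log n := Real.log_pos (by linarith)
  refine Nat.cast_div_le.trans ?_
  refine le_of_pow_le_pow_left₀ (n := 3) (by norm_num) (by positivity) ?_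
  have cube : ∀ x : ℝ, 0 ≤ x → (x ^ (2 / 3 : ℝ)) ^ 3 = x ^ 2 := by
    intro x hx
    rw [← Real.rpow_natCast, ← Real.rpow_mul hx, ← Real.rpow_natCast]
    norm_num
  rw [mul_pow, mul_pow, cube _ (by linarith), cube _ hlog.le, div_pow, div_le_iff₀ (by positivity)]
  have h1 : (9 : ℝ) * n * e ^ 3 ≤ q ^ 3 * bitLength n ^ 2 := by exact_mod_cast hq.le
  have h2 : (bitLength n : ℝ) ^ 2 ≤ (3 * Real.log n) ^ 2 := by
    gcongr
    exact bitLength_le_log hn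
  have h3 : 1 ≤ ε ^ 3 * (e : ℝ) ^ 3 := by
    rw [← mul_pow]
    refine one_le_pow₀ ?_
    rwa [div_le_iff₀ hε, mul_comm] at he
  have h4 : (n : ℝ) * e ^ 3 ≤ q ^ 3 * Real.log n ^ 2 := by
    have := mul_le_mul_of_nonneg_left h2 (show (0 : ℝ) ≤ q ^ 3 by positivity)
    rw [mul_pow] at this
    linarith
  calc (n : ℝ) ^ 3 ≤ n ^ 3 * (ε ^ 3 * (e : ℝ) ^ 3) := le_mul_of_one_le_right (by positivity) h3
    _ = ε ^ 3 * n ^ 2 * (n * e ^ 3) := by ring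
    _ ≤ ε ^ 3 * n ^ 2 * (q ^ 3 * Real.log n ^ 2) := by gcongr
    _ = _ := by ring

/-- Here `ε` may exceed one, in which case the ceiling of `1 / ε` is `1`; the maximum covers both
ranges. -/
theorem inverseError_cube_le {ε : ℝ} (hε : 0 < ε) :
    (inverseError ε : ℝ) ^ 3 ≤ 8 * max 1 ((ε ^ 3)⁻¹) := by
  have hε1 : 0 < 1 / ε := by positivity
  have h6 : (inverseError ε : ℝ) ≤ 2 * max 1 (1 / ε) := by
    have := (Nat.ceil_lt_add_one hε1.le).le
    have := le_max_left 1 (1 / ε)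
    have := le_max_right 1 (1 / ε)
    unfold inverseError
    linarith
  have h7 : max 1 (1 / ε) ^ 3 ≤ max 1 ((ε ^ 3)⁻¹) := by
    rcases le_total 1 (1 / ε) with h | h
    · rw [max_eq_right h, one_div, inv_pow]
      exact le_max_right _ _
    · rw [max_eq_left h, one_pow]
      exact le_max_left _ _
  calc (inverseError ε : ℝ) ^ 3 ≤ (2 * max 1 (1 / ε)) ^ 3 := by gcongr
    _ = 8 * max 1 (1 / ε) ^ 3 := by ring
    _ ≤ _ := by gcongr

end

/-- The algorithm with absolute error. -/
theorem exists_absolute_algorithm (c : ℝ) : ∃ (A : DynamicAlgorithm) (k : ℕ)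
    (par : ℝ → Fin k → ℕ) (C : ℝ) (K : ℕ), ∀ (n : ℕ) (ε : ℝ) (w : ℕ), 1 ≤ n → 0 < ε →
      (2 + (n : ℝ) + 1 / ε) ^ K ≤ 2 ^ w →
      (∀ i, par ε i < 2 ^ w) ∧
      ∃ T : ℕ, (T : ℝ) ≤ C * max 1 ((ε ^ 3)⁻¹) ∧
        A.MaintainsNumCC w (par ε) n
          (ε * (n : ℝ) ^ (2 / 3 : ℝ) * Real.log n ^ (2 / 3 : ℝ)) (1 / (n : ℝ) ^ c) T := by
  obtain ⟨κ, hκ⟩ : ∃ κ, κ = ⌈c⌉₊ + 2 := ⟨_, rfl⟩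
  have hκ1 : 1 ≤ κ := by omega
  refine ⟨RamProg.absoluteAlgorithm κ, 1, fun ε _ => inverseError ε,
    RamProg.updateTime 1 * (2 ^ 34 * (κ + 1) + 1), 2 * ((8 + κ) * 20), fun n ε w hn hε => ?_⟩
  have hε1 : 0 < 1 / ε := by positivity
  have hn0 : (1 : ℝ) ≤ n := by exact_mod_cast hn
  obtain ⟨Y, hY, hXY, hYw⟩ := exists_nat_bound (x := 2 + (n : ℝ) + 1 / ε) (by linarith)
  have hnY : n ≤ Y := by
    have : (n : ℝ) ≤ Y := by linarith
    exact_mod_cast this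
  have heY : inverseError ε ≤ Y := Nat.ceil_le.mpr (by linarith)
  have he := inverseError_pos hε
  intro hw
  have hYw' := hYw _ w hw
  clear hw
  rw [pow_mul] at hYw'
  obtain ⟨q, hq⟩ := exists_isRoot hn he
  obtain ⟨hok, h1, h2, h3, h4, h5⟩ := absoluteParams_ok hn he hq hκ1 hY hnY heY hYw'
  refine ⟨fun _ => h5, RamProg.updateTime (absoluteParams n q κ).b, ?_, ?_⟩
  · have hM := le_max_left 1 ((ε ^ 3)⁻¹)
    have hb := absoluteParams_b_le hok he hq
    have he3 := inverseError_cube_le hε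
    generalize max 1 ((ε ^ 3)⁻¹) = M at hM he3 ⊢
    have h8 : (RamProg.updateTime (absoluteParams n q κ).b : ℝ) ≤
        RamProg.updateTime 1 * ((absoluteParams n q κ).b + 1) := by
      exact_mod_cast RamProg.updateTime_le (absoluteParams n q κ).b
    calc _ ≤ (RamProg.updateTime 1 : ℝ) * ((absoluteParams n q κ).b + 1) := h8
      _ ≤ RamProg.updateTime 1 * (2 ^ 31 * (κ + 1) * (8 * M) + M) := by
        gcongr
        exact hb.trans (by gcongr)
      _ = _ := by ring
  · refine (RamProg.absoluteAlgorithm_maintains hn he hq rfl rfl hok h1 hκ1 h2 h3 h4).mono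
      (hκ ▸ absoluteParams_fail_le hn) ?_
    -- For `n = 1` the permitted error is zero, but so is the required success probability.
    rcases hn.eq_or_lt with h | h
    · right
      rw [← h]
      simp
    · exact .inl (absoluteParams_R_le h hε (Nat.le_ceil _) hq)

theorem mainTheorem8 :
    -- additive error `ε n`: one algorithm for all `n`, `ε`, `p` and all sufficiently long words
    (∃ (A : DynamicAlgorithm) (k : ℕ) (par : ℝ → ℝ → Fin k → ℕ) (C : ℝ) (K : ℕ),
      ∀ (n : ℕ) (ε p : ℝ) (w : ℕ), 1 ≤ n → 0 < ε → ε < 1 → 0 < p → p < 1 →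
        (2 + (n : ℝ) + 1 / ε + Real.log (1 / p)) ^ K ≤ 2 ^ w →
        (∀ i, par ε p i < 2 ^ w) ∧
        ∃ T : ℕ,
          (T : ℝ) ≤ C * max 1 (Real.log (1 / ε) * Real.log (1 / p) / (ε ^ 3 * n)) ∧
          A.MaintainsNumCC w (par ε p) n (ε * n) p T) ∧
    -- additive error `ε n ^ (2/3) (log n) ^ (2/3)`
    (∀ c : ℝ, 1 ≤ c →
      ∃ (A : DynamicAlgorithm) (k : ℕ) (par : ℝ → Fin k → ℕ) (C : ℝ) (K : ℕ),
        ∀ (n : ℕ) (ε : ℝ) (w : ℕ), 1 ≤ n → 0 < ε →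
          (2 + (n : ℝ) + 1 / ε) ^ K ≤ 2 ^ w →
          (∀ i, par ε i < 2 ^ w) ∧
          ∃ T : ℕ,
            (T : ℝ) ≤ C * max 1 ((ε ^ 3)⁻¹) ∧
            A.MaintainsNumCC w (par ε) n
              (ε * (n : ℝ) ^ (2 / 3 : ℝ) * Real.log n ^ (2 / 3 : ℝ)) (1 / (n : ℝ) ^ c) T) :=
  ⟨exists_relative_algorithm, fun c _ => exists_absolute_algorithm c⟩
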